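/- All categories below are small, and a set $I$ is regarded as a discrete category. **Operads.** A (symmetric, coloured) operad $T$ with set of objects $I$ consists of sets $T((i_j)_{1\le j\le n};i)$ of arrows $\alpha:(i_j)_j\to i$, actions $\alpha\mapsto\alpha\rho:(i_{\rho j})_j\to i$ of the permutations $\rho\in\Sigma_n$, units $1_i:(i)\to i$ and composites $\alpha\circ(\beta_j)_j$ that satisfy $\alpha 1=\alpha$, $(\alpha\rho_1)\rho_2=\alpha(\rho_1\rho_2)$, the unit and associativity axioms, and the equivariance axiom $(\alpha\circ(\beta_j)_j)(\rho(\rho_j)_j)=(\alpha\rho)\circ(\beta_{\rho j}\rho_j)_j$, where $\rho(\rho_j)_j$ permutes the blocks by $\rho$ and the elements of the block put in the $j$-th place by $\rho_j$. It is *$\Sigma$-free* when $\alpha\rho\ne\alpha$ for every arrow $\alpha:(i_j)_j\to i$ and every $\rho\neq 1$ with $(i_{\rho j})_j=(i_j)_j$. **Polynomials.** A polynomial from $I$ to $I$ is a diagram of functors $I\xleftarrow{s}E\xrightarrow{p}B\xrightarrow{t}I$, where $p$ is a discrete fibration and a discrete opfibration. A morphism $(s,p,t)\to(s',p',t')$ is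 a pair of functors $(f_1:B\to B',f_2:E\to E')$ with $s'f_2=s$, $t'f_1=t$, and for which the square $p'f_2=f_1p$ is a pullback; a 2-cell is a pair of natural transformations compatible with $p$ and $p'$. Polynomials compose, so that they form a monoidal 2-category $\mathfrak D_I\subseteq\mathrm{Poly}_{\mathbf{Cat}}(I,I)$; a monad in it is a polynomial with a unit and a multiplication satisfying the monad laws. The homomorphism $\mathrm{PFun}$ sends a polynomial to the endo-2-functor of $\mathbf{Cat}/I$ under which $X$ goes to the category whose objects are the pairs $(b,h)$ of an object $b$ of $B$ and a functor $h:p^{-1}\{b\}\to X$ over $I$. It sends morphisms to 2-natural transformations, 2-cells to modifications, and monads to 2-monads. **The polynomial of an operad.** Let $T$ be an operad with set of objects $I$. The objects of $B_T$ are the arrows of $T$, and an arrow $\alpha\to\beta$ of $B_T$ is a permutation $\rho$ with $\alpha=\beta\rho$. The objects of $E_T$ are the pairs $(\alpha,j)$ of an arrow of $T$ and a place $1\le j\le n$ of its source, and an arrow $(\alpha,j)\to(\beta,k)$ is an arrow $\rho:\alpha\to\beta$ of $B_T$ with $\rho j=k$. With $s_T(\alpha,j)=i_j$, $p_T(\alpha,j)=\alpha$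 and $t_T\alpha=i$, this gives a polynomial $(s_T,p_T,t_T)$, which is a monad by means of the units and the composition of $T$; its image under $\mathrm{PFun}$ is the 2-monad on $\mathbf{Cat}/I$, again written $T$. **The quotient $T/\Sigma$.** Taking categories of arrows gives a polynomial $(s_T^{[1]},p_T^{[1]},t_T^{[1]}):I\leftarrow E_T^{[1]}\to B_T^{[1]}\to I$, two morphisms (source and target) from it to $(s_T,p_T,t_T)$, and a 2-cell between them whose components are the arrows themselves. Let $\alpha_T:d_T\Rightarrow c_T:T^{[1]}_\Sigma\to T$ be the image of this 2-cell under $\mathrm{PFun}$. The morphism of 2-monads $q_T:T\to T/\Sigma$ is the coidentifier of $\alpha_T$ in the 2-category of 2-monads on $\mathbf{Cat}/I$, computed as in the 2-category of endo-2-functors of $\mathbf{Cat}/I$. (A coidentifier of $\phi$ is the universal 1-cell $q$ such that $q\phi$ is an identity, in the 1- and the 2-dimensional sense.) For a category $X$, let $q_X:X\to\pi_0X$ be the functor to the discrete category of connected components. **Theorem.** Let $T$ be a $\Sigma$-free operad with set of objects $I$. Then the square $$\begin{array}{ccc}E_T&\xrightarrow{\;p_T\;}&B_T\\ {\scriptstyle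 q_{E_T}}\downarrow&&\downarrow{\scriptstyle q_{B_T}}\\ \pi_0E_T&\xrightarrow{\pi_0p_T}&\pi_0B_T\end{array}$$ is a pullback in $\mathbf{Cat}$, so that $(q_{B_T},q_{E_T})$ is a morphism of polynomials $(s_T,p_T,t_T)\to(\pi_0s_T,\pi_0p_T,\pi_0t_T)$; there is a unique monad structure on $(\pi_0s_T,\pi_0p_T,\pi_0t_T)$ for which $(q_{B_T},q_{E_T})$ is a morphism of monads in $\mathrm{Poly}_{\mathbf{Cat}}$; and $\mathrm{PFun}$ sends this morphism of monads to $q_T:T\to T/\Sigma$. That is, the image of $(q_{B_T},q_{E_T})$ is a morphism of 2-monads that is a coidentifier of $\alpha_T$, both in 2-monads on $\mathbf{Cat}/I$ and in endo-2-functors of $\mathbf{Cat}/I$. In particular $T/\Sigma$ is a polynomial 2-monad. -/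

import Mathlib

open CategoryTheory Bicategory

universe u

namespace TwoCat

universe w v x

section

variable {K : Type x} [Bicategory.{w, v} K]

/-- A 2-natural transformation between endo-2-functors of a 2-category. -/
structure TwoNat (F G : StrictPseudofunctor K K) where
  app (X : K) : F.obj X ⟶ G.obj X
  naturality {X Y : K} (f : X ⟶ Y) : F.map f ≫ app Y = app X ≫ G.map f
  naturality₂ {X Y : K} {f g : X ⟶ Y} (θ : f ⟶ g) :
    F.map₂ θ ▷ app Y ≫ eqToHom (naturality g) = eqToHom (naturality f) ≫ app X ◁ G.map₂ θ

theorem TwoNat.ext {F G : StrictPseudofunctor K K} {φ ψ : TwoNat F G}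
    (h : ∀ X, φ.app X = ψ.app X) : φ = ψ := by
  obtain ⟨a, _, _⟩ := φ
  obtain ⟨b, _, _⟩ := ψ
  obtain rfl : a = b := funext h
  rfl

/-- A modification between 2-natural transformations. -/
structure Modif {F G : StrictPseudofunctor K K} (φ ψ : TwoNat F G) where
  app (X : K) : φ.app X ⟶ ψ.app X
  naturality {X Y : K} (f : X ⟶ Y) :
    F.map f ◁ app Y ≫ eqToHom (ψ.naturality f) = eqToHom (φ.naturality f) ≫ app X ▷ G.map f

/-- A modification is an identity when its source and target agree and its components are
identities. -/
def Modif.IsId {F G : StrictPseudofunctor K K} {φ ψ : TwoNat F G} (Γ : Modif φ ψ) : Prop :=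
  ∃ h : φ = ψ, ∀ X, Γ.app X = eqToHom (congrArg (fun χ => TwoNat.app χ X) h)

variable [Bicategory.Strict K]

attribute [local simp] Strict.leftUnitor_eqToIso Strict.rightUnitor_eqToIso
  Strict.associator_eqToIso

theorem Modif.naturality' {F G : StrictPseudofunctor K K} {φ ψ : TwoNat F G} (Γ : Modif φ ψ)
    {X Y : K} (f : X ⟶ Y) :
    F.map f ◁ Γ.app Y = eqToHom (φ.naturality f) ≫ Γ.app X ▷ G.map f ≫
      eqToHom (ψ.naturality f).symm := by
  rw [← Category.assoc, ← Γ.naturality]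
  simp

theorem whiskerRight_eq {a b c : K} {f g : a ⟶ b} (θ : f ⟶ g) {h k : b ⟶ c} (e : h = k) :
    θ ▷ h = eqToHom (by rw [e]) ≫ θ ▷ k ≫ eqToHom (by rw [e]) := by
  subst e; simp

theorem whiskerLeft_eq {a b c : K} {f g : b ⟶ c} (θ : f ⟶ g) {h k : a ⟶ b} (e : h = k) :
    h ◁ θ = eqToHom (by rw [e]) ≫ k ◁ θ ≫ eqToHom (by rw [e]) := by
  subst e; simp

theorem TwoNat.naturality₂' {F G : StrictPseudofunctor K K} (φ : TwoNat F G)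
    {X Y : K} {f g : X ⟶ Y} (θ : f ⟶ g) :
    F.map₂ θ ▷ φ.app Y = eqToHom (φ.naturality f) ≫ φ.app X ◁ G.map₂ θ ≫
      eqToHom (φ.naturality g).symm := by
  have := φ.naturality₂ θ
  rw [← Category.assoc, ← this]
  simp

/-- Composition of 2-natural transformations. -/
@[reducible] def TwoNat.comp {F G H : StrictPseudofunctor K K} (φ : TwoNat F G) (ψ : TwoNat G H) :
    TwoNat F H where
  app X := φ.app X ≫ ψ.app X
  naturality {X Y} f := by
    rw [← Strict.assoc, φ.naturality, Strict.assoc, ψ.naturality, Strict.assoc]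
  naturality₂ {X Y f g} θ := by
    rw [whiskerRight_comp, φ.naturality₂', comp_whiskerLeft]
    simp [ψ.naturality₂']

/-- The composite `Γ` followed by `q`. -/
def Modif.whiskerRight {F G H : StrictPseudofunctor K K} {φ ψ : TwoNat F G} (Γ : Modif φ ψ)
    (q : TwoNat G H) : Modif (φ.comp q) (ψ.comp q) where
  app X := Γ.app X ▷ q.app X
  naturality {X Y} f := by
    have h1 : F.map f ◁ (Γ.app Y ▷ q.app Y) = (α_ _ _ _).inv ≫ (F.map f ◁ Γ.app Y) ▷ q.app Y ≫
        (α_ _ _ _).hom := by simp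
    have h2 : (Γ.app X ▷ q.app X) ▷ H.map f = (α_ _ _ _).hom ≫ Γ.app X ▷ (q.app X ≫ H.map f) ≫
        (α_ _ _ _).inv := by simp
    rw [h1, h2, Γ.naturality', whiskerRight_eq (Γ.app X) (q.naturality f).symm]
    simp

/-- The composite `q` followed by `Γ`. -/
def Modif.whiskerLeft {F G H : StrictPseudofunctor K K} (q : TwoNat F G) {φ ψ : TwoNat G H}
    (Γ : Modif φ ψ) : Modif (q.comp φ) (q.comp ψ) where
  app X := q.app X ◁ Γ.app X
  naturality {X Y} f := by
    have h1 : F.map f ◁ (q.app Y ◁ Γ.app Y) = (α_ _ _ _).inv ≫ (F.map f ≫ q.app Y) ◁ Γ.app Y ≫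
        (α_ _ _ _).hom := by simp
    have h2 : (q.app X ◁ Γ.app X) ▷ H.map f = (α_ _ _ _).hom ≫ q.app X ◁ (Γ.app X ▷ H.map f) ≫
        (α_ _ _ _).inv := by simp
    have h3 : (q.app X ≫ G.map f) ◁ Γ.app Y = (α_ _ _ _).hom ≫ q.app X ◁ (G.map f ◁ Γ.app Y) ≫
        (α_ _ _ _).inv := by simp
    rw [h1, h2, whiskerLeft_eq (Γ.app Y) (q.naturality f)]
    rw [h3, Γ.naturality']
    simp

/-- The components of a 2-natural transformation `1 ⟶ T`. -/
def unitApp {T : StrictPseudofunctor K K} (η : TwoNat (StrictPseudofunctor.id K) T) (X : K) :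
    X ⟶ T.obj X := η.app X

/-- The components of a 2-natural transformation `T T ⟶ T`. -/
def multApp {T : StrictPseudofunctor K K} (μ : TwoNat (T.comp T) T) (X : K) :
    T.obj (T.obj X) ⟶ T.obj X := μ.app X

variable (K) in
/-- A 2-monad on a 2-category. -/
structure TwoMonad where
  T : StrictPseudofunctor K K
  η : TwoNat (StrictPseudofunctor.id K) T
  μ : TwoNat (T.comp T) T
  left_unit (X : K) : unitApp η (T.obj X) ≫ multApp μ X = 𝟙 (T.obj X)
  right_unit (X : K) : T.map (unitApp η X) ≫ multApp μ X = 𝟙 (T.obj X)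
  assoc (X : K) : T.map (multApp μ X) ≫ multApp μ X = multApp μ (T.obj X) ≫ multApp μ X

/-- The property of being a (strict) morphism of 2-monads. -/
structure IsMonadMor (S T : TwoMonad K) (φ : TwoNat S.T T.T) : Prop where
  unit (X : K) : unitApp S.η X ≫ φ.app X = unitApp T.η X
  mult (X : K) :
    multApp S.μ X ≫ φ.app X = (S.T.map (φ.app X) ≫ φ.app (T.T.obj X)) ≫ multApp T.μ X

/-- The property of being a 2-cell between morphisms of 2-monads: compatibility with the units and
with the multiplications. -/
structure IsMonadCell {S T : TwoMonad K} {φ ψ : TwoNat S.T T.T} (hφ : IsMonadMor S T φ)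
    (hψ : IsMonadMor S T ψ) (Γ : Modif φ ψ) : Prop where
  unit (X : K) : unitApp S.η X ◁ Γ.app X ≫ eqToHom (hψ.unit X) = eqToHom (hφ.unit X)
  mult (X : K) :
    multApp S.μ X ◁ Γ.app X ≫ eqToHom (hψ.mult X) =
      eqToHom (hφ.mult X) ≫
        (S.T.map₂ (Γ.app X) ▷ φ.app (T.T.obj X) ≫
          S.T.map (ψ.app X) ◁ Γ.app (T.T.obj X)) ▷ multApp T.μ X

/-- `q : G ⟶ Q` exhibits `Q` as the coidentifier of the modification `Γ` in the 2-category of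
endo-2-functors of `K`: `Γ` followed by `q` is an identity, and composition with `q` is an
isomorphism, for every `R`, from the category of 2-natural transformations `Q ⟶ R` to the full
subcategory of the category of the `h : G ⟶ R` for which `Γ` followed by `h` is an identity. -/
structure IsCoidentifierEnd {F G Q : StrictPseudofunctor K K} {φ ψ : TwoNat F G}
    (Γ : Modif φ ψ) (q : TwoNat G Q) : Prop where
  isId : (Γ.whiskerRight q).IsId
  desc (R : StrictPseudofunctor K K) (h : TwoNat G R) (hh : (Γ.whiskerRight h).IsId) :
    ∃! k : TwoNat Q R, q.comp k = h
  desc₂ (R : StrictPseudofunctor K K) (k k' : TwoNat Q R)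
    (Θ : Modif (q.comp k) (q.comp k')) : ∃! Ξ : Modif k k', Ξ.whiskerLeft q = Θ

theorem IsMonadMor.comp {S T R : TwoMonad K} {φ : TwoNat S.T T.T} {ψ : TwoNat T.T R.T}
    (hφ : IsMonadMor S T φ) (hψ : IsMonadMor T R ψ) : IsMonadMor S R (φ.comp ψ) where
  unit X := by
    change unitApp S.η X ≫ φ.app X ≫ ψ.app X = _
    rw [← Strict.assoc, hφ.unit, hψ.unit]
  mult X := by
    change multApp S.μ X ≫ φ.app X ≫ ψ.app X =
      (S.T.map (φ.app X ≫ ψ.app X) ≫ φ.app (R.T.obj X) ≫ ψ.app (R.T.obj X)) ≫ multApp R.μ X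
    rw [← Strict.assoc, hφ.mult, Strict.assoc, hψ.mult, StrictPseudofunctor.map_comp]
    have h := φ.naturality (ψ.app X)
    simp only [Strict.assoc]
    rw [← Strict.assoc (S.T.map (ψ.app X)), h]
    simp only [Strict.assoc]

/-- `q : G ⟶ Q` exhibits `Q` as the coidentifier of the modification `Γ` in the 2-category of
2-monads, 2-monad morphisms and 2-monad 2-cells on `K`. For a 2-cell `Γ` of 2-monads, the condition
that a morphism of 2-monads sends `Γ` to an identity only involves its underlying modification. -/
structure IsCoidentifierMnd {G Q : TwoMonad K} {F : StrictPseudofunctor K K} {φ ψ : TwoNat F G.T}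
    (Γ : Modif φ ψ) (q : TwoNat G.T Q.T) : Prop where
  isMor : IsMonadMor G Q q
  isId : (Γ.whiskerRight q).IsId
  desc (R : TwoMonad K) (h : TwoNat G.T R.T) (_ : IsMonadMor G R h)
    (_ : (Γ.whiskerRight h).IsId) :
    ∃! k : TwoNat Q.T R.T, IsMonadMor Q R k ∧ q.comp k = h
  desc₂ (R : TwoMonad K) (k k' : TwoNat Q.T R.T) (hk : IsMonadMor Q R k)
    (hk' : IsMonadMor Q R k') (Θ : Modif (q.comp k) (q.comp k'))
    (_ : IsMonadCell (isMor.comp hk) (isMor.comp hk') Θ) :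
    ∃! Ξ : Modif k k', IsMonadCell hk hk' Ξ ∧ Ξ.whiskerLeft q = Θ

end
end TwoCat

/-! ### The slice 2-category `Cat/I` over a set `I` -/

/-- An object of `Cat/I`: a small category with a functor to the discrete category `I`. -/
structure SlCat (I : Type u) : Type (u + 1) where
  C : Type u
  [cat : SmallCategory C]
  π : C ⥤ Discrete I

attribute [instance] SlCat.cat

namespace SlCat

variable {I : Type u}

/-- A 1-cell of `Cat/I`: a functor commuting with the functors to `I`. -/
@[ext]
structure Hom (X Y : SlCat I) where
  F : X.C ⥤ Y.C
  w : F ⋙ Y.π = X.π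

/-- The colour of an object of a category over `I`. -/
def col (X : SlCat I) (x : X.C) : I := (X.π.obj x).as

theorem col_eq (X : SlCat I) {x y : X.C} (f : x ⟶ y) : X.col x = X.col y :=
  Discrete.eq_of_hom (X.π.map f)

theorem Hom.col_obj {X Y : SlCat I} (f : Hom X Y) (x : X.C) : Y.col (f.F.obj x) = X.col x :=
  congrArg Discrete.as (Functor.congr_obj f.w x)

/-- Functors into a discrete category agree when they agree on objects. -/
theorem functor_discrete_ext {C : Type u} [SmallCategory C] {F G : C ⥤ Discrete I}
    (h : ∀ x, (F.obj x).as = (G.obj x).as) : F = G :=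
  Functor.hext (fun x => Discrete.ext (h x)) fun x y f => by
    have hx : F.obj x = G.obj x := Discrete.ext (h x)
    have hy : F.obj y = G.obj y := Discrete.ext (h y)
    have : ∀ {a b c d : Discrete I} (f : a ⟶ b) (g : c ⟶ d), a = c → b = d → f ≍ g := by
      rintro a b c d f g rfl rfl
      exact heq_of_eq (Subsingleton.elim _ _)
    exact this _ _ hx hy

/-- A 2-cell of `Cat/I`: a natural transformation. The condition that its components lie over
identities of `I` is automatic, as `I` is discrete. -/
@[ext]
structure Cell {X Y : SlCat I} (f g : Hom X Y) where
  nt : f.F ⟶ g.F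

instance (X Y : SlCat I) : Category (Hom X Y) where
  Hom f g := Cell f g
  id f := ⟨𝟙 f.F⟩
  comp α β := ⟨α.nt ≫ β.nt⟩
  id_comp α := Cell.ext (Category.id_comp α.nt)
  comp_id α := Cell.ext (Category.comp_id α.nt)
  assoc α β γ := Cell.ext (Category.assoc α.nt β.nt γ.nt)

/-- The natural transformation underlying a 2-cell. -/
def nt {X Y : SlCat I} {f g : Hom X Y} (α : f ⟶ g) : f.F ⟶ g.F := Cell.nt α

/-- The component of a 2-cell. -/
def cmp {X Y : SlCat I} {f g : Hom X Y} (α : f ⟶ g) (x : X.C) : f.F.obj x ⟶ g.F.obj x :=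
  (nt α).app x

theorem cell_ext {X Y : SlCat I} {f g : Hom X Y} {α β : f ⟶ g} (h : ∀ x, cmp α x = cmp β x) :
    α = β := Cell.ext (NatTrans.ext (funext h))

theorem cmp_naturality {X Y : SlCat I} {f g : Hom X Y} (α : f ⟶ g) {x y : X.C} (a : x ⟶ y) :
    f.F.map a ≫ cmp α y = cmp α x ≫ g.F.map a := (nt α).naturality a

@[simp] theorem cmp_id {X Y : SlCat I} (f : Hom X Y) (x : X.C) : cmp (𝟙 f) x = 𝟙 _ := rfl

@[simp] theorem cmp_comp {X Y : SlCat I} {f g h : Hom X Y} (α : f ⟶ g) (β : g ⟶ h) (x : X.C) :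
    cmp (α ≫ β) x = cmp α x ≫ cmp β x := rfl

@[simp] theorem cmp_eqToHom {X Y : SlCat I} {f g : Hom X Y} (h : f = g) (x : X.C) :
    cmp (eqToHom h) x = eqToHom (by rw [h]) := by subst h; rfl

/-- The 2-cell with given components. -/
def mkCell {X Y : SlCat I} {f g : Hom X Y} (α : f.F ⟶ g.F) : f ⟶ g := Cell.mk α

@[simp] theorem cmp_mkCell {X Y : SlCat I} {f g : Hom X Y} (α : f.F ⟶ g.F) (x : X.C) :
    cmp (mkCell α) x = α.app x := rfl

/-- An isomorphism between 1-cells from a natural isomorphism. -/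
def mkIso {X Y : SlCat I} {f g : Hom X Y} (α : f.F ≅ g.F) : f ≅ g where
  hom := mkCell α.hom
  inv := mkCell α.inv
  hom_inv_id := Cell.ext α.hom_inv_id
  inv_hom_id := Cell.ext α.inv_hom_id

@[simp] theorem cmp_mkIso_hom {X Y : SlCat I} {f g : Hom X Y} (α : f.F ≅ g.F) (x : X.C) :
    cmp (mkIso α).hom x = α.hom.app x := rfl

@[simp] theorem cmp_mkIso_inv {X Y : SlCat I} {f g : Hom X Y} (α : f.F ≅ g.F) (x : X.C) :
    cmp (mkIso α).inv x = α.inv.app x := rfl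

/-- Composition of 1-cells. -/
@[simps]
def Hom.comp {X Y Z : SlCat I} (f : Hom X Y) (g : Hom Y Z) : Hom X Z where
  F := f.F ⋙ g.F
  w := by rw [Functor.assoc, g.w, f.w]

/-- The identity 1-cell. -/
@[simps]
def Hom.id (X : SlCat I) : Hom X X where
  F := 𝟭 X.C
  w := rfl

theorem triv {C : Type u} [SmallCategory C] {x y : C} (f : x ⟶ y) : 𝟙 x ≫ f ≫ 𝟙 y = f := by
  simp

instance : Bicategory (SlCat I) where
  Hom := Hom
  id := Hom.id
  comp := Hom.comp
  homCategory X Y := inferInstance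
  whiskerLeft f _ _ α := mkCell (Functor.whiskerLeft f.F (nt α))
  whiskerRight α g := mkCell (Functor.whiskerRight (nt α) g.F)
  associator f g h := mkIso (Functor.associator f.F g.F h.F)
  leftUnitor f := mkIso f.F.leftUnitor
  rightUnitor f := mkIso f.F.rightUnitor
  whiskerLeft_id f g := cell_ext fun x => rfl
  whiskerLeft_comp f _ _ _ α β := cell_ext fun x => rfl
  id_whiskerLeft α := cell_ext fun x => (triv _).symm
  comp_whiskerLeft f g _ _ α := cell_ext fun x => (triv _).symm
  id_whiskerRight f g := cell_ext fun x => g.F.map_id _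
  comp_whiskerRight α β g := cell_ext fun x => g.F.map_comp _ _
  whiskerRight_id α := cell_ext fun x => (triv _).symm
  whiskerRight_comp α g h := cell_ext fun x => (triv _).symm
  whisker_assoc f _ _ α h := cell_ext fun x => (triv _).symm
  whisker_exchange α β := cell_ext fun x => ((nt β).naturality (cmp α x)).symm
  pentagon f g h k := cell_ext fun x => by
    change k.F.map (𝟙 _) ≫ 𝟙 _ ≫ 𝟙 _ = 𝟙 _ ≫ 𝟙 _
    simp
  triangle f g := cell_ext fun x => by
    change 𝟙 _ ≫ 𝟙 _ = g.F.map (𝟙 _)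
    simp

@[simp] theorem comp_F {X Y Z : SlCat I} (f : X ⟶ Y) (g : Y ⟶ Z) :
    Hom.F (f ≫ g) = Hom.F f ⋙ Hom.F g := rfl

@[simp] theorem id_F (X : SlCat I) : Hom.F (𝟙 X) = 𝟭 X.C := rfl

@[simp] theorem cmp_whiskerLeft {X Y Z : SlCat I} (f : X ⟶ Y) {g h : Y ⟶ Z} (α : g ⟶ h)
    (x : X.C) : cmp (f ◁ α) x = cmp α ((Hom.F f).obj x) := rfl

@[simp] theorem cmp_whiskerRight {X Y Z : SlCat I} {f g : X ⟶ Y} (α : f ⟶ g) (h : Y ⟶ Z)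
    (x : X.C) : cmp (α ▷ h) x = (Hom.F h).map (cmp α x) := rfl

instance : Bicategory.Strict (SlCat I) where
  id_comp _ := rfl
  comp_id _ := rfl
  assoc _ _ _ := rfl
  leftUnitor_eqToIso _ := by ext; rfl
  rightUnitor_eqToIso _ := by ext; rfl
  associator_eqToIso _ _ _ := by ext; rfl

theorem triv' {X Y : SlCat I} {f g : X ⟶ Y} (α : f ⟶ g) : 𝟙 f ≫ α ≫ 𝟙 g = α := by
  simp

end SlCat

/-! ### Polynomials over a set `I` -/

/-- Every arrow out of the image of `e` has a unique lift to an arrow out of `e`. -/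
def IsDiscreteOpfibration {E B : Type u} [SmallCategory E] [SmallCategory B] (p : E ⥤ B) : Prop :=
  ∀ e : E, Function.Bijective
    (fun x : Σ e', (e ⟶ e') => (⟨p.obj x.1, p.map x.2⟩ : Σ b, (p.obj e ⟶ b)))

/-- Every arrow into the image of `e` has a unique lift to an arrow into `e`. -/
def IsDiscreteFibration {E B : Type u} [SmallCategory E] [SmallCategory B] (p : E ⥤ B) : Prop :=
  ∀ e : E, Function.Bijective
    (fun x : Σ e', (e' ⟶ e) => (⟨p.obj x.1, p.map x.2⟩ : Σ b, (b ⟶ p.obj e)))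

/-- A polynomial `I ← E → B → I` in `Cat` from the set `I` to itself, whose middle functor is a
discrete fibration and a discrete opfibration (and hence exponentiable). -/
structure CatPoly (I : Type u) : Type (u + 1) where
  B : Type u
  E : Type u
  [catB : SmallCategory B]
  [catE : SmallCategory E]
  s : E ⥤ Discrete I
  p : E ⥤ B
  t : B ⥤ Discrete I
  dopf : IsDiscreteOpfibration p
  dfib : IsDiscreteFibration p

attribute [instance] CatPoly.catB CatPoly.catE

namespace CatPoly

variable {I : Type u}

/-- The fibre of the middle functor over `b`. -/
abbrev Fib (P : CatPoly I) (b : P.B) : Type u := {e : P.E // P.p.obj e = b}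

/-- The colour of an element of a fibre, that is, its image under `s`. -/
def sc (P : CatPoly I) {b : P.B} (x : P.Fib b) : I := (P.s.obj x.1).as

/-- The colour of an object of `B`, that is, its image under `t`. -/
def tc (P : CatPoly I) (b : P.B) : I := (P.t.obj b).as

/-- `R β x y` says that there is an arrow `x ⟶ y` of `E` lying over `β`; that is, the transport
between fibres along `β` sends `x` to `y`. -/
def R (P : CatPoly I) {b b' : P.B} (β : b ⟶ b') (x : P.Fib b) (y : P.Fib b') : Prop :=
  ∃ κ : x.1 ⟶ y.1, P.p.map κ = eqToHom x.2 ≫ β ≫ eqToHom y.2.symm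

section

variable (P : CatPoly I)

theorem R_id {b : P.B} (x : P.Fib b) : P.R (𝟙 b) x x := ⟨𝟙 _, by simp⟩

theorem R_map {e e' : P.E} (κ : e ⟶ e') : P.R (P.p.map κ) ⟨e, rfl⟩ ⟨e', rfl⟩ := ⟨κ, by simp⟩

variable {P}

theorem R.comp {b b' b'' : P.B} {β : b ⟶ b'} {β' : b' ⟶ b''} {x : P.Fib b} {y : P.Fib b'}
    {z : P.Fib b''} (h : P.R β x y) (h' : P.R β' y z) : P.R (β ≫ β') x z := by
  obtain ⟨κ, hκ⟩ := h
  obtain ⟨κ', hκ'⟩ := h'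
  exact ⟨κ ≫ κ', by rw [P.p.map_comp, hκ, hκ']; simp⟩

theorem exists_right {b b' : P.B} (β : b ⟶ b') (x : P.Fib b) : ∃ y, P.R β x y := by
  obtain ⟨e, rfl⟩ := x
  obtain ⟨⟨e', κ⟩, h⟩ := (P.dopf e).2 ⟨b', β⟩
  obtain ⟨rfl, h⟩ := Sigma.mk.inj_iff.1 h
  exact ⟨⟨e', rfl⟩, κ, by simp [eq_of_heq h]⟩

theorem exists_left {b b' : P.B} (β : b ⟶ b') (y : P.Fib b') : ∃ x, P.R β x y := by
  obtain ⟨e, rfl⟩ := y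
  obtain ⟨⟨e', κ⟩, h⟩ := (P.dfib e).2 ⟨b, β⟩
  obtain ⟨rfl, h⟩ := Sigma.mk.inj_iff.1 h
  exact ⟨⟨e', rfl⟩, κ, by simp [eq_of_heq h]⟩

theorem R.right_unique {b b' : P.B} {β : b ⟶ b'} {x : P.Fib b} {y y' : P.Fib b'}
    (h : P.R β x y) (h' : P.R β x y') : y = y' := by
  obtain ⟨e, rfl⟩ := x
  obtain ⟨κ, hκ⟩ := h
  obtain ⟨κ', hκ'⟩ := h'
  have := @(P.dopf e).1 ⟨y.1, κ⟩ ⟨y'.1, κ'⟩ (by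
    obtain ⟨e₁, rfl⟩ := y
    obtain ⟨e₂, h₂⟩ := y'
    simp only at κ κ' hκ hκ' ⊢
    rw [hκ, hκ']
    refine Sigma.ext h₂.symm ?_
    simp)
  exact Subtype.ext (congrArg Sigma.fst this)

theorem R.left_unique {b b' : P.B} {β : b ⟶ b'} {x x' : P.Fib b} {y : P.Fib b'}
    (h : P.R β x y) (h' : P.R β x' y) : x = x' := by
  obtain ⟨e, rfl⟩ := y
  obtain ⟨κ, hκ⟩ := h
  obtain ⟨κ', hκ'⟩ := h'
  have := @(P.dfib e).1 ⟨x.1, κ⟩ ⟨x'.1, κ'⟩ (by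
    obtain ⟨e₁, rfl⟩ := x
    obtain ⟨e₂, h₂⟩ := x'
    simp only at κ κ' hκ hκ' ⊢
    rw [hκ, hκ']
    refine Sigma.ext h₂.symm ?_
    simp)
  exact Subtype.ext (congrArg Sigma.fst this)

theorem R_id_iff {b : P.B} {x y : P.Fib b} : P.R (𝟙 b) x y ↔ x = y :=
  ⟨fun h => (P.R_id x).right_unique h, by rintro rfl; exact P.R_id x⟩

theorem R.cancel {b b' b'' : P.B} {β : b ⟶ b'} {β' : b' ⟶ b''} {x : P.Fib b} {y : P.Fib b'}
    {z : P.Fib b''} (h : P.R (β ≫ β') x z) (h' : P.R β x y) : P.R β' y z := by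
  obtain ⟨w, hw⟩ := exists_right β' y
  rwa [h.right_unique (h'.comp hw)]

theorem R.sc_eq {b b' : P.B} {β : b ⟶ b'} {x : P.Fib b} {y : P.Fib b'} (h : P.R β x y) :
    P.sc x = P.sc y :=
  Discrete.eq_of_hom (P.s.map h.choose)

/-- The middle functor is faithful. -/
theorem p_faithful {e e' : P.E} {κ κ' : e ⟶ e'} (h : P.p.map κ = P.p.map κ') : κ = κ' := by
  have := @(P.dopf e).1 ⟨e', κ⟩ ⟨e', κ'⟩ (by simp [h])
  simpa using this

variable (P)

/-- Transport between fibres. -/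
noncomputable def tr {b b' : P.B} (β : b ⟶ b') (x : P.Fib b) : P.Fib b' :=
  (exists_right β x).choose

theorem R_tr {b b' : P.B} (β : b ⟶ b') (x : P.Fib b) : P.R β x (P.tr β x) :=
  (exists_right β x).choose_spec

end

/-! ### The polynomial functor of a polynomial -/

/-- An object of `P X`: an object `b` of `B` with a functor over `I` from the (discrete) fibre over
`b` to `X`. -/
@[ext]
structure Lab (P : CatPoly I) (X : SlCat I) : Type u where
  b : P.B
  h : P.Fib b → X.C
  w : ∀ x, X.col (h x) = P.sc x

/-- An arrow of `P X`: an arrow `β` of `B` with a natural transformation from the first labelling to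
the composite of the second labelling with the transport along `β`. -/
@[ext]
structure Lab.Hom {P : CatPoly I} {X : SlCat I} (z z' : Lab P X) : Type u where
  β : z.b ⟶ z'.b
  γ : ∀ (x : P.Fib z.b) (y : P.Fib z'.b), P.R β x y → (z.h x ⟶ z'.h y)

namespace Lab

variable {P : CatPoly I} {X Y Z : SlCat I}

theorem Hom.ext_of {z z' : Lab P X} {φ ψ : Lab.Hom z z'} (hβ : φ.β = ψ.β)
    (hγ : ∀ x y r r', φ.γ x y r = ψ.γ x y r') : φ = ψ := by
  obtain ⟨β, γ⟩ := φ
  obtain ⟨β', γ'⟩ := ψ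
  obtain rfl : β = β' := hβ
  obtain rfl : γ = γ' := by
    funext x y r
    exact hγ x y r r
  rfl

/-- The identity arrow. -/
def Hom.id (z : Lab P X) : Lab.Hom z z :=
  ⟨𝟙 z.b, fun x y r => eqToHom (by rw [R_id_iff.1 r])⟩

/-- Composition of arrows. -/
noncomputable def Hom.comp {z₁ z₂ z₃ : Lab P X} (φ : Lab.Hom z₁ z₂) (ψ : Lab.Hom z₂ z₃) :
    Lab.Hom z₁ z₃ :=
  ⟨φ.β ≫ ψ.β, fun x z r =>
    φ.γ x (P.tr φ.β x) (P.R_tr φ.β x) ≫ ψ.γ (P.tr φ.β x) z (r.cancel (P.R_tr φ.β x))⟩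

theorem Hom.comp_γ {z₁ z₂ z₃ : Lab P X} (φ : Lab.Hom z₁ z₂) (ψ : Lab.Hom z₂ z₃)
    {x : P.Fib z₁.b} {y : P.Fib z₂.b} {z : P.Fib z₃.b} (r : P.R φ.β x y) (r' : P.R ψ.β y z)
    (r'' : P.R (φ.β ≫ ψ.β) x z) : (φ.comp ψ).γ x z r'' = φ.γ x y r ≫ ψ.γ y z r' := by
  obtain rfl := r.right_unique (P.R_tr φ.β x)
  rfl

noncomputable instance : SmallCategory (Lab P X) where
  Hom z z' := Lab.Hom z z'
  id z := Lab.Hom.id z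
  comp φ ψ := φ.comp ψ
  id_comp {z z'} φ := Hom.ext_of (Category.id_comp φ.β) fun x y r r' =>
    (Hom.comp_γ (Hom.id z) φ (P.R_id x) r' r).trans (Category.id_comp _)
  comp_id {z z'} φ := Hom.ext_of (Category.comp_id φ.β) fun x y r r' =>
    (Hom.comp_γ φ (Hom.id z') r' (P.R_id y) r).trans (Category.comp_id _)
  assoc {z₁ z₂ z₃ z₄} φ ψ χ := Hom.ext_of (Category.assoc φ.β ψ.β χ.β) fun x y r r' => by
    have h1 := P.R_tr φ.β x
    have h2 := P.R_tr ψ.β (P.tr φ.β x)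
    have h3 := r'.cancel h1
    have h4 := h3.cancel h2
    rw [Hom.comp_γ (φ.comp ψ) χ (h1.comp h2) h4 r, Hom.comp_γ φ ψ h1 h2,
      Hom.comp_γ φ (ψ.comp χ) h1 h3 r', Hom.comp_γ ψ χ h2 h4 h3, Category.assoc]

/-- The arrow of `B` underlying an arrow. -/
def β {z z' : Lab P X} (φ : z ⟶ z') : z.b ⟶ z'.b := Lab.Hom.β φ

/-- The components of an arrow. -/
def γ {z z' : Lab P X} (φ : z ⟶ z') {x : P.Fib z.b} {y : P.Fib z'.b} (r : P.R (β φ) x y) :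
    z.h x ⟶ z'.h y := Lab.Hom.γ φ x y r

/-- The arrow with given components. -/
def mk' {z z' : Lab P X} (β : z.b ⟶ z'.b)
    (γ : ∀ (x : P.Fib z.b) (y : P.Fib z'.b), P.R β x y → (z.h x ⟶ z'.h y)) : z ⟶ z' :=
  Lab.Hom.mk β γ

@[simp] theorem β_mk' {z z' : Lab P X} (b : z.b ⟶ z'.b)
    (g : ∀ (x : P.Fib z.b) (y : P.Fib z'.b), P.R b x y → (z.h x ⟶ z'.h y)) :
    β (mk' b g) = b := rfl

@[simp] theorem γ_mk' {z z' : Lab P X} (b : z.b ⟶ z'.b)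
    (g : ∀ (x : P.Fib z.b) (y : P.Fib z'.b), P.R b x y → (z.h x ⟶ z'.h y))
    {x : P.Fib z.b} {y : P.Fib z'.b} (r : P.R (β (mk' b g)) x y) :
    γ (mk' b g) r = g x y r := rfl

@[simp] theorem id_β (z : Lab P X) : β (𝟙 z) = 𝟙 z.b := rfl

@[simp] theorem comp_β {z₁ z₂ z₃ : Lab P X} (φ : z₁ ⟶ z₂) (ψ : z₂ ⟶ z₃) :
    β (φ ≫ ψ) = β φ ≫ β ψ := rfl

theorem id_γ (z : Lab P X) {x y : P.Fib z.b} (r : P.R (β (𝟙 z)) x y) :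
    γ (𝟙 z) r = eqToHom (by rw [R_id_iff.1 r]) := rfl

theorem comp_γ {z₁ z₂ z₃ : Lab P X} (φ : z₁ ⟶ z₂) (ψ : z₂ ⟶ z₃) {x : P.Fib z₁.b}
    {y : P.Fib z₂.b} {z : P.Fib z₃.b} (r'' : P.R (β (φ ≫ ψ)) x z) (r : P.R (β φ) x y)
    (r' : P.R (β ψ) y z) : γ (φ ≫ ψ) r'' = γ φ r ≫ γ ψ r' := Hom.comp_γ φ ψ r r' r''

theorem hom_ext {z z' : Lab P X} {φ ψ : z ⟶ z'} (hβ : β φ = β ψ)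
    (hγ : ∀ x y (r : P.R (β φ) x y) (r' : P.R (β ψ) x y), γ φ r = γ ψ r') : φ = ψ :=
  Hom.ext_of hβ hγ

theorem γ_congr {z z' : Lab P X} {φ ψ : z ⟶ z'} (h : φ = ψ) {x : P.Fib z.b} {y : P.Fib z'.b}
    (r : P.R (β φ) x y) (r' : P.R (β ψ) x y) : γ φ r = γ ψ r' := by
  subst h; rfl

theorem eqToHom_β {z z' : Lab P X} (h : z = z') :
    β (eqToHom h) = eqToHom (congrArg Lab.b h) := by
  subst h; rfl

/-- The functor from `P X` to `I`. -/
def proj (P : CatPoly I) (X : SlCat I) : Lab P X ⥤ Discrete I where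
  obj z := P.t.obj z.b
  map φ := P.t.map (β φ)
  map_id _ := P.t.map_id _
  map_comp _ _ := P.t.map_comp _ _

/-- Relabelling of an object along a functor over `I`. -/
@[reducible] def mapObj (f : X ⟶ Y) (z : Lab P X) : Lab P Y :=
  ⟨z.b, fun x => f.F.obj (z.h x), fun x => (f.col_obj _).trans (z.w x)⟩

/-- Relabelling of an arrow along a functor over `I`. -/
def mapHom (f : X ⟶ Y) {z z' : Lab P X} (φ : z ⟶ z') : mapObj f z ⟶ mapObj f z' :=
  mk' (β (z := z) (z' := z') φ) fun _ _ r => f.F.map (γ (z := z) (z' := z') φ r)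

/-- Relabelling along a functor over `I`. -/
@[reducible] def map (P : CatPoly I) (f : X ⟶ Y) : Lab P X ⥤ Lab P Y where
  obj z := mapObj f z
  map φ := mapHom f φ
  map_id z := hom_ext rfl fun x y r r' => by
    rw [id_γ]
    exact (congrArg f.F.map (id_γ z r)).trans (eqToHom_map _ _)
  map_comp {z₁ z₂ z₃} φ ψ := hom_ext rfl fun x y r r' => by
    have h1 := P.R_tr (β φ) x
    have h2 := r.cancel h1
    exact ((congrArg f.F.map (comp_γ φ ψ r h1 h2)).trans (f.F.map_comp _ _)).trans
      (comp_γ (mapHom f φ) (mapHom f ψ) _ h1 h2).symm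

/-- The component at `z` of the natural transformation relabelling along a natural
transformation. -/
def mapCell {f g : X ⟶ Y} (α : f ⟶ g) (z : Lab P X) : mapObj f z ⟶ mapObj g z :=
  mk' (z := mapObj f z) (z' := mapObj g z) (𝟙 z.b) fun x _ r =>
    SlCat.cmp α (z.h x) ≫ eqToHom (congrArg (fun x => g.F.obj (z.h x)) (R_id_iff.1 r))

theorem mapCell_γ {f g : X ⟶ Y} (α : f ⟶ g) (z : Lab P X) (x : P.Fib z.b)
    (r : P.R (β (mapCell α z)) x x) :
    γ (mapCell α z) r = SlCat.cmp α (z.h x) := Category.comp_id _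

/-- Relabelling along a natural transformation. -/
@[reducible] def map₂ (P : CatPoly I) {f g : X ⟶ Y} (α : f ⟶ g) : map P f ⟶ map P g where
  app z := mapCell α z
  naturality z z' φ := hom_ext ((Category.comp_id (β φ)).trans (Category.id_comp (β φ)).symm)
    fun x y r r' => by
      have h : P.R (β φ) x y := by
        have := r
        rw [comp_β] at this
        exact (Category.comp_id (β φ)) ▸ this
      refine (comp_γ (mapHom f φ) (mapCell α z') r h (P.R_id y)).trans
        (Eq.trans ?_ (comp_γ (mapCell α z) (mapHom g φ) r' (P.R_id x) h).symm)
      exact (congrArg (f.F.map (γ φ h) ≫ ·) (mapCell_γ α z' y (P.R_id y))).trans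
        ((SlCat.cmp_naturality α (γ φ h)).trans
          (congrArg (· ≫ g.F.map (γ φ h)) (mapCell_γ α z x (P.R_id x)).symm))

end Lab

/-- The action of the 2-functor of a polynomial on objects. -/
@[reducible] noncomputable def fobj (P : CatPoly I) (X : SlCat I) : SlCat I :=
  ⟨Lab P X, Lab.proj P X⟩

/-- The action of the 2-functor of a polynomial on functors. -/
@[reducible] noncomputable def fmap (P : CatPoly I) {X Y : SlCat I} (f : X ⟶ Y) :
    P.fobj X ⟶ P.fobj Y := SlCat.Hom.mk (Lab.map P f) rfl

/-- The action of the 2-functor of a polynomial on natural transformations. -/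
@[reducible] noncomputable def fmap₂ (P : CatPoly I) {X Y : SlCat I} {f g : X ⟶ Y} (α : f ⟶ g) :
    P.fmap f ⟶ P.fmap g := SlCat.mkCell (Lab.map₂ P α)

/-- The 2-functor `Cat/I ⟶ Cat/I` of a polynomial. -/
noncomputable def pfun (P : CatPoly I) : StrictPseudofunctor (SlCat I) (SlCat I) :=
  StrictPseudofunctor.mk''
    { obj := P.fobj
      map := P.fmap
      map₂ := P.fmap₂
      map_id := fun X => rfl
      map_comp := fun f g => rfl
      map₂_id := fun {X Y} f => SlCat.cell_ext fun z => Lab.hom_ext rfl fun x y r r' => by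
        obtain rfl := R_id_iff.1 r
        exact Category.comp_id _
      map₂_comp := fun {X Y f g h} α α' => SlCat.cell_ext fun z =>
        Lab.hom_ext (Category.comp_id _).symm fun x y r r' => by
          obtain rfl := R_id_iff.1 r
          refine (Lab.mapCell_γ (α ≫ α') z x r).trans (Eq.trans ?_
            (Lab.comp_γ (Lab.mapCell α z) (Lab.mapCell α' z) _ (P.R_id x) (P.R_id x)).symm)
          exact congrArg₂ (· ≫ ·) (Lab.mapCell_γ α z x (P.R_id x)).symm
            (Lab.mapCell_γ α' z x (P.R_id x)).symm
      map₂_whisker_left := fun {X Y Z} f g g' α => (SlCat.triv' (P.fmap₂ (f ◁ α))).symm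
      map₂_whisker_right := fun {X Y Z} f f' α g => by
        refine Eq.trans ?_ (SlCat.triv' (P.fmap₂ α ▷ P.fmap g)).symm
        refine SlCat.cell_ext fun z => Lab.hom_ext rfl fun x y r r' => ?_
        obtain rfl := R_id_iff.1 r
        refine (Lab.mapCell_γ (α ▷ g) z x r).trans ?_
        exact congrArg g.F.map (Lab.mapCell_γ α z x r').symm }

end CatPoly

/-! ### Morphisms of polynomials -/

namespace CatPoly

variable {I : Type u}

/-- A morphism of polynomials: functors between the categories of the two polynomials that commute
with the functors to `I`, and for which the square involving the middle functors is a pullback. -/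
structure Hom (P Q : CatPoly I) where
  f₁ : P.B ⥤ Q.B
  f₂ : P.E ⥤ Q.E
  ws : f₂ ⋙ Q.s = P.s
  wt : f₁ ⋙ Q.t = P.t
  pb : IsPullback f₂.toCatHom P.p.toCatHom Q.p.toCatHom f₁.toCatHom

theorem functor_ext {P : CatPoly I} {C : Type u} [SmallCategory C] {F G : C ⥤ P.E}
    (h : ∀ c, F.obj c = G.obj c) (hp : F ⋙ P.p = G ⋙ P.p) : F = G := by
  refine CategoryTheory.Functor.ext h fun c c' φ => P.p_faithful ?_
  have := Functor.congr_hom hp φ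
  simp only [Functor.comp_map] at this
  rw [this]
  simp [eqToHom_map]

section

variable {P Q : CatPoly I} (f₁ : P.B ⥤ Q.B) (f₂ : P.E ⥤ Q.E) (wp : f₂ ⋙ Q.p = P.p ⋙ f₁)

/-- The map induced between fibres. -/
abbrev fibAux (b : P.B) (x : P.Fib b) : Q.Fib (f₁.obj b) :=
  ⟨f₂.obj x.1, (Functor.congr_obj wp x.1).trans (congrArg f₁.obj x.2)⟩

theorem fibAux_R {b b' : P.B} {β : b ⟶ b'} {x : P.Fib b} {y : P.Fib b'} (r : P.R β x y) :
    Q.R (f₁.map β) (fibAux f₁ f₂ wp b x) (fibAux f₁ f₂ wp b' y) := by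
  obtain ⟨κ, hκ⟩ := r
  refine ⟨f₂.map κ, ?_⟩
  have := Functor.congr_hom wp κ
  simp only [Functor.comp_map] at this
  rw [this, hκ]
  simp [eqToHom_map]

theorem R_of_fibAux (hb : ∀ b, Function.Injective (fibAux f₁ f₂ wp b)) {b b' : P.B} {β : b ⟶ b'}
    {x : P.Fib b} {y : P.Fib b'}
    (r : Q.R (f₁.map β) (fibAux f₁ f₂ wp b x) (fibAux f₁ f₂ wp b' y)) : P.R β x y := by
  obtain ⟨y', r'⟩ := exists_right β x
  obtain rfl := hb _ ((fibAux_R f₁ f₂ wp r').right_unique r)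
  exact r'

theorem exists_lift (hb : ∀ b, Function.Bijective (fibAux f₁ f₂ wp b)) {C : Type u}
    [SmallCategory C] (g : C ⥤ Q.E) (h : C ⥤ P.B) (w : g ⋙ Q.p = h ⋙ f₁) :
    ∃ l : C ⥤ P.E, l ⋙ f₂ = g ∧ l ⋙ P.p = h := by
  choose x hx using fun c => (hb (h.obj c)).2 ⟨g.obj c, Functor.congr_obj w c⟩
  have hR : ∀ {c c' : C} (φ : c ⟶ c'), P.R (h.map φ) (x c) (x c') := fun {c c'} φ => by
    refine R_of_fibAux f₁ f₂ wp (fun b => (hb b).1) ?_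
    rw [hx, hx]
    exact ⟨g.map φ, by simpa using Functor.congr_hom w φ⟩
  choose κ hκ using fun (c c' : C) (φ : c ⟶ c') => hR φ
  let l : C ⥤ P.E :=
    { obj := fun c => (x c).1
      map := fun {c c'} φ => κ c c' φ
      map_id := fun c => P.p_faithful (by rw [hκ]; simp)
      map_comp := fun φ ψ => P.p_faithful (by rw [hκ, P.p.map_comp, hκ, hκ]; simp) }
  have h2 : l ⋙ P.p = h := CategoryTheory.Functor.ext (fun c => (x c).2) fun c c' φ => hκ c c' φ
  refine ⟨l, functor_ext (fun c => congrArg Subtype.val (hx c)) ?_, h2⟩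
  rw [Functor.assoc, wp, ← Functor.assoc, h2, w]

theorem isPullback_of_fibAux (hb : ∀ b, Function.Bijective (fibAux f₁ f₂ wp b)) :
    IsPullback f₂.toCatHom P.p.toCatHom Q.p.toCatHom f₁.toCatHom := by
  have w : f₂.toCatHom ≫ Q.p.toCatHom = P.p.toCatHom ≫ f₁.toCatHom := Cat.Hom.ext wp
  have key := fun s : Limits.PullbackCone Q.p.toCatHom f₁.toCatHom =>
    exists_lift f₁ f₂ wp hb s.fst.toFunctor s.snd.toFunctor
      (congrArg Cat.Hom.toFunctor s.condition)
  choose l hl hl' using key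
  refine ⟨⟨w⟩, ⟨Limits.PullbackCone.IsLimit.mk w (fun s => (l s).toCatHom)
    (fun s => Cat.Hom.ext (hl s)) (fun s => Cat.Hom.ext (hl' s)) fun s m hm hm' => ?_⟩⟩
  have e1 : m.toFunctor ⋙ f₂ = l s ⋙ f₂ := (congrArg Cat.Hom.toFunctor hm).trans (hl s).symm
  have e2 : m.toFunctor ⋙ P.p = l s ⋙ P.p := (congrArg Cat.Hom.toFunctor hm').trans (hl' s).symm
  refine Cat.Hom.ext (functor_ext (fun c => ?_) e2)
  have := @(hb ((l s ⋙ P.p).obj c)).1 ⟨m.toFunctor.obj c, Functor.congr_obj e2 c⟩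
    ⟨(l s).obj c, rfl⟩ (Subtype.ext (Functor.congr_obj e1 c))
  exact congrArg Subtype.val this

theorem functor_punit_ext {C : Type u} [SmallCategory C] {F G : Discrete PUnit.{u + 1} ⥤ C}
    (h : F.obj ⟨⟨⟩⟩ = G.obj ⟨⟨⟩⟩) : F = G := by
  refine CategoryTheory.Functor.ext (fun _ => h) ?_
  rintro ⟨⟨⟩⟩ ⟨⟨⟩⟩ φ
  obtain rfl : φ = 𝟙 _ := Subsingleton.elim _ _
  simp

theorem fibAux_of_isPullback
    (h : IsPullback f₂.toCatHom P.p.toCatHom Q.p.toCatHom f₁.toCatHom) (b : P.B) :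
    Function.Bijective (fibAux f₁ f₂ wp b) := by
  constructor
  · rintro ⟨e, he⟩ ⟨e', he'⟩ hee
    have hee' : f₂.obj e = f₂.obj e' := congrArg Subtype.val hee
    have : (Functor.fromPUnit.{u} e).toCatHom = (Functor.fromPUnit e').toCatHom :=
      h.hom_ext (Cat.Hom.ext (functor_punit_ext hee')) (Cat.Hom.ext (functor_punit_ext (he.trans he'.symm)))
    exact Subtype.ext (Functor.congr_obj (congrArg Cat.Hom.toFunctor this) ⟨⟨⟩⟩)
  · rintro ⟨e, he⟩
    have w : (Functor.fromPUnit.{u} e).toCatHom ≫ Q.p.toCatHom =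
        (Functor.fromPUnit b).toCatHom ≫ f₁.toCatHom := Cat.Hom.ext (functor_punit_ext he)
    have h1 := Functor.congr_obj (congrArg Cat.Hom.toFunctor (h.lift_fst _ _ w)) ⟨⟨⟩⟩
    have h2 := Functor.congr_obj (congrArg Cat.Hom.toFunctor (h.lift_snd _ _ w)) ⟨⟨⟩⟩
    exact ⟨⟨(h.lift _ _ w).toFunctor.obj ⟨⟨⟩⟩, h2⟩, Subtype.ext h1⟩

end

namespace Hom

theorem ext' {P Q : CatPoly I} {f g : Hom P Q} (h₁ : f.f₁ = g.f₁)
    (h₂ : ∀ e, f.f₂.obj e = g.f₂.obj e) : f = g := by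
  obtain ⟨f₁, f₂, _, _, pb⟩ := f
  obtain ⟨g₁, g₂, _, _, pb'⟩ := g
  obtain rfl : f₁ = g₁ := h₁
  obtain rfl : f₂ = g₂ := functor_ext h₂
    (congrArg Cat.Hom.toFunctor (pb.w.trans pb'.w.symm))
  rfl

variable {P Q S : CatPoly I} (f : Hom P Q)

theorem wp : f.f₂ ⋙ Q.p = P.p ⋙ f.f₁ := congrArg Cat.Hom.toFunctor f.pb.w

/-- The map between fibres induced by a morphism of polynomials. -/
abbrev fibMap {b : P.B} (x : P.Fib b) : Q.Fib (f.f₁.obj b) := fibAux f.f₁ f.f₂ f.wp b x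

/-- The bijection between fibres induced by a morphism of polynomials. -/
noncomputable def fibEquiv (b : P.B) : P.Fib b ≃ Q.Fib (f.f₁.obj b) :=
  Equiv.ofBijective f.fibMap (fibAux_of_isPullback f.f₁ f.f₂ f.wp f.pb b)

/-- The inverse of the bijection between fibres induced by a morphism of polynomials. -/
noncomputable def fibInv {b : P.B} (y : Q.Fib (f.f₁.obj b)) : P.Fib b := (f.fibEquiv b).symm y

@[simp] theorem fibInv_fibMap {b : P.B} (x : P.Fib b) : f.fibInv (f.fibMap x) = x :=
  (f.fibEquiv b).symm_apply_apply x

@[simp] theorem fibMap_fibInv {b : P.B} (y : Q.Fib (f.f₁.obj b)) : f.fibMap (f.fibInv y) = y :=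
  (f.fibEquiv b).apply_symm_apply y

theorem fibInv_eq {b : P.B} {y : Q.Fib (f.f₁.obj b)} {x : P.Fib b} (h : f.fibMap x = y) :
    f.fibInv y = x := by rw [← h, fibInv_fibMap]

theorem sc_fibMap {b : P.B} (x : P.Fib b) : Q.sc (f.fibMap x) = P.sc x :=
  congrArg Discrete.as (Functor.congr_obj f.ws x.1)

theorem sc_fibInv {b : P.B} (y : Q.Fib (f.f₁.obj b)) : P.sc (f.fibInv y) = Q.sc y := by
  rw [← f.sc_fibMap, fibMap_fibInv]

theorem tc_obj (b : P.B) : Q.tc (f.f₁.obj b) = P.tc b :=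
  congrArg Discrete.as (Functor.congr_obj f.wt b)

theorem R_fibMap {b b' : P.B} {β : b ⟶ b'} {x : P.Fib b} {y : P.Fib b'} (r : P.R β x y) :
    Q.R (f.f₁.map β) (f.fibMap x) (f.fibMap y) := fibAux_R f.f₁ f.f₂ f.wp r

theorem R_fibInv {b b' : P.B} {β : b ⟶ b'} {x : Q.Fib (f.f₁.obj b)} {y : Q.Fib (f.f₁.obj b')}
    (r : Q.R (f.f₁.map β) x y) : P.R β (f.fibInv x) (f.fibInv y) := by
  refine R_of_fibAux f.f₁ f.f₂ f.wp (fun b => (f.fibEquiv b).injective) ?_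
  have h1 := f.fibMap_fibInv x
  have h2 := f.fibMap_fibInv y
  rw [fibMap] at h1 h2
  rwa [h1, h2]

/-- The identity morphism. -/
def id (P : CatPoly I) : Hom P P where
  f₁ := 𝟭 _
  f₂ := 𝟭 _
  ws := rfl
  wt := rfl
  pb := IsPullback.of_id_fst

/-- Composition of morphisms. -/
def comp (f : Hom P Q) (g : Hom Q S) : Hom P S where
  f₁ := f.f₁ ⋙ g.f₁
  f₂ := f.f₂ ⋙ g.f₂
  ws := by rw [Functor.assoc, g.ws, f.ws]
  wt := by rw [Functor.assoc, g.wt, f.wt]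
  pb := f.pb.paste_horiz g.pb

theorem fibInv_comp (f : Hom P Q) (g : Hom Q S) {b : P.B} (y : S.Fib ((f.comp g).f₁.obj b)) :
    (f.comp g).fibInv y = f.fibInv (g.fibInv y) :=
  fibInv_eq _ ((congrArg g.fibMap (f.fibMap_fibInv (g.fibInv y))).trans (g.fibMap_fibInv y))

end Hom

section mkHom

variable {P Q : CatPoly I} (f₁ : P.B ⥤ Q.B)

/-- A family of bijections between fibres, compatible with colours and with transport. -/
structure FibFamily where
  ψ : ∀ b, Q.Fib (f₁.obj b) ≃ P.Fib b
  hs : ∀ b y, P.sc (ψ b y) = Q.sc y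
  hR : ∀ {b b' : P.B} (β : b ⟶ b') (x : Q.Fib (f₁.obj b)) (y : Q.Fib (f₁.obj b')),
    Q.R (f₁.map β) x y → P.R β (ψ b x) (ψ b' y)

variable {f₁} (d : FibFamily f₁)

theorem mkHom_aux {e e' : P.E} (κ : e ⟶ e') :
    Q.R (f₁.map (P.p.map κ)) ((d.ψ _).symm ⟨e, rfl⟩) ((d.ψ _).symm ⟨e', rfl⟩) := by
  obtain ⟨y, hy⟩ := exists_right (f₁.map (P.p.map κ)) ((d.ψ _).symm ⟨e, rfl⟩)
  have := d.hR _ _ _ hy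
  rw [Equiv.apply_symm_apply] at this
  rw [(P.R_map κ).right_unique this, Equiv.symm_apply_apply]
  exact hy

/-- The functor `f₂` of the morphism of polynomials given by a functor `f₁` and a family of
bijections between fibres. -/
noncomputable def mkHomF : P.E ⥤ Q.E where
  obj e := ((d.ψ (P.p.obj e)).symm ⟨e, rfl⟩).1
  map κ := (mkHom_aux d κ).choose
  map_id e := Q.p_faithful (by rw [(mkHom_aux d (𝟙 e)).choose_spec]; simp)
  map_comp κ κ' := Q.p_faithful (by
    rw [(mkHom_aux d (κ ≫ κ')).choose_spec, Q.p.map_comp,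
      (mkHom_aux d κ).choose_spec, (mkHom_aux d κ').choose_spec]
    simp)

theorem mkHomF_wp : mkHomF d ⋙ Q.p = P.p ⋙ f₁ :=
  CategoryTheory.Functor.ext (fun e => ((d.ψ (P.p.obj e)).symm ⟨e, rfl⟩).2)
    fun _ _ κ => (mkHom_aux d κ).choose_spec

theorem mkHom_fibAux (b : P.B) (x : P.Fib b) :
    fibAux f₁ (mkHomF d) (mkHomF_wp d) b x = (d.ψ b).symm x := by
  obtain ⟨e, rfl⟩ := x
  rfl

/-- The morphism of polynomials given by a functor `f₁` and a family of bijections between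
fibres that are compatible with colours and with transport. -/
noncomputable def mkHom (wt : f₁ ⋙ Q.t = P.t) : Hom P Q where
  f₁ := f₁
  f₂ := mkHomF d
  ws := SlCat.functor_discrete_ext fun e => by
    have := d.hs _ ((d.ψ (P.p.obj e)).symm ⟨e, rfl⟩)
    rw [Equiv.apply_symm_apply] at this
    exact this.symm
  wt := wt
  pb := isPullback_of_fibAux f₁ _ (mkHomF_wp d) fun b => by
    rw [show fibAux f₁ (mkHomF d) (mkHomF_wp d) b = (d.ψ b).symm from
      funext (mkHom_fibAux d b)]
    exact (d.ψ b).symm.bijective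

theorem mkHom_fibInv (wt : f₁ ⋙ Q.t = P.t) {b : P.B} (y : Q.Fib (f₁.obj b)) :
    (mkHom d wt).fibInv y = d.ψ b y :=
  Hom.fibInv_eq _ ((mkHom_fibAux d b _).trans (Equiv.symm_apply_apply _ _))

end mkHom

/-! ### The 2-natural transformation of a morphism of polynomials -/

namespace Hom

variable {P Q : CatPoly I} (f : Hom P Q) {X Y : SlCat I}

/-- The action on objects. -/
@[reducible] noncomputable def labObj (z : Lab P X) : Lab Q X :=
  ⟨f.f₁.obj z.b, fun y => z.h (f.fibInv y), fun y => (z.w _).trans (f.sc_fibInv y)⟩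

/-- The action on arrows. -/
noncomputable def labHom {z z' : Lab P X} (φ : z ⟶ z') : f.labObj z ⟶ f.labObj z' :=
  Lab.mk' (z := f.labObj z) (z' := f.labObj z') (f.f₁.map (Lab.β φ))
    fun _ _ r => Lab.γ φ (f.R_fibInv r)

/-- The functor `P X ⥤ Q X`. -/
@[reducible] noncomputable def lab (X : SlCat I) : Lab P X ⥤ Lab Q X where
  obj z := f.labObj z
  map φ := f.labHom φ
  map_id z := Lab.hom_ext (f.f₁.map_id _) fun x y r r' => by
    obtain rfl := R_id_iff.1 r'
    rfl
  map_comp φ ψ := Lab.hom_ext (f.f₁.map_comp _ _) fun x y r r' => by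
    have h1 := Q.R_tr (f.f₁.map (Lab.β φ)) x
    have h2 := r'.cancel h1
    exact (Lab.comp_γ φ ψ (f.R_fibInv r) (f.R_fibInv h1) (f.R_fibInv h2)).trans
      (Lab.comp_γ (f.labHom φ) (f.labHom ψ) r' h1 h2).symm

/-- The component at `X`, as a functor over `I`. -/
@[reducible] noncomputable def app (X : SlCat I) : P.fobj X ⟶ Q.fobj X :=
  SlCat.Hom.mk (f.lab X) (SlCat.functor_discrete_ext fun z => f.tc_obj z.b)

/-- The 2-natural transformation of a morphism of polynomials. -/
noncomputable def pfun : TwoCat.TwoNat P.pfun Q.pfun where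
  app X := f.app X
  naturality g := rfl
  naturality₂ {X Y g h} α := by
    refine (Category.comp_id _).trans (Eq.trans ?_ (Category.id_comp _).symm)
    refine SlCat.cell_ext fun z => Lab.hom_ext (f.f₁.map_id _) fun x y r r' => ?_
    obtain rfl := R_id_iff.1 r'
    exact (Lab.mapCell_γ α z (f.fibInv x) (P.R_id _)).trans (Lab.mapCell_γ α (f.labObj z) x _).symm

end Hom

/-! ### 2-cells between morphisms of polynomials -/

/-- A 2-cell between morphisms of polynomials: natural transformations over `I` that are compatible
with the middle functors. (Compatibility with the functors to `I` is automatic, as `I` is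
discrete.) -/
structure Cell {P Q : CatPoly I} (f g : Hom P Q) where
  α₁ : f.f₁ ⟶ g.f₁
  α₂ : f.f₂ ⟶ g.f₂
  wp (e : P.E) : Q.p.map (α₂.app e) =
    eqToHom (Functor.congr_obj f.wp e) ≫ α₁.app (P.p.obj e) ≫
      eqToHom (Functor.congr_obj g.wp e).symm

namespace Cell

variable {P Q : CatPoly I} {f g : Hom P Q} (α : Cell f g)

theorem R_fibMap {b : P.B} (x : P.Fib b) : Q.R (α.α₁.app b) (f.fibMap x) (g.fibMap x) := by
  obtain ⟨e, rfl⟩ := x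
  exact ⟨α.α₂.app e, α.wp e⟩

theorem fibInv_eq {b : P.B} {x : Q.Fib (f.f₁.obj b)} {y : Q.Fib (g.f₁.obj b)}
    (r : Q.R (α.α₁.app b) x y) : f.fibInv x = g.fibInv y := by
  have := α.R_fibMap (f.fibInv x)
  rw [Hom.fibMap_fibInv] at this
  exact (g.fibInv_eq (this.right_unique r)).symm

/-- The component at an object `z` of `P X` of the modification of a 2-cell. -/
noncomputable def labHom {X : SlCat I} (z : Lab P X) : f.labObj z ⟶ g.labObj z :=
  Lab.mk' (z := f.labObj z) (z' := g.labObj z) (α.α₁.app z.b)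
    fun _ _ r => eqToHom (congrArg z.h (α.fibInv_eq r))

theorem γ_eqToHom {X : SlCat I} {z z' : Lab P X} (φ : z ⟶ z') {x x' : P.Fib z.b}
    {y y' : P.Fib z'.b} (hx : x = x') (hy : y = y') (r : P.R (Lab.β φ) x y)
    (r' : P.R (Lab.β φ) x' y') : Lab.γ φ r ≫ eqToHom (congrArg z'.h hy) =
      eqToHom (congrArg z.h hx) ≫ Lab.γ φ r' := by
  subst hx hy
  simp

/-- The component at `X` of the modification of a 2-cell. -/
noncomputable def lab (X : SlCat I) : f.lab X ⟶ g.lab X where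
  app z := α.labHom z
  naturality z z' φ := Lab.hom_ext (α.α₁.naturality (Lab.β φ)) fun x y r r' => by
    have h1 := Q.R_tr (f.f₁.map (Lab.β φ)) x
    have h2 := r.cancel h1
    have h3 := Q.R_tr (α.α₁.app z.b) x
    have h4 := r'.cancel h3
    refine (Lab.comp_γ (f.labHom φ) (α.labHom z') r h1 h2).trans (Eq.trans ?_
      (Lab.comp_γ (α.labHom z) (g.labHom φ) r' h3 h4).symm)
    exact γ_eqToHom φ (α.fibInv_eq h3) (α.fibInv_eq h2) _ _

/-- The modification of a 2-cell between morphisms of polynomials. -/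
noncomputable def pfun : TwoCat.Modif f.pfun g.pfun where
  app X := SlCat.mkCell (α.lab X)
  naturality {X Y} h := by
    refine (Category.comp_id _).trans (Eq.trans ?_ (Category.id_comp _).symm)
    refine SlCat.cell_ext fun z => Lab.hom_ext rfl fun x y r r' => ?_
    exact (eqToHom_map h.F (congrArg z.h (α.fibInv_eq r))).symm

end Cell

end CatPoly

/-! ### Composition of polynomials -/

/-- The data of a discrete fibration and opfibration over `B` with a map to `I`, as a family of
fibres. -/
structure Fam (I : Type u) (B : Type u) [SmallCategory B] where
  F : B → Type u
  rel : ∀ {b b' : B}, (b ⟶ b') → F b → F b' → Prop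
  rel_id : ∀ {b : B} (x : F b), rel (𝟙 b) x x
  rel_comp : ∀ {b b' b'' : B} {β : b ⟶ b'} {β' : b' ⟶ b''} {x : F b} {y : F b'} {z : F b''},
    rel β x y → rel β' y z → rel (β ≫ β') x z
  ex_right : ∀ {b b' : B} (β : b ⟶ b') (x : F b), ∃ y, rel β x y
  ex_left : ∀ {b b' : B} (β : b ⟶ b') (y : F b'), ∃ x, rel β x y
  right_unique : ∀ {b b' : B} {β : b ⟶ b'} {x : F b} {y y' : F b'},
    rel β x y → rel β x y' → y = y'
  left_unique : ∀ {b b' : B} {β : b ⟶ b'} {x x' : F b} {y : F b'},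
    rel β x y → rel β x' y → x = x'
  col : ∀ {b : B}, F b → I
  col_eq : ∀ {b b' : B} {β : b ⟶ b'} {x : F b} {y : F b'}, rel β x y → col x = col y

namespace Fam

variable {I : Type u} {B : Type u} [SmallCategory B]

/-- The objects of the total category. -/
@[ext]
structure Tot (A : Fam I B) : Type u where
  b : B
  x : A.F b

instance (A : Fam I B) : SmallCategory A.Tot where
  Hom e e' := {β : e.b ⟶ e'.b // A.rel β e.x e'.x}
  id e := ⟨𝟙 e.b, A.rel_id e.x⟩
  comp κ κ' := ⟨κ.1 ≫ κ'.1, A.rel_comp κ.2 κ'.2⟩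
  id_comp κ := Subtype.ext (Category.id_comp κ.1)
  comp_id κ := Subtype.ext (Category.comp_id κ.1)
  assoc κ κ' κ'' := Subtype.ext (Category.assoc κ.1 κ'.1 κ''.1)

/-- The projection from the total category. -/
@[reducible] def proj (A : Fam I B) : A.Tot ⥤ B where
  obj e := e.b
  map κ := κ.1

theorem proj_dopf (A : Fam I B) : IsDiscreteOpfibration A.proj := fun e => by
  constructor
  · rintro ⟨⟨b, x⟩, ⟨β, h⟩⟩ ⟨⟨b', x'⟩, ⟨β', h'⟩⟩ hh
    obtain ⟨rfl, hh⟩ := Sigma.mk.inj_iff.1 hh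
    obtain rfl : β = β' := eq_of_heq hh
    obtain rfl := A.right_unique h h'
    rfl
  · rintro ⟨b, β⟩
    obtain ⟨y, hy⟩ := A.ex_right β e.x
    exact ⟨⟨⟨b, y⟩, ⟨β, hy⟩⟩, rfl⟩

theorem proj_dfib (A : Fam I B) : IsDiscreteFibration A.proj := fun e => by
  constructor
  · rintro ⟨⟨b, x⟩, ⟨β, h⟩⟩ ⟨⟨b', x'⟩, ⟨β', h'⟩⟩ hh
    obtain ⟨rfl, hh⟩ := Sigma.mk.inj_iff.1 hh
    obtain rfl : β = β' := eq_of_heq hh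
    obtain rfl := A.left_unique h h'
    rfl
  · rintro ⟨b, β⟩
    obtain ⟨y, hy⟩ := A.ex_left β e.x
    exact ⟨⟨⟨b, y⟩, ⟨β, hy⟩⟩, rfl⟩

/-- The polynomial of a family of fibres over `B`. -/
@[reducible] def poly (A : Fam I B) (t : B ⥤ Discrete I) : CatPoly I where
  B := B
  E := A.Tot
  s :=
    { obj := fun e => ⟨A.col e.x⟩
      map := fun κ => Discrete.eqToHom (A.col_eq κ.2) }
  p := A.proj
  t := t
  dopf := A.proj_dopf
  dfib := A.proj_dfib

/-- The fibres of the polynomial of a family. -/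
def fibEquiv (A : Fam I B) (t : B ⥤ Discrete I) (b : B) : A.F b ≃ (A.poly t).Fib b where
  toFun x := ⟨⟨b, x⟩, rfl⟩
  invFun y := y.2 ▸ y.1.x
  left_inv _ := rfl
  right_inv := by rintro ⟨⟨b', x⟩, rfl⟩; rfl

theorem R_iff (A : Fam I B) (t : B ⥤ Discrete I) {b b' : B} {β : b ⟶ b'} {x : A.F b}
    {y : A.F b'} :
    (A.poly t).R β (A.fibEquiv t b x) (A.fibEquiv t b' y) ↔ A.rel β x y := by
  constructor
  · rintro ⟨⟨κ, h⟩, hκ⟩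
    exact hκ.trans (SlCat.triv β) ▸ h
  · intro h
    exact ⟨⟨β, h⟩, (SlCat.triv β).symm⟩

theorem R_iff' (A : Fam I B) (t : B ⥤ Discrete I) {b b' : B} {β : b ⟶ b'}
    {x : (A.poly t).Fib b} {y : (A.poly t).Fib b'} :
    (A.poly t).R β x y ↔ A.rel β ((A.fibEquiv t b).symm x) ((A.fibEquiv t b').symm y) := by
  rw [← A.R_iff t, Equiv.apply_symm_apply, Equiv.apply_symm_apply]

theorem sc_eq (A : Fam I B) (t : B ⥤ Discrete I) {b : B} (y : (A.poly t).Fib b) :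
    (A.poly t).sc y = A.col ((A.fibEquiv t b).symm y) := by
  obtain ⟨⟨b', x⟩, rfl⟩ := y
  rfl

end Fam

namespace CatPoly

variable {I : Type u}

variable (I) in
/-- The identity polynomial `I ← I → I → I`. -/
@[reducible] def one : CatPoly I where
  B := Discrete I
  E := Discrete I
  s := 𝟭 _
  p := 𝟭 _
  t := 𝟭 _
  dopf _ := Function.bijective_id
  dfib _ := Function.bijective_id

/-- The category `B` of a polynomial, as a category over `I`. -/
@[reducible] def base (P : CatPoly I) : SlCat I := ⟨P.B, P.t⟩

/-- The fibres of the middle functor of the composite of two polynomials: over a labelling `z` of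
the fibre of `P` over `z.b` by objects of the base of `Q`, the pairs of an element `x` of that fibre
and of an element of the fibre of `Q` over the label of `x`. -/
@[reducible] def compFam (P Q : CatPoly I) : Fam I (Lab P Q.base) where
  F z := Σ x : P.Fib z.b, Q.Fib (z.h x)
  rel φ x y := ∃ r : P.R (Lab.β φ) x.1 y.1, Q.R (Lab.γ φ r) x.2 y.2
  rel_id {z} x := ⟨P.R_id x.1, Q.R_id x.2⟩
  rel_comp {z z' z'' φ φ' x y w} := fun ⟨r, q⟩ ⟨r', q'⟩ => by
    refine ⟨r.comp r', ?_⟩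
    rw [Lab.comp_γ φ φ' (r.comp r') r r']
    exact q.comp q'
  ex_right φ x := ⟨⟨P.tr (Lab.β φ) x.1, Q.tr (Lab.γ φ (P.R_tr _ _)) x.2⟩,
    P.R_tr _ _, Q.R_tr _ _⟩
  ex_left φ y := by
    obtain ⟨x, r⟩ := exists_left (Lab.β φ) y.1
    obtain ⟨x', r'⟩ := exists_left (Lab.γ φ r) y.2
    exact ⟨⟨x, x'⟩, r, r'⟩
  right_unique {z z' φ x y y'} := by
    obtain ⟨y, e⟩ := y
    obtain ⟨y', e'⟩ := y'
    rintro ⟨r, q⟩ ⟨r', q'⟩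
    obtain rfl : y = y' := r.right_unique r'
    obtain rfl : e = e' := q.right_unique q'
    rfl
  left_unique {z z' φ x x' y} := by
    obtain ⟨x, e⟩ := x
    obtain ⟨x', e'⟩ := x'
    rintro ⟨r, q⟩ ⟨r', q'⟩
    obtain rfl : x = x' := r.left_unique r'
    obtain rfl : e = e' := q.left_unique q'
    rfl
  col x := Q.sc x.2
  col_eq := fun ⟨_, q⟩ => q.sc_eq

/-- The composite of two polynomials, whose 2-functor is `X ↦ P (Q X)`. -/
@[reducible] noncomputable def comp (P Q : CatPoly I) : CatPoly I :=
  (compFam P Q).poly (Lab.proj P Q.base)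

section

variable {P Q : CatPoly I}

/-- The elements of the fibres of a composite. -/
noncomputable def pr (z : Lab P Q.base) : (P.comp Q).Fib z ≃ Σ x : P.Fib z.b, Q.Fib (z.h x) :=
  ((compFam P Q).fibEquiv (Lab.proj P Q.base) z).symm

theorem R_pr {z z' : Lab P Q.base} {φ : z ⟶ z'} {x : (P.comp Q).Fib z} {y : (P.comp Q).Fib z'} :
    (P.comp Q).R φ x y ↔
      ∃ r : P.R (Lab.β φ) (pr z x).1 (pr z' y).1, Q.R (Lab.γ φ r) (pr z x).2 (pr z' y).2 :=
  (compFam P Q).R_iff' _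

theorem sc_pr {z : Lab P Q.base} (x : (P.comp Q).Fib z) : (P.comp Q).sc x = Q.sc (pr z x).2 :=
  (compFam P Q).sc_eq _ x

theorem sc_pr_symm {z : Lab P Q.base} (w : Σ x : P.Fib z.b, Q.Fib (z.h x)) :
    (P.comp Q).sc ((pr z).symm w) = Q.sc w.2 := by
  rw [sc_pr, Equiv.apply_symm_apply]

theorem R_pr_symm {z z' : Lab P Q.base} {φ : z ⟶ z'} {w : Σ x : P.Fib z.b, Q.Fib (z.h x)}
    {w' : Σ x : P.Fib z'.b, Q.Fib (z'.h x)} :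
    (P.comp Q).R φ ((pr z).symm w) ((pr z').symm w') ↔
      ∃ r : P.R (Lab.β φ) w.1 w'.1, Q.R (Lab.γ φ r) w.2 w'.2 :=
  (compFam P Q).R_iff _

end

/-- A morphism of polynomials, restricted to the categories `B`. -/
@[reducible] def Hom.base {P Q : CatPoly I} (f : Hom P Q) : P.base ⟶ Q.base :=
  SlCat.Hom.mk f.f₁ f.wt

/-- The horizontal composite of two morphisms of polynomials. -/
noncomputable def hcomp {P P' Q Q' : CatPoly I} (f : Hom P P') (g : Hom Q Q') :
    Hom (P.comp Q) (P'.comp Q') :=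
  mkHom (f₁ := Lab.map P g.base ⋙ f.lab Q'.base)
    { ψ := fun z => (pr (f.labObj (Lab.mapObj g.base z))).trans
        ((Equiv.sigmaCongr (f.fibEquiv z.b).symm fun x =>
          (g.fibEquiv (z.h (f.fibInv x))).symm).trans (pr z).symm)
      hs := fun z y => by
        rw [sc_pr, sc_pr]
        simp only [Equiv.trans_apply]
        exact g.sc_fibInv _
      hR := fun {z z'} φ x y r => by
        rw [R_pr] at r ⊢
        obtain ⟨r, r'⟩ := r
        simp only [Equiv.trans_apply, Equiv.apply_symm_apply]
        exact ⟨f.R_fibInv r, g.R_fibInv r'⟩ }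
    (SlCat.functor_discrete_ext fun z => f.tc_obj z.b)

/-- The unitor `X ⟶ 1 X` on objects. -/
@[reducible] def unitObj {X : SlCat I} (x : X.C) : Lab (one I) X :=
  ⟨⟨X.col x⟩, fun _ => x, fun y => (congrArg Discrete.as y.2).symm⟩

/-- The functor `X ⥤ 1 X`. -/
@[reducible] noncomputable def unitFun (X : SlCat I) : X.C ⥤ Lab (one I) X where
  obj x := unitObj x
  map {x y} a := Lab.mk' (z := unitObj x) (z' := unitObj y) (Discrete.eqToHom (X.col_eq a))
    fun _ _ _ => a
  map_id x := Lab.hom_ext rfl fun _ _ _ _ => rfl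
  map_comp a b := Lab.hom_ext (Subsingleton.elim _ _) fun x z r r' => by
    have h1 := (one I).R_tr (Discrete.eqToHom (X.col_eq a)) x
    have h2 := r'.cancel h1
    exact (Lab.comp_γ _ _ r' h1 h2).symm

/-- The functor `X ⥤ 1 X` over `I`. -/
@[reducible] noncomputable def unitApp (X : SlCat I) : X ⟶ (one I).fobj X :=
  SlCat.Hom.mk (unitFun X) (SlCat.functor_discrete_ext fun _ => rfl)

/-- The inverse of the functor `X ⥤ 1 X`. -/
@[reducible] noncomputable def evFun (X : SlCat I) : Lab (one I) X ⥤ X.C where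
  obj z := z.h ⟨z.b, rfl⟩
  map φ := Lab.γ φ (⟨Lab.β φ, Subsingleton.elim _ _⟩ : (one I).R (Lab.β φ) ⟨_, rfl⟩ ⟨_, rfl⟩)
  map_id _ := rfl
  map_comp φ ψ := Lab.comp_γ φ ψ _ _ _

theorem ev_faithful {X : SlCat I} {z z' : Lab (one I) X} {φ ψ : z ⟶ z'}
    (h : (evFun X).map φ = (evFun X).map ψ) : φ = ψ :=
  Lab.hom_ext (Subsingleton.elim _ _) fun x y r r' => by
    obtain ⟨x, hx⟩ := x
    obtain ⟨y, hy⟩ := y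
    cases hx
    cases hy
    exact h

theorem ev_injective {X : SlCat I} {z z' : Lab (one I) X}
    (h : (evFun X).obj z = (evFun X).obj z') : z = z' := by
  obtain ⟨b, l, w⟩ := z
  obtain ⟨b', l', w'⟩ := z'
  have hb : b = b' := Discrete.ext
    ((w ⟨b, rfl⟩).symm.trans ((congrArg X.col h).trans (w' ⟨b', rfl⟩)))
  subst hb
  obtain rfl : l = l' := funext fun ⟨x, hx⟩ => by subst hx; exact h
  rfl

theorem evFun_ext {X : SlCat I} {C : Type u} [SmallCategory C] {F G : C ⥤ Lab (one I) X}
    (h : F ⋙ evFun X = G ⋙ evFun X) : F = G := by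
  refine CategoryTheory.Functor.ext (fun c => ev_injective (Functor.congr_obj h c))
    fun c c' φ => ev_faithful ?_
  rw [(evFun X).map_comp, (evFun X).map_comp, eqToHom_map, eqToHom_map]
  exact Functor.congr_hom h φ

/-- The 2-natural transformation `1 ⟶ PFun(1)`. -/
noncomputable def pfunUnit : TwoCat.TwoNat (StrictPseudofunctor.id (SlCat I)) (one I).pfun where
  app X := unitApp X
  naturality {X Y} g := SlCat.Hom.ext (evFun_ext rfl)
  naturality₂ {X Y g h} α := by
    refine SlCat.cell_ext fun x => ev_faithful ?_
    rw [SlCat.cmp_comp, SlCat.cmp_comp, SlCat.cmp_eqToHom, SlCat.cmp_eqToHom]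
    refine ((evFun Y).map_comp _ _).trans (Eq.trans ?_ ((evFun Y).map_comp _ _).symm)
    refine (congrArg (_ ≫ ·) (eqToHom_map (evFun Y) _)).trans (Eq.trans ?_
      (congrArg (· ≫ _) (eqToHom_map (evFun Y) _)).symm)
    refine (Category.comp_id _).trans (Eq.trans ?_ (Category.id_comp _).symm)
    exact (Lab.mapCell_γ α (unitObj x) _ ((one I).R_id _)).symm

section

variable {P Q : CatPoly I} {X : SlCat I}

/-- The functor `P (Q X) ⥤ (P Q) X` on objects. -/
@[reducible] noncomputable def compObj (z : Lab P (Q.fobj X)) : Lab (P.comp Q) X :=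
  ⟨⟨z.b, fun x => (z.h x).b, z.w⟩, fun y => (z.h (pr _ y).1).h (pr _ y).2, fun y => by
    rw [sc_pr]; exact (z.h _).w _⟩

/-- The functor `P (Q X) ⥤ (P Q) X` on arrows, at the level of bases. -/
@[reducible] noncomputable def compHomβ {z z' : Lab P (Q.fobj X)} (φ : z ⟶ z') :
    (compObj z).b ⟶ (compObj z').b :=
  Lab.mk' (z := (compObj z).b) (z' := (compObj z').b) (Lab.β (z := z) (z' := z') φ)
    fun _ _ r => Lab.β (X := X) (P := Q) (Lab.γ (z := z) (z' := z') φ r)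

/-- The functor `P (Q X) ⥤ (P Q) X` on arrows. -/
noncomputable def compHom {z z' : Lab P (Q.fobj X)} (φ : z ⟶ z') : compObj z ⟶ compObj z' :=
  Lab.mk' (z := compObj z) (z' := compObj z') (compHomβ φ)
    fun _ _ r => Lab.γ (X := X) (P := Q) (Lab.γ (z := z) (z' := z') φ (R_pr.1 r).choose)
      (R_pr.1 r).choose_spec

/-- The functor `P (Q X) ⥤ (P Q) X`. -/
@[reducible] noncomputable def compFun (P Q : CatPoly I) (X : SlCat I) :
    Lab P (Q.fobj X) ⥤ Lab (P.comp Q) X where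
  obj z := compObj z
  map {z z'} φ := compHom φ
  map_id z := Lab.hom_ext (Lab.hom_ext rfl fun x y r r' => by
      obtain rfl := R_id_iff.1 r
      rfl) fun x y r r' => by
    obtain rfl := R_id_iff.1 r'
    rfl
  map_comp {z₁ z₂ z₃} φ ψ := Lab.hom_ext (Lab.hom_ext rfl fun x y r r' => by
      have h1 := P.R_tr (Lab.β φ) x
      have h2 := r'.cancel h1
      refine Eq.trans ?_ (Lab.comp_γ (compHomβ φ) (compHomβ ψ) r' h1 h2).symm
      exact congrArg Lab.β (Lab.comp_γ φ ψ r h1 h2)) fun x y r r' => by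
    have h1 := (P.comp Q).R_tr (compHomβ φ) x
    have h2 := r'.cancel h1
    refine Eq.trans ?_ (Lab.comp_γ (compHom φ) (compHom ψ) r' h1 h2).symm
    have k1 := (R_pr.1 h1).choose_spec
    have k2 := (R_pr.1 h2).choose_spec
    exact (Lab.γ_congr (Lab.comp_γ φ ψ (R_pr.1 r).choose (R_pr.1 h1).choose (R_pr.1 h2).choose)
      (R_pr.1 r).choose_spec (k1.comp k2)).trans (Lab.comp_γ _ _ _ k1 k2)

/-- The functor `P (Q X) ⥤ (P Q) X` over `I`. -/
@[reducible] noncomputable def compApp (P Q : CatPoly I) (X : SlCat I) :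
    P.fobj (Q.fobj X) ⟶ (P.comp Q).fobj X :=
  SlCat.Hom.mk (compFun P Q X) (SlCat.functor_discrete_ext fun _ => rfl)

/-- The 2-natural transformation `PFun(P) PFun(Q) ⟶ PFun(P Q)`. -/
noncomputable def pfunComp (P Q : CatPoly I) :
    TwoCat.TwoNat (Q.pfun.comp P.pfun) (P.comp Q).pfun where
  app X := compApp P Q X
  naturality g := rfl
  naturality₂ {X Y g h} α := by
    refine (Category.comp_id _).trans (Eq.trans ?_ (Category.id_comp _).symm)
    refine SlCat.cell_ext fun z => Lab.hom_ext (Lab.hom_ext rfl fun x y r r' => ?_)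
      fun x y r r' => ?_
    · obtain rfl := R_id_iff.1 r
      exact Category.comp_id _
    · obtain rfl := R_id_iff.1 r'
      refine (Lab.γ_congr (Lab.mapCell_γ (Q.fmap₂ α) z _ (P.R_id _)) (R_pr.1 r).choose_spec
        (Q.R_id _)).trans ?_
      exact (Lab.mapCell_γ α _ _ _).trans (Lab.mapCell_γ α (compObj z) x _).symm

end

/-- The unitor `P ⟶ 1 P`. -/
noncomputable def lu (P : CatPoly I) : Hom P ((one I).comp P) :=
  mkHom (f₁ := unitFun P.base)
    { ψ := fun b => (pr (unitObj (X := P.base) b)).trans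
        { toFun := fun x => x.2
          invFun := fun y => ⟨⟨⟨P.tc b⟩, rfl⟩, y⟩
          left_inv := by rintro ⟨⟨x, hx⟩, y⟩; cases hx; rfl
          right_inv := fun y => rfl }
      hs := fun b y => (sc_pr y).symm
      hR := fun β x y r => (R_pr.1 r).choose_spec }
    (SlCat.functor_discrete_ext fun _ => rfl)

/-- The functor `P.B ⥤ (P 1).B`. -/
@[reducible] noncomputable def ruFun (P : CatPoly I) : P.B ⥤ Lab P (one I).base where
  obj b := ⟨b, fun x => ⟨P.sc x⟩, fun _ => rfl⟩
  map β := Lab.mk' β fun _ _ r => Discrete.eqToHom r.sc_eq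
  map_id _ := Lab.hom_ext rfl fun _ _ _ _ => Subsingleton.elim _ _
  map_comp _ _ := Lab.hom_ext rfl fun _ _ _ _ => Subsingleton.elim _ _

/-- The unitor `P ⟶ P 1`. -/
noncomputable def ru (P : CatPoly I) : Hom P (P.comp (one I)) :=
  mkHom (f₁ := P.ruFun)
    { ψ := fun b => (pr (P.ruFun.obj b)).trans
        { toFun := fun x => x.1
          invFun := fun y => ⟨y, ⟨⟨P.sc y⟩, rfl⟩⟩
          left_inv := by rintro ⟨x, ⟨y, hy⟩⟩; cases hy; rfl
          right_inv := fun y => rfl }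
      hs := fun b y => by
        rw [sc_pr]
        exact (congrArg Discrete.as (pr (P.ruFun.obj b) y).2.2).symm
      hR := fun β x y r => (R_pr.1 r).choose }
    (SlCat.functor_discrete_ext fun _ => rfl)

/-- The associator `P (Q S) ⟶ (P Q) S`. -/
noncomputable def assoc (P Q S : CatPoly I) : Hom (P.comp (Q.comp S)) ((P.comp Q).comp S) :=
  mkHom (f₁ := compFun P Q S.base)
    { ψ := fun z => (pr (compObj z)).trans ((Equiv.sigmaCongr (pr (compObj z).b)
          fun _ => Equiv.refl _).trans ((Equiv.sigmaAssoc _).trans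
            ((Equiv.sigmaCongrRight fun x => (pr (z.h x)).symm).trans (pr z).symm)))
      hs := fun z y => (sc_pr_symm _).trans ((sc_pr_symm _).trans (sc_pr y).symm)
      hR := fun {z z'} φ x y r => by
        obtain ⟨r, q⟩ := R_pr.1 r
        obtain ⟨r₁, r₂⟩ := R_pr.1 r
        exact R_pr_symm.2 ⟨r₁, R_pr_symm.2 ⟨r₂, q⟩⟩ }
    (SlCat.functor_discrete_ext fun _ => rfl)

end CatPoly

/-! ### Monads in polynomials -/

namespace CatPoly

variable {I : Type u}

/-- A monad structure on a polynomial. -/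
structure Mon (P : CatPoly I) where
  u : Hom (one I) P
  m : Hom (P.comp P) P
  left_unit : P.lu.comp ((hcomp u (Hom.id P)).comp m) = Hom.id P
  right_unit : P.ru.comp ((hcomp (Hom.id P) u).comp m) = Hom.id P
  assoc : (assoc P P P).comp ((hcomp m (Hom.id P)).comp m) = (hcomp (Hom.id P) m).comp m

/-- The property of being a morphism of monads of polynomials. -/
structure IsMonMor {P Q : CatPoly I} (M : Mon P) (N : Mon Q) (f : Hom P Q) : Prop where
  unit : M.u.comp f = N.u
  mult : M.m.comp f = (hcomp f f).comp N.m

theorem Lab.hom_heq {P : CatPoly I} {X : SlCat I} {z₁ z₁' z₂ z₂' : Lab P X} (h₁ : z₁ = z₁')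
    (h₂ : z₂ = z₂') {φ : z₁ ⟶ z₂} {ψ : z₁' ⟶ z₂'} (hβ : Lab.β φ ≍ Lab.β ψ)
    (hγ : ∀ x y (r : P.R (Lab.β φ) x y) x' y' (r' : P.R (Lab.β ψ) x' y'), x ≍ x' → y ≍ y' →
      Lab.γ φ r ≍ Lab.γ ψ r') : φ ≍ ψ := by
  subst h₁ h₂
  exact heq_of_eq (Lab.hom_ext (eq_of_heq hβ) fun x y r r' =>
    eq_of_heq (hγ x y r x y r' HEq.rfl HEq.rfl))

theorem Lab.γ_heq {P : CatPoly I} {X : SlCat I} {z z' : Lab P X} (φ : z ⟶ z')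
    {x x' : P.Fib z.b} {y y' : P.Fib z'.b} (hx : x = x') (hy : y = y') (r : P.R (Lab.β φ) x y)
    (r' : P.R (Lab.β φ) x' y') : Lab.γ φ r ≍ Lab.γ φ r' := by
  subst hx hy
  rfl

theorem Lab.functor_ext {P : CatPoly I} {X : SlCat I} {C : Type u} [SmallCategory C]
    {F G : C ⥤ Lab P X} (h : ∀ c, F.obj c = G.obj c)
    (hβ : ∀ {c c' : C} (φ : c ⟶ c'), Lab.β (F.map φ) ≍ Lab.β (G.map φ))
    (hγ : ∀ {c c' : C} (φ : c ⟶ c') x y (r : P.R (Lab.β (F.map φ)) x y) x' y'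
      (r' : P.R (Lab.β (G.map φ)) x' y'), x ≍ x' → y ≍ y' →
      Lab.γ (F.map φ) r ≍ Lab.γ (G.map φ) r') : F = G :=
  Functor.hext h fun c c' φ => Lab.hom_heq (h c) (h c') (hβ φ) (hγ φ)

theorem Lab.obj_ext {P : CatPoly I} {X : SlCat I} {b : P.B} {h h' : P.Fib b → X.C} {w w'}
    (e : ∀ x, h x = h' x) : (⟨b, h, w⟩ : Lab P X) = ⟨b, h', w'⟩ := by
  obtain rfl : h = h' := funext e
  rfl

theorem app_comp {P Q S : CatPoly I} (f : Hom P Q) (g : Hom Q S) (X : SlCat I) :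
    (f.comp g).app X = f.app X ≫ g.app X :=
  SlCat.Hom.ext (Lab.functor_ext
    (fun z => Lab.obj_ext fun x => congrArg z.h (Hom.fibInv_comp f g x))
    (fun _ => HEq.rfl) fun φ x y r x' y' r' hx hy => by
      cases hx
      cases hy
      exact Lab.γ_heq φ (Hom.fibInv_comp f g x) (Hom.fibInv_comp f g y) _ _)

theorem fibInv_id (P : CatPoly I) {b : P.B} (x : P.Fib b) : (Hom.id P).fibInv (b := b) x = x :=
  Hom.fibInv_eq _ rfl

theorem app_id (P : CatPoly I) (X : SlCat I) : (Hom.id P).app X = 𝟙 (P.fobj X) :=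
  SlCat.Hom.ext (Lab.functor_ext
    (fun z => Lab.obj_ext fun x => congrArg z.h (fibInv_id P x))
    (fun _ => HEq.rfl) fun φ x y r x' y' r' hx hy => by
      cases hx
      cases hy
      exact Lab.γ_heq φ (fibInv_id P x) (fibInv_id P y) _ _)

theorem lu_fibInv (P : CatPoly I) {b : P.B} (y : ((one I).comp P).Fib (P.lu.f₁.obj b)) :
    P.lu.fibInv y = (pr (unitObj (X := P.base) b) y).2 := mkHom_fibInv _ _ y

theorem ru_fibInv (P : CatPoly I) {b : P.B} (y : (P.comp (one I)).Fib (P.ru.f₁.obj b)) :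
    P.ru.fibInv y = (pr (P.ruFun.obj b) y).1 := mkHom_fibInv _ _ y

theorem lu_app (P : CatPoly I) (X : SlCat I) :
    P.lu.app X = unitApp (P.fobj X) ≫ compApp (one I) P X :=
  SlCat.Hom.ext (Lab.functor_ext
    (fun z => Lab.obj_ext fun x => congrArg z.h (lu_fibInv P x))
    (fun _ => HEq.rfl) fun φ x y r x' y' r' hx hy => by
      cases hx
      cases hy
      exact Lab.γ_heq φ (lu_fibInv P x) (lu_fibInv P y) _ _)

theorem discrete_heq {a a' b b' : Discrete I} (ha : a = a') (hb : b = b') (f : a ⟶ b)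
    (g : a' ⟶ b') : f ≍ g := by
  subst ha hb
  exact heq_of_eq (Subsingleton.elim _ _)

theorem pr_fst_heq {P Q : CatPoly I} {z z' : Lab P Q.base} (h : z = z') {x : (P.comp Q).Fib z}
    {x' : (P.comp Q).Fib z'} (hx : x ≍ x') : (pr z x).1 ≍ (pr z' x').1 := by
  subst h
  cases hx
  rfl

theorem lab_congr {P Q : CatPoly I} {X : SlCat I} {b : P.B} (h : P.Fib b → X.C)
    {k k' : P.Fib b → Q.B} (hk : k = k') (w w' w₁ w₁') :
    (⟨⟨b, k, w⟩, fun y => h (pr ⟨b, k, w⟩ y).1, w₁⟩ : Lab (P.comp Q) X) =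
      ⟨⟨b, k', w'⟩, fun y => h (pr ⟨b, k', w'⟩ y).1, w₁'⟩ := by
  subst hk
  rfl

theorem ru_base (P : CatPoly I) {X : SlCat I} (z : Lab P X) :
    P.ruFun.obj z.b = (compObj (Lab.mapObj (unitApp X) z)).b :=
  Lab.obj_ext fun x => Discrete.ext (z.w x).symm

theorem ru_app (P : CatPoly I) (X : SlCat I) :
    P.ru.app X = P.fmap (unitApp X) ≫ compApp P (one I) X :=
  SlCat.Hom.ext (Lab.functor_ext
    (fun z => Eq.trans (Lab.obj_ext fun x => congrArg z.h (ru_fibInv P x))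
      (lab_congr z.h (funext fun x => Discrete.ext (z.w x).symm) (P.ruFun.obj z.b).w
        (compObj (Lab.mapObj (unitApp X) z)).b.w
        (fun x => (z.w _).trans ((sc_pr x).trans
          (congrArg Discrete.as (pr _ x).2.2)).symm) _))
    (fun {z z'} φ => Lab.hom_heq (ru_base P z) (ru_base P z') HEq.rfl
      fun x y r x' y' r' hx hy => discrete_heq
        (by cases hx; exact Discrete.ext (z.w _).symm)
        (by cases hy; exact Discrete.ext (z'.w _).symm) _ _)
    fun {z z'} φ x y r x' y' r' hx hy =>
      Lab.γ_heq φ ((ru_fibInv P x).trans (eq_of_heq (pr_fst_heq (ru_base P z) hx)))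
        ((ru_fibInv P y).trans (eq_of_heq (pr_fst_heq (ru_base P z') hy))) _ _)

theorem hcomp_fibInv {P P' Q Q' : CatPoly I} (f : Hom P P') (g : Hom Q Q') {z : Lab P Q.base}
    (y : (P'.comp Q').Fib ((hcomp f g).f₁.obj z)) :
    (hcomp f g).fibInv y = (pr z).symm
      ⟨f.fibInv (pr (f.labObj (Lab.mapObj g.base z)) y).1,
        g.fibInv (pr (f.labObj (Lab.mapObj g.base z)) y).2⟩ := mkHom_fibInv _ _ y

theorem compObj_h {P Q : CatPoly I} {X : SlCat I} (z : Lab P (Q.fobj X))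
    {y : (P.comp Q).Fib (compObj z).b} {w : Σ x : P.Fib z.b, Q.Fib (z.h x).b}
    (h : y = (pr (compObj z).b).symm w) : (compObj z).h y = (z.h w.1).h w.2 := by
  subst h
  exact congrArg (fun v : Σ x : P.Fib z.b, Q.Fib (z.h x).b => (z.h v.1).h v.2)
    ((pr (compObj z).b).apply_symm_apply w)

theorem compHom_γ {P Q : CatPoly I} {X : SlCat I} {z z' : Lab P (Q.fobj X)} (φ : z ⟶ z')
    {y : (P.comp Q).Fib (compObj z).b} {w : Σ x : P.Fib z.b, Q.Fib (z.h x).b}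
    (h : y = (pr (compObj z).b).symm w)
    {y' : (P.comp Q).Fib (compObj z').b} {w' : Σ x : P.Fib z'.b, Q.Fib (z'.h x).b}
    (h' : y' = (pr (compObj z').b).symm w') (r : (P.comp Q).R (compHomβ φ) y y')
    (r₁ : P.R (Lab.β φ) w.1 w'.1) (r₂ : Q.R (Lab.β (X := X) (P := Q) (Lab.γ φ r₁)) w.2 w'.2) :
    Lab.γ (compHom φ) r ≍ Lab.γ (X := X) (P := Q) (Lab.γ φ r₁) r₂ := by
  obtain rfl : pr (compObj z).b y = w := by rw [h, Equiv.apply_symm_apply]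
  obtain rfl : pr (compObj z').b y' = w' := by rw [h', Equiv.apply_symm_apply]
  rfl

theorem hcomp_app {P P' Q Q' : CatPoly I} (f : Hom P P') (g : Hom Q Q') (X : SlCat I) :
    compApp P Q X ≫ (hcomp f g).app X =
      P.fmap (g.app X) ≫ f.app (Q'.fobj X) ≫ compApp P' Q' X :=
  SlCat.Hom.ext (Lab.functor_ext
    (fun z => Lab.obj_ext fun y => compObj_h z (hcomp_fibInv f g y))
    (fun _ => HEq.rfl) fun {z z'} φ x y r x' y' r' hx hy => by
      cases hx
      cases hy
      have r₁ := (R_pr.1 r').choose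
      have r₂ := (R_pr.1 r').choose_spec
      exact compHom_γ φ (hcomp_fibInv f g x) (hcomp_fibInv f g y) ((hcomp f g).R_fibInv r)
        (f.R_fibInv r₁) (g.R_fibInv r₂))

theorem assoc_fibInv (P Q S : CatPoly I) {z : Lab P (Q.comp S).base}
    (y : ((P.comp Q).comp S).Fib ((assoc P Q S).f₁.obj z)) :
    (assoc P Q S).fibInv y = (pr z).symm
      ⟨(pr (compObj z).b (pr (compObj z) y).1).1, (pr (z.h _)).symm
        ⟨(pr (compObj z).b (pr (compObj z) y).1).2, (pr (compObj z) y).2⟩⟩ := mkHom_fibInv _ _ y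

set_option maxHeartbeats 1000000 in
theorem assoc_app (P Q S : CatPoly I) (X : SlCat I) :
    P.fmap (compApp Q S X) ≫ compApp P (Q.comp S) X ≫ (assoc P Q S).app X =
      compApp P Q (S.fobj X) ≫ compApp (P.comp Q) S X :=
  SlCat.Hom.ext (Lab.functor_ext
    (fun z => Lab.obj_ext fun y =>
      (compObj_h (Lab.mapObj (compApp Q S X) z) (assoc_fibInv P Q S y)).trans
        (compObj_h (z.h _) rfl))
    (fun _ => HEq.rfl) fun {z z'} φ x y r x' y' r' hx hy => by
      cases hx
      cases hy
      let v := pr (compObj (compObj z)).b x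
      let v' := pr (compObj (compObj z')).b y
      obtain ⟨r₁, r₂⟩ := R_pr.1 r'
      obtain ⟨r₃, r₄⟩ := R_pr.1 r₁
      have k := compHom_γ (Lab.mapHom (compApp Q S X) φ) (assoc_fibInv P Q S x)
        (assoc_fibInv P Q S y) ((assoc P Q S).R_fibInv r) r₃ (R_pr_symm.2 ⟨r₄, r₂⟩)
      refine k.trans ?_
      have k₂ := compHom_γ (P := Q) (Q := S) (X := X)
        (z := z.h (pr (compObj z).b v.1).1) (z' := z'.h (pr (compObj z').b v'.1).1)
        (Lab.γ (z := z) (z' := z') φ r₃)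
        (w := ⟨(pr (compObj z).b v.1).2, v.2⟩) (w' := ⟨(pr (compObj z').b v'.1).2, v'.2⟩)
        rfl rfl (R_pr_symm.2 ⟨r₄, r₂⟩) r₄ r₂
      exact k₂)

/-- The 2-monad on `Cat/I` of a monad of polynomials. -/
noncomputable def Mon.pfun {P : CatPoly I} (M : Mon P) : TwoCat.TwoMonad (SlCat I) where
  T := P.pfun
  η := pfunUnit.comp M.u.pfun
  μ := (pfunComp P P).comp M.m.pfun
  left_unit X := by
    change (unitApp (P.fobj X) ≫ M.u.app (P.fobj X)) ≫ compApp P P X ≫ M.m.app X = 𝟙 _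
    have h := hcomp_app M.u (Hom.id P) X
    rw [app_id] at h
    have h' : compApp (one I) P X ≫ (hcomp M.u (Hom.id P)).app X =
      M.u.app (P.fobj X) ≫ compApp P P X := h
    calc _ = unitApp (P.fobj X) ≫ (M.u.app (P.fobj X) ≫ compApp P P X) ≫ M.m.app X := rfl
      _ = P.lu.app X ≫ (hcomp M.u (Hom.id P)).app X ≫ M.m.app X := by rw [← h', lu_app]; rfl
      _ = _ := by rw [← app_comp, ← app_comp, M.left_unit, app_id]
  right_unit X := by
    change P.fmap (unitApp X ≫ M.u.app X) ≫ compApp P P X ≫ M.m.app X = 𝟙 _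
    have h := hcomp_app (Hom.id P) M.u X
    rw [app_id] at h
    have h' : compApp P (one I) X ≫ (hcomp (Hom.id P) M.u).app X =
      P.fmap (M.u.app X) ≫ compApp P P X := h
    calc _ = P.fmap (unitApp X) ≫ (P.fmap (M.u.app X) ≫ compApp P P X) ≫ M.m.app X := rfl
      _ = P.ru.app X ≫ (hcomp (Hom.id P) M.u).app X ≫ M.m.app X := by rw [← h', ru_app]; rfl
      _ = _ := by rw [← app_comp, ← app_comp, M.right_unit, app_id]
  assoc X := by
    change P.fmap (compApp P P X ≫ M.m.app X) ≫ compApp P P X ≫ M.m.app X =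
      (compApp P P (P.fobj X) ≫ M.m.app (P.fobj X)) ≫ compApp P P X ≫ M.m.app X
    have h := hcomp_app (Hom.id P) M.m X
    rw [app_id] at h
    have h₁ : compApp P (P.comp P) X ≫ (hcomp (Hom.id P) M.m).app X =
      P.fmap (M.m.app X) ≫ compApp P P X := h
    have h' := hcomp_app M.m (Hom.id P) X
    rw [app_id] at h'
    have h₂ : compApp (P.comp P) P X ≫ (hcomp M.m (Hom.id P)).app X =
      M.m.app (P.fobj X) ≫ compApp P P X := h'
    calc _ = P.fmap (compApp P P X) ≫ (P.fmap (M.m.app X) ≫ compApp P P X) ≫ M.m.app X := rfl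
      _ = P.fmap (compApp P P X) ≫ compApp P (P.comp P) X ≫
          (hcomp (Hom.id P) M.m).app X ≫ M.m.app X := by rw [← h₁]; rfl
      _ = (P.fmap (compApp P P X) ≫ compApp P (P.comp P) X ≫ (CatPoly.assoc P P P).app X) ≫
          (hcomp M.m (Hom.id P)).app X ≫ M.m.app X := by
        rw [← app_comp, ← M.assoc, app_comp, app_comp]; rfl
      _ = compApp P P (P.fobj X) ≫ (compApp (P.comp P) P X ≫ (hcomp M.m (Hom.id P)).app X) ≫
          M.m.app X := by rw [assoc_app]; rfl
      _ = _ := by rw [h₂]; rfl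

end CatPoly

/-! ### The polynomial of arrows and the polynomial of connected components -/

namespace CatPoly

variable {I : Type u}

section

variable {E B : Type u} [SmallCategory E] [SmallCategory B] {p : E ⥤ B}

theorem _root_.IsDiscreteOpfibration.faithful (hp : IsDiscreteOpfibration p) {e e' : E}
    {κ κ' : e ⟶ e'} (h : p.map κ = p.map κ') : κ = κ' := by
  have := @(hp e).1 ⟨e', κ⟩ ⟨e', κ'⟩ (by simp [h])
  simpa using this

theorem _root_.IsDiscreteOpfibration.exists_lift (hp : IsDiscreteOpfibration p) {e : E} {b : B}
    (β : p.obj e ⟶ b) : ∃ (e' : E) (κ : e ⟶ e') (h : p.obj e' = b), p.map κ ≫ eqToHom h = β := by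
  obtain ⟨⟨e', κ⟩, h⟩ := (hp e).2 ⟨b, β⟩
  obtain ⟨rfl, h⟩ := Sigma.mk.inj_iff.1 h
  exact ⟨e', κ, rfl, by simpa using eq_of_heq h⟩

theorem _root_.IsDiscreteOpfibration.lift_unique (hp : IsDiscreteOpfibration p) {e e' e'' : E}
    (κ : e ⟶ e') (κ' : e ⟶ e'') (h : p.obj e' = p.obj e'')
    (w : p.map κ ≫ eqToHom h = p.map κ') : ∃ h' : e' = e'', κ ≫ eqToHom h' = κ' := by
  have := @(hp e).1 ⟨e', κ⟩ ⟨e'', κ'⟩ (Sigma.ext h (by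
    dsimp only
    rw [← w, heq_comp_eqToHom_iff]))
  cases this
  exact ⟨rfl, by simp⟩

theorem _root_.IsDiscreteOpfibration.mapArrow (hp : IsDiscreteOpfibration p) :
    IsDiscreteOpfibration p.mapArrow := by
  rintro ⟨e, e', κ⟩
  constructor
  · rintro ⟨⟨x, x', f⟩, sq⟩ ⟨⟨y, y', g⟩, sq'⟩ h
    have hl := @(hp e).1 ⟨x, sq.left⟩ ⟨y, sq'.left⟩
      (congrArg (fun v : Σ b, (p.mapArrow.obj ⟨e, e', κ⟩ ⟶ b) =>
        (⟨v.1.left, v.2.left⟩ : Σ b, (p.obj e ⟶ b))) h)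
    have hr := @(hp e').1 ⟨x', sq.right⟩ ⟨y', sq'.right⟩
      (congrArg (fun v : Σ b, (p.mapArrow.obj ⟨e, e', κ⟩ ⟶ b) =>
        (⟨v.1.right, v.2.right⟩ : Σ b, (p.obj e' ⟶ b))) h)
    obtain ⟨hx, hl⟩ := Sigma.mk.inj_iff.1 hl
    obtain ⟨hx', hr⟩ := Sigma.mk.inj_iff.1 hr
    cases hx
    cases hx'
    have hfg : f = g := hp.faithful (Arrow.mk_injective _ _ (congrArg Sigma.fst h))
    cases hfg
    have : sq = sq' := Arrow.hom_ext _ _ (eq_of_heq hl) (eq_of_heq hr)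
    rw [this]
  · rintro ⟨⟨b, b', f⟩, sq⟩
    obtain ⟨e₁, a, h, ha⟩ := hp.exists_lift (e := e) (b := b) sq.left
    obtain ⟨e₁', a', h', ha'⟩ := hp.exists_lift (e := e') (b := b') sq.right
    subst h h'
    obtain ⟨e₂, c, h, hc⟩ := hp.exists_lift (e := e₁) (b := p.obj e₁') f
    have ha : p.map a = sq.left := by simpa using ha
    have ha' : p.map a' = sq.right := by simpa using ha'
    have w : p.map a ≫ f = p.map κ ≫ p.map a' := by
      rw [ha, ha']
      exact Arrow.w sq
    obtain ⟨h', hac⟩ := hp.lift_unique (a ≫ c) (κ ≫ a') h (by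
      rw [p.map_comp, p.map_comp, ← w, Category.assoc, hc])
    subst h'
    obtain rfl : p.map c = f := by simpa using hc
    refine ⟨⟨Arrow.mk c, Arrow.homMk a a' (by simpa using hac)⟩, Sigma.ext rfl (heq_of_eq ?_)⟩
    exact Arrow.hom_ext _ _ ha ha'

theorem _root_.IsDiscreteFibration.faithful (hp : IsDiscreteFibration p) {e e' : E}
    {κ κ' : e ⟶ e'} (h : p.map κ = p.map κ') : κ = κ' := by
  have := @(hp e').1 ⟨e, κ⟩ ⟨e, κ'⟩ (by simp [h])
  simpa using this

theorem _root_.IsDiscreteFibration.exists_lift (hp : IsDiscreteFibration p) {e : E} {b : B}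
    (β : b ⟶ p.obj e) : ∃ (e' : E) (κ : e' ⟶ e) (h : b = p.obj e'), eqToHom h ≫ p.map κ = β := by
  obtain ⟨⟨e', κ⟩, h⟩ := (hp e).2 ⟨b, β⟩
  obtain ⟨rfl, h⟩ := Sigma.mk.inj_iff.1 h
  exact ⟨e', κ, rfl, by simpa using eq_of_heq h⟩

theorem _root_.IsDiscreteFibration.lift_unique (hp : IsDiscreteFibration p) {e e' e'' : E}
    (κ : e' ⟶ e) (κ' : e'' ⟶ e) (h : p.obj e'' = p.obj e')
    (w : eqToHom h ≫ p.map κ = p.map κ') : ∃ h' : e'' = e', eqToHom h' ≫ κ = κ' := by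
  have := @(hp e).1 ⟨e', κ⟩ ⟨e'', κ'⟩ (Sigma.ext h.symm (by
    dsimp only
    rw [← w, heq_eqToHom_comp_iff]))
  cases this
  exact ⟨rfl, by simp⟩

theorem _root_.IsDiscreteFibration.mapArrow (hp : IsDiscreteFibration p) :
    IsDiscreteFibration p.mapArrow := by
  rintro ⟨e, e', κ⟩
  constructor
  · rintro ⟨⟨x, x', f⟩, sq⟩ ⟨⟨y, y', g⟩, sq'⟩ h
    have hl := @(hp e).1 ⟨x, sq.left⟩ ⟨y, sq'.left⟩
      (congrArg (fun v : Σ b, (b ⟶ p.mapArrow.obj ⟨e, e', κ⟩) =>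
        (⟨v.1.left, v.2.left⟩ : Σ b, (b ⟶ p.obj e))) h)
    have hr := @(hp e').1 ⟨x', sq.right⟩ ⟨y', sq'.right⟩
      (congrArg (fun v : Σ b, (b ⟶ p.mapArrow.obj ⟨e, e', κ⟩) =>
        (⟨v.1.right, v.2.right⟩ : Σ b, (b ⟶ p.obj e'))) h)
    obtain ⟨hx, hl⟩ := Sigma.mk.inj_iff.1 hl
    obtain ⟨hx', hr⟩ := Sigma.mk.inj_iff.1 hr
    cases hx
    cases hx'
    have hfg : f = g := hp.faithful (Arrow.mk_injective _ _ (congrArg Sigma.fst h))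
    cases hfg
    have : sq = sq' := Arrow.hom_ext _ _ (eq_of_heq hl) (eq_of_heq hr)
    rw [this]
  · rintro ⟨⟨b, b', f⟩, sq⟩
    obtain ⟨e₁, a, h, ha⟩ := hp.exists_lift (e := e) (b := b) sq.left
    obtain ⟨e₁', a', h', ha'⟩ := hp.exists_lift (e := e') (b := b') sq.right
    subst h h'
    obtain ⟨e₂, c, h, hc⟩ := hp.exists_lift (e := e₁') (b := p.obj e₁) f
    have ha : p.map a = sq.left := by simpa using ha
    have ha' : p.map a' = sq.right := by simpa using ha'
    have w : p.map a ≫ p.map κ = f ≫ p.map a' := by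
      rw [ha, ha']
      exact Arrow.w sq
    obtain ⟨h', hac⟩ := hp.lift_unique (c ≫ a') (a ≫ κ) h (by
      rw [p.map_comp, p.map_comp, w, ← Category.assoc, hc])
    subst h'
    obtain rfl : p.map c = f := by simpa using hc
    refine ⟨⟨Arrow.mk c, Arrow.homMk a a' (by simpa using hac.symm)⟩,
      Sigma.ext rfl (heq_of_eq ?_)⟩
    exact Arrow.hom_ext _ _ ha ha'

end

/-- The polynomial of arrows of a polynomial. -/
@[reducible] noncomputable def arr (P : CatPoly I) : CatPoly I where
  B := Arrow P.B
  E := Arrow P.E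
  s := Arrow.leftFunc ⋙ P.s
  p := P.p.mapArrow
  t := Arrow.leftFunc ⋙ P.t
  dopf := P.dopf.mapArrow
  dfib := P.dfib.mapArrow

/-- The morphism of polynomials sending an arrow to its source. -/
def arrSource (P : CatPoly I) : Hom P.arr P where
  f₁ := Arrow.leftFunc
  f₂ := Arrow.leftFunc
  ws := rfl
  wt := rfl
  pb := isPullback_of_fibAux (P := P.arr) (Q := P) Arrow.leftFunc Arrow.leftFunc rfl
    fun ⟨b, b', f⟩ => by
      constructor
      · rintro ⟨⟨x, x', κ⟩, h⟩ ⟨⟨y, y', κ'⟩, h'⟩ hh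
        obtain rfl : x = y := congrArg Subtype.val hh
        have := @(P.dopf x).1 ⟨x', κ⟩ ⟨y', κ'⟩ (by
          obtain ⟨_, h₂, h₃⟩ := Comma.mk.inj (h.trans h'.symm)
          exact Sigma.ext h₂ h₃)
        cases this
        rfl
      · rintro ⟨e, he⟩
        cases he
        obtain ⟨⟨e', κ⟩, h⟩ := (P.dopf e).2 ⟨b', f⟩
        cases h
        exact ⟨⟨⟨e, e', κ⟩, rfl⟩, rfl⟩

/-- The morphism of polynomials sending an arrow to its target. -/
def arrTarget (P : CatPoly I) : Hom P.arr P where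
  f₁ := Arrow.rightFunc
  f₂ := Arrow.rightFunc
  ws := SlCat.functor_discrete_ext fun κ => (Discrete.eq_of_hom (P.s.map κ.hom)).symm
  wt := SlCat.functor_discrete_ext fun β => (Discrete.eq_of_hom (P.t.map β.hom)).symm
  pb := isPullback_of_fibAux (P := P.arr) (Q := P) Arrow.rightFunc Arrow.rightFunc rfl
    fun ⟨b, b', f⟩ => by
      constructor
      · rintro ⟨⟨x, x', κ⟩, h⟩ ⟨⟨y, y', κ'⟩, h'⟩ hh
        obtain rfl : x' = y' := congrArg Subtype.val hh
        have := @(P.dfib x').1 ⟨x, κ⟩ ⟨y, κ'⟩ (by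
          obtain ⟨h₁, _, h₃⟩ := Comma.mk.inj (h.trans h'.symm)
          exact Sigma.ext h₁ h₃)
        cases this
        rfl
      · rintro ⟨e, he⟩
        cases he
        obtain ⟨⟨e', κ⟩, h⟩ := (P.dfib e).2 ⟨b, f⟩
        cases h
        exact ⟨⟨⟨e', e, κ⟩, rfl⟩, rfl⟩

/-- The 2-cell given by the arrows themselves. -/
def arrCell (P : CatPoly I) : Cell P.arrSource P.arrTarget where
  α₁ := Arrow.leftToRight
  α₂ := Arrow.leftToRight
  wp κ := (SlCat.triv (P.p.map κ.hom)).symm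

/-- A functor between discrete categories is a discrete opfibration. -/
theorem discrete_dopf {X Y : Type u} (p : Discrete X ⥤ Discrete Y) :
    IsDiscreteOpfibration p := by
  rintro e
  constructor
  · rintro ⟨e', f⟩ ⟨e'', g⟩ _
    obtain rfl := Discrete.ext (Discrete.eq_of_hom f)
    obtain rfl := Discrete.ext (Discrete.eq_of_hom g)
    exact Sigma.ext rfl (heq_of_eq (Subsingleton.elim _ _))
  · rintro ⟨b, f⟩
    obtain rfl := Discrete.ext (Discrete.eq_of_hom f)
    exact ⟨⟨e, 𝟙 e⟩, Sigma.ext rfl (heq_of_eq (Subsingleton.elim _ _))⟩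

/-- A functor between discrete categories is a discrete fibration. -/
theorem discrete_dfib {X Y : Type u} (p : Discrete X ⥤ Discrete Y) :
    IsDiscreteFibration p := by
  rintro e
  constructor
  · rintro ⟨e', f⟩ ⟨e'', g⟩ _
    obtain rfl := Discrete.ext (Discrete.eq_of_hom f)
    obtain rfl := Discrete.ext (Discrete.eq_of_hom g)
    exact Sigma.ext rfl (heq_of_eq (Subsingleton.elim _ _))
  · rintro ⟨b, f⟩
    obtain rfl := Discrete.ext (Discrete.eq_of_hom f)
    exact ⟨⟨e, 𝟙 e⟩, Sigma.ext rfl (heq_of_eq (Subsingleton.elim _ _))⟩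

/-- The set of connected components of a category, as a discrete category. -/
abbrev Conn (C : Type u) [SmallCategory C] : Type u := Discrete (ConnectedComponents C)

/-- The functor `q` from a category to its set of connected components. -/
def conn (C : Type u) [SmallCategory C] : C ⥤ Conn C :=
  ConnectedComponents.functorToDiscrete _ id

/-- The functor between sets of connected components induced by a functor. -/
def connMap {C D : Type u} [SmallCategory C] [SmallCategory D] (F : C ⥤ D) : Conn C ⥤ Conn D :=
  Discrete.functor fun x => ⟨F.mapConnectedComponents x⟩

/-- The functor from the set of connected components of a category to a set induced by a functor
from that category to the set. -/
def connDesc {C : Type u} [SmallCategory C] (F : C ⥤ Discrete I) : Conn C ⥤ Discrete I :=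
  Discrete.functor fun x => ⟨ConnectedComponents.liftFunctor _ F x⟩

/-- The polynomial of connected components of a polynomial. -/
@[reducible] def pi0 (P : CatPoly I) : CatPoly I where
  B := Conn P.B
  E := Conn P.E
  s := connDesc P.s
  p := connMap P.p
  t := connDesc P.t
  dopf := discrete_dopf _
  dfib := discrete_dfib _

end CatPoly

/-! ### Operads -/

/-- The data of a (symmetric, coloured) operad with set of colours `I`: the sets `Hom n c i` of
arrows with source the sequence `c` of length `n` and with target `i`, the actions of permutations,
the units and the compositions. -/
structure OperadData (I : Type u) : Type (u + 1) where
  Hom : (n : ℕ) → (Fin n → I) → I → Type u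
  act : ∀ {n : ℕ} {c : Fin n → I} {i : I}, Hom n c i → ∀ ρ : Equiv.Perm (Fin n), Hom n (c ∘ ρ) i
  one : ∀ i : I, Hom 1 (fun _ => i) i
  comp : ∀ {n : ℕ} {c : Fin n → I} {i : I}, Hom n c i → ∀ (m : Fin n → ℕ)
    (d : ∀ j, Fin (m j) → I), (∀ j, Hom (m j) (d j) (c j)) →
    Hom (∑ j, m j) (fun x => d (finSigmaFinEquiv.symm x).1 (finSigmaFinEquiv.symm x).2) i

namespace OperadData

variable {I : Type u} (T : OperadData I)

/-- The set of all arrows. -/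
structure Op : Type u where
  n : ℕ
  c : Fin n → I
  i : I
  a : T.Hom n c i

variable {T}

/-- An arrow, as an element of the set of all arrows. -/
abbrev toOp {n : ℕ} {c : Fin n → I} {i : I} (a : T.Hom n c i) : T.Op := ⟨n, c, i, a⟩

/-- The action of a bijection between `Fin k` and `Fin n` (so that `k = n`). -/
def actHom {k n : ℕ} (h : k = n) (e : Fin k ≃ Fin n) {c : Fin n → I} {i : I} (a : T.Hom n c i) :
    T.Hom k (c ∘ e) i := by
  subst h
  exact T.act a e

/-- The action of a bijection between `Fin k` and `Fin n` on an arrow with source of length `n`. -/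
def Op.reindex {k : ℕ} (α : T.Op) (e : Fin k ≃ Fin α.n) : T.Op :=
  ⟨k, α.c ∘ e, α.i, actHom (Fin.equiv_iff_eq.1 ⟨e⟩) e α.a⟩

/-- The bijection that permutes blocks using `ρ`, and the elements of the block that is put in the
`j`-th place using `σ j`. -/
def blockEquiv {k n : ℕ} {l : Fin k → ℕ} {m : Fin n → ℕ} (ρ : Fin k ≃ Fin n)
    (σ : ∀ j, Fin (l j) ≃ Fin (m (ρ j))) : Fin (∑ j, l j) ≃ Fin (∑ j, m j) :=
  finSigmaFinEquiv.symm.trans ((Equiv.sigmaCongr ρ σ).trans finSigmaFinEquiv)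

theorem blockEquiv_apply {k n : ℕ} {l : Fin k → ℕ} {m : Fin n → ℕ} (ρ : Fin k ≃ Fin n)
    (σ : ∀ j, Fin (l j) ≃ Fin (m (ρ j))) (j : Fin k) (x : Fin (l j)) :
    blockEquiv ρ σ (finSigmaFinEquiv ⟨j, x⟩) = finSigmaFinEquiv ⟨ρ j, σ j x⟩ := by
  exact congrArg (fun v => finSigmaFinEquiv (Equiv.sigmaCongr ρ σ v))
    (finSigmaFinEquiv.symm_apply_apply (⟨j, x⟩ : Σ j, Fin (l j)))

variable (T) in
/-- The axioms of operads. Those about compositions are equations in the set of all arrows. -/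
structure IsOperad : Prop where
  act_one {n : ℕ} {c : Fin n → I} {i : I} (a : T.Hom n c i) : T.act a 1 = a
  act_mul {n : ℕ} {c : Fin n → I} {i : I} (a : T.Hom n c i) (ρ₁ ρ₂ : Equiv.Perm (Fin n)) :
    T.act (T.act a ρ₁) ρ₂ = T.act a (ρ₁ * ρ₂)
  one_comp {n : ℕ} {c : Fin n → I} {i : I} (a : T.Hom n c i) :
    toOp (T.comp (T.one i) (fun _ => n) (fun _ => c) fun _ => a) = toOp a
  comp_one {n : ℕ} {c : Fin n → I} {i : I} (a : T.Hom n c i) :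
    toOp (T.comp a (fun _ => 1) (fun j _ => c j) fun j => T.one (c j)) = toOp a
  assoc {n : ℕ} {c : Fin n → I} {i : I} (a : T.Hom n c i) (m : Fin n → ℕ)
    (d : ∀ j, Fin (m j) → I) (b : ∀ j, T.Hom (m j) (d j) (c j)) (p : ∀ j, Fin (m j) → ℕ)
    (f : ∀ j k, Fin (p j k) → I) (g : ∀ j k, T.Hom (p j k) (f j k) (d j k)) :
    toOp (T.comp a (fun j => ∑ k, p j k) _ fun j => T.comp (b j) (p j) (f j) (g j)) =
      toOp (T.comp (T.comp a m d b)
        (fun x => p (finSigmaFinEquiv.symm x).1 (finSigmaFinEquiv.symm x).2)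
        (fun x => f (finSigmaFinEquiv.symm x).1 (finSigmaFinEquiv.symm x).2)
        fun x => g (finSigmaFinEquiv.symm x).1 (finSigmaFinEquiv.symm x).2)
  equivariance {n : ℕ} {c : Fin n → I} {i : I} (a : T.Hom n c i) (m : Fin n → ℕ)
    (d : ∀ j, Fin (m j) → I) (b : ∀ j, T.Hom (m j) (d j) (c j)) (ρ : Equiv.Perm (Fin n))
    (σ : ∀ j, Equiv.Perm (Fin (m (ρ j)))) :
    (toOp (T.comp a m d b)).reindex (blockEquiv ρ σ) =
      toOp (T.comp (T.act a ρ) (fun j => m (ρ j)) (fun j => d (ρ j) ∘ σ j)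
        fun j => T.act (b (ρ j)) (σ j))

end OperadData

/-- A (symmetric, coloured) operad with set of colours `I`. -/
structure Operad (I : Type u) extends OperadData I where
  isOperad : toOperadData.IsOperad

namespace OperadData

variable {I : Type u} (T : OperadData I)

/-- An operad is `Σ`-free when no arrow is fixed by a non-identity permutation that fixes its source
sequence. -/
def SigmaFree : Prop :=
  ∀ {n : ℕ} {c : Fin n → I} {i : I} (ρ : Equiv.Perm (Fin n)), ρ ≠ 1 → ∀ hc : c ∘ ρ = c,
    ∀ a : T.Hom n c i, (hc ▸ T.act a ρ : T.Hom n c i) ≠ a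

end OperadData

/-! ### The polynomial of an operad -/

namespace Operad

open OperadData

variable {I : Type u} (T : Operad I)

theorem reindex_refl (α : T.Op) : α.reindex (Equiv.refl _) = α := by
  obtain ⟨n, c, i, a⟩ := α
  exact congrArg (Op.mk n c i) (T.isOperad.act_one a)

theorem reindex_trans {k l : ℕ} (α : T.Op) (e : Fin k ≃ Fin α.n) (f : Fin l ≃ Fin k) :
    (α.reindex e).reindex f = α.reindex (f.trans e) := by
  obtain ⟨n, c, i, a⟩ := α
  obtain rfl : k = n := Fin.equiv_iff_eq.1 ⟨e⟩
  obtain rfl : l = k := Fin.equiv_iff_eq.1 ⟨f⟩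
  exact congrArg (Op.mk l _ i) (T.isOperad.act_mul a e f)

/-- The objects of the category `B_T`: the arrows of `T`. -/
structure B : Type u where
  op : T.Op

/-- The arrows `α ⟶ β` of the category `B_T`: the permutations that act on `β` to give `α`. -/
@[ext]
structure BHom (α β : T.B) : Type u where
  e : Fin α.op.n ≃ Fin β.op.n
  w : α.op = β.op.reindex e

theorem eq_reindex {α β δ : T.Op} (h : β = δ) (e : Fin α.n ≃ Fin β.n) (w : α = β.reindex e) :
    α = δ.reindex (e.trans (finCongr (congrArg Op.n h))) := by
  subst h
  exact w

theorem comp_w {α β γ : T.Op} (e : Fin α.n ≃ Fin β.n) (f : Fin β.n ≃ Fin γ.n)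
    (h : α = β.reindex e) (h' : β = γ.reindex f) : α = γ.reindex (e.trans f) := by
  exact (T.eq_reindex h' e h).trans (T.reindex_trans γ f _)

instance : SmallCategory T.B where
  Hom α β := T.BHom α β
  id α := ⟨Equiv.refl _, (T.reindex_refl _).symm⟩
  comp f g := ⟨f.e.trans g.e, T.comp_w _ _ f.w g.w⟩

variable {T}

/-- The bijection underlying an arrow of `B_T`. -/
def perm {α β : T.B} (f : α ⟶ β) : Fin α.op.n ≃ Fin β.op.n := BHom.e f

theorem perm_w {α β : T.B} (f : α ⟶ β) : α.op = β.op.reindex (perm f) := BHom.w f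

theorem perm_ext {α β : T.B} {f g : α ⟶ β} (h : perm f = perm g) : f = g := BHom.ext h

theorem c_reindex {α β : T.Op} (e : Fin α.n ≃ Fin β.n) (h : α = β.reindex e) (j : Fin α.n) :
    α.c j = β.c (e j) := by
  obtain ⟨n, c, i, a⟩ := α
  exact congrFun (eq_of_heq (Op.mk.inj h).2.1) j

variable (T)

/-- The functor sending an arrow of `T` to its target. -/
@[reducible] def tgt : T.B ⥤ Discrete I where
  obj α := ⟨α.op.i⟩
  map f := Discrete.eqToHom ((congrArg Op.i (perm_w f) : _))

/-- The fibres of the functor `E_T ⟶ B_T`: the objects of `E_T` over an arrow `α` of `T` are the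
pairs of `α` and of a place of the source of `α`. -/
@[reducible] def places : Fam I T.B where
  F α := ULift (Fin α.op.n)
  rel f j k := perm f j.down = k.down
  rel_id _ := rfl
  rel_comp {_ _ _ _ g _ _ _} h h' := (congrArg (perm g) h).trans h'
  ex_right f j := ⟨⟨perm f j.down⟩, rfl⟩
  ex_left f k := ⟨⟨(perm f).symm k.down⟩, (perm f).apply_symm_apply _⟩
  right_unique h h' := ULift.ext _ _ (h.symm.trans h')
  left_unique {_ _ f _ _ _} h h' := ULift.ext _ _ ((perm f).injective (h.trans h'.symm))
  col {α} j := α.op.c j.down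
  col_eq {_ _ f _ _} h := (c_reindex (perm f) (perm_w f) _).trans (congrArg _ h)

/-- The polynomial `I ← E_T → B_T → I` of an operad. -/
@[reducible] def poly : CatPoly I := T.places.poly T.tgt

variable {T}

/-- The element of a fibre of `E_T ⟶ B_T` given by a place. -/
def place {α : T.B} (j : Fin α.op.n) : T.poly.Fib α := T.places.fibEquiv T.tgt α ⟨j⟩

/-- The place of an element of a fibre of `E_T ⟶ B_T`. -/
def idx {α : T.B} (x : T.poly.Fib α) : Fin α.op.n := ((T.places.fibEquiv T.tgt α).symm x).down

@[simp] theorem idx_place {α : T.B} (j : Fin α.op.n) : idx (place j) = j := rfl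

@[simp] theorem place_idx {α : T.B} (x : T.poly.Fib α) : place (idx x) = x :=
  (T.places.fibEquiv T.tgt α).apply_symm_apply x

theorem idx_inj {α : T.B} {x y : T.poly.Fib α} (h : idx x = idx y) : x = y := by
  rw [← place_idx x, h, place_idx]

/-- The bijection between elements of a fibre of `E_T ⟶ B_T` and places. -/
def idxEquiv {α : T.B} : T.poly.Fib α ≃ Fin α.op.n where
  toFun := idx
  invFun := place
  left_inv := place_idx
  right_inv := idx_place

theorem R_idx {α β : T.B} {f : α ⟶ β} {x : T.poly.Fib α} {y : T.poly.Fib β} :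
    T.poly.R f x y ↔ perm f (idx x) = idx y := T.places.R_iff' T.tgt

theorem R_place {α β : T.B} (f : α ⟶ β) (j : Fin α.op.n) :
    T.poly.R f (place j) (place (perm f j)) := R_idx.2 rfl

theorem sc_idx {α : T.B} (x : T.poly.Fib α) : T.poly.sc x = α.op.c (idx x) :=
  T.places.sc_eq T.tgt x

/-- Composition, on the set of all arrows. -/
def compOp (α : T.Op) (h : Fin α.n → T.Op) (H : ∀ j, (h j).i = α.c j) : T.Op :=
  toOp (T.comp α.a (fun j => (h j).n) (fun j => (h j).c) fun j => H j ▸ (h j).a)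

theorem compOp_reindex {α α' : T.Op} {h : Fin α.n → T.Op} {h' : Fin α'.n → T.Op}
    (H : ∀ j, (h j).i = α.c j) (H' : ∀ j, (h' j).i = α'.c j) (e : Fin α.n ≃ Fin α'.n)
    (w : α = α'.reindex e) (σ : ∀ j, Fin (h j).n ≃ Fin (h' (e j)).n)
    (w' : ∀ j, h j = (h' (e j)).reindex (σ j)) :
    compOp α h H = (compOp α' h' H').reindex (blockEquiv e σ) := by
  obtain ⟨n, c, i, a⟩ := α
  obtain ⟨n', c', i', a'⟩ := α'
  dsimp only at h h' e σ w' H H'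
  obtain rfl : n = n' := Fin.equiv_iff_eq.1 ⟨e⟩
  dsimp only [Op.reindex] at w
  cases w
  obtain ⟨m', d', t', b', rfl⟩ : ∃ (m : Fin n → ℕ) (d : ∀ j, Fin (m j) → I) (t : Fin n → I)
      (b : ∀ j, T.Hom (m j) (d j) (t j)), h' = fun j => ⟨m j, d j, t j, b j⟩ :=
    ⟨_, _, _, _, rfl⟩
  obtain ⟨m, d, t, b, rfl⟩ : ∃ (m : Fin n → ℕ) (d : ∀ j, Fin (m j) → I) (t : Fin n → I)
      (b : ∀ j, T.Hom (m j) (d j) (t j)), h = fun j => ⟨m j, d j, t j, b j⟩ :=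
    ⟨_, _, _, _, rfl⟩
  obtain rfl : t' = c' := funext H'
  dsimp only at σ w'
  obtain rfl : m = fun j => m' (e j) := funext fun j => Fin.equiv_iff_eq.1 ⟨σ j⟩
  obtain rfl : t = fun j => t' (e j) := funext fun j => congrArg Op.i (w' j)
  have hd : d = fun j => d' (e j) ∘ σ j := funext fun j =>
    eq_of_heq (Op.mk.inj (w' j)).2.1
  subst hd
  obtain rfl : b = fun j => T.act (b' (e j)) (σ j) := funext fun j =>
    eq_of_heq (Op.mk.inj (w' j)).2.2.2
  exact (T.isOperad.equivariance a' m' d' b' e σ).symm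

/-- The unit of the polynomial of an operad. -/
noncomputable def unitHom : CatPoly.Hom (CatPoly.one I) T.poly :=
  CatPoly.mkHom (f₁ := Discrete.functor fun i => ⟨toOp (T.one i)⟩)
    { ψ := fun i =>
        { toFun := fun _ => ⟨i, rfl⟩
          invFun := fun _ => place (0 : Fin 1)
          left_inv := fun x => idx_inj (Subsingleton.elim (α := Fin 1) _ _)
          right_inv := by rintro ⟨x, hx⟩; cases hx; rfl }
      hs := fun _ y => (sc_idx y).symm
      hR := fun β x y r => ⟨β, Subsingleton.elim _ _⟩ }
    (SlCat.functor_discrete_ext fun _ => rfl)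

/-- Composition, as a map from the objects of `(P_T P_T).B` to `B_T`. -/
@[reducible] def multObj (z : CatPoly.Lab T.poly T.poly.base) : T.B :=
  ⟨compOp z.b.op (fun j => (z.h (place j)).op) fun j => (z.w _).trans (sc_idx _)⟩

/-- Composition, as a functor. -/
@[reducible] def multFun (T : Operad I) : CatPoly.Lab T.poly T.poly.base ⥤ T.B where
  obj z := multObj z
  map {z z'} φ := BHom.mk
    (blockEquiv (perm (CatPoly.Lab.β φ)) fun j => perm (CatPoly.Lab.γ φ (R_place _ j)))
    (compOp_reindex _ _ _ (perm_w _) _ fun j => perm_w (CatPoly.Lab.γ φ (R_place _ j)))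
  map_id z := perm_ext (Equiv.ext fun x => by
    obtain ⟨⟨j, k⟩, rfl⟩ := finSigmaFinEquiv.surjective x
    exact blockEquiv_apply (l := fun j => (z.h (place j)).op.n) _ _ j k)
  map_comp {z z' z''} f g := perm_ext (Equiv.ext fun x => by
    obtain ⟨⟨j, k⟩, rfl⟩ := finSigmaFinEquiv.surjective x
    refine (blockEquiv_apply (l := fun j => (z.h (place j)).op.n) _ _ j k).trans (Eq.trans ?_
      ((congrArg (blockEquiv _ _) (blockEquiv_apply (l := fun j => (z.h (place j)).op.n) _ _ j k)).trans
        (blockEquiv_apply _ _ _ _)).symm)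
    have h := CatPoly.Lab.comp_γ f g (R_place _ j) (R_place _ j) (R_place _ _)
    exact congrArg (fun v => finSigmaFinEquiv (m := z''.b.op.n)
      (n := fun j => (z''.h (place j)).op.n)
      ⟨perm (CatPoly.Lab.β g) (perm (CatPoly.Lab.β f) j), perm v k⟩) h)

theorem multFun_R {z z' : CatPoly.Lab T.poly T.poly.base} (φ : z ⟶ z')
    (s : Σ j : Fin z.b.op.n, Fin (z.h (place j)).op.n)
    (s' : Σ j : Fin z'.b.op.n, Fin (z'.h (place j)).op.n)
    (h : s' = ⟨perm (CatPoly.Lab.β φ) s.1, perm (CatPoly.Lab.γ φ (R_place _ s.1)) s.2⟩) :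
    ∃ r : T.poly.R (CatPoly.Lab.β φ) (place s.1) (place s'.1),
      T.poly.R (CatPoly.Lab.γ φ r) (place s.2) (place s'.2) := by
  subst h
  exact ⟨R_place _ _, R_place _ _⟩

/-- The bijection between the places of a composite and the places of its factors. -/
noncomputable def multEquiv (z : CatPoly.Lab T.poly T.poly.base) :
    T.poly.Fib (multObj z) ≃ (T.poly.comp T.poly).Fib z :=
  let e : (Σ j : Fin z.b.op.n, Fin (z.h (place j)).op.n) ≃ Σ x : T.poly.Fib z.b, T.poly.Fib (z.h x) :=
    Equiv.sigmaCongr (idxEquiv (α := z.b)).symm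
      fun j => (idxEquiv (α := z.h (place j))).symm
  (idxEquiv (α := multObj z)).trans (finSigmaFinEquiv.symm.trans (e.trans (CatPoly.pr z).symm))

theorem multEquiv_apply (z : CatPoly.Lab T.poly T.poly.base) (y : T.poly.Fib (multObj z)) :
    multEquiv z y = (CatPoly.pr z).symm
      ⟨place (finSigmaFinEquiv.symm (idx y)).1, place (finSigmaFinEquiv.symm (idx y)).2⟩ := rfl

/-- The multiplication of the polynomial of an operad. -/
noncomputable def multHom (T : Operad I) : CatPoly.Hom (T.poly.comp T.poly) T.poly :=
  CatPoly.mkHom (f₁ := T.multFun)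
    { ψ := fun z => multEquiv z
      hs := fun z y => (CatPoly.sc_pr_symm
        (⟨place (finSigmaFinEquiv.symm (idx y)).1, place (finSigmaFinEquiv.symm (idx y)).2⟩ :
          Σ x : T.poly.Fib z.b, T.poly.Fib (z.h x))).trans ((sc_idx _).trans (sc_idx y).symm)
      hR := fun {z z'} φ x y r => CatPoly.R_pr_symm.2 (multFun_R φ (finSigmaFinEquiv.symm (idx x))
        (finSigmaFinEquiv.symm (idx y)) (by
        have h := (R_idx.1 r).symm
        rw [h]
        exact finSigmaFinEquiv.symm_apply_apply _)) }
    (SlCat.functor_discrete_ext fun _ => rfl)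

theorem unitHom_fibInv {i : Discrete I} (y : T.poly.Fib (unitHom.f₁.obj i)) :
    (unitHom (T := T)).fibInv y = ⟨i, rfl⟩ := CatPoly.mkHom_fibInv _ _ y

theorem multHom_fibInv {z : CatPoly.Lab T.poly T.poly.base}
    (y : T.poly.Fib (T.multHom.f₁.obj z)) :
    T.multHom.fibInv y = (CatPoly.pr z).symm
      ⟨place (finSigmaFinEquiv.symm (idx y)).1, place (finSigmaFinEquiv.symm (idx y)).2⟩ :=
  CatPoly.mkHom_fibInv _ _ y

theorem fib_val_eq {α β : T.B} (h : α = β) {x : T.poly.Fib α} {y : T.poly.Fib β}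
    (hxy : (idx x).val = (idx y).val) : x.1 = y.1 := by
  subst h
  rw [idx_inj (Fin.ext hxy)]

theorem perm_eqToHom {α β : T.B} (h : α = β) (j : Fin α.op.n) :
    (perm (eqToHom h) j).val = j.val := by
  subst h
  rfl

theorem perm_comp {α β γ : T.B} (f : α ⟶ β) (g : β ⟶ γ) (j : Fin α.op.n) :
    perm (f ≫ g) j = perm g (perm f j) := rfl

theorem fibMap_val {P : CatPoly I} {f g : CatPoly.Hom P T.poly}
    (h : ∀ b, f.f₁.obj b = g.f₁.obj b)
    (h' : ∀ b (y : T.poly.Fib (f.f₁.obj b)) (y' : T.poly.Fib (g.f₁.obj b)),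
      (idx y).val = (idx y').val → f.fibInv y = g.fibInv y')
    {b : P.B} (x : P.Fib b) : (idx (f.fibMap x)).val = (idx (g.fibMap x)).val := by
  have hn : (f.f₁.obj b).op.n = (g.f₁.obj b).op.n := by rw [h]
  have e := h' b (f.fibMap x) (place (Fin.cast hn (idx (f.fibMap x)))) rfl
  rw [CatPoly.Hom.fibInv_fibMap] at e
  have e' := congrArg (fun x => (idx (g.fibMap x)).val) e
  refine Eq.trans ?_ e'.symm
  exact (congrArg (fun y => (idx y).val) (g.fibMap_fibInv
    (place (Fin.cast hn (idx (f.fibMap x)))))).symm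

theorem hom_ext {P : CatPoly I} {f g : CatPoly.Hom P T.poly}
    (h : ∀ b, f.f₁.obj b = g.f₁.obj b)
    (h' : ∀ b (y : T.poly.Fib (f.f₁.obj b)) (y' : T.poly.Fib (g.f₁.obj b)),
      (idx y).val = (idx y').val → f.fibInv y = g.fibInv y') :
    f = g := by
  refine CatPoly.Hom.ext' (CategoryTheory.Functor.ext h fun b b' β => perm_ext (Equiv.ext
    fun j => Fin.ext ?_)) fun e => fib_val_eq (h _)
      (fibMap_val h h' (⟨e, rfl⟩ : P.Fib (P.p.obj e)))
  obtain ⟨x, hx⟩ := (f.fibEquiv b).surjective (place j)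
  have hx : f.fibMap x = place j := hx
  obtain rfl : idx (f.fibMap x) = j := by rw [hx, idx_place]
  have r := P.R_tr β x
  rw [perm_comp, perm_comp, perm_eqToHom, R_idx.1 (f.R_fibMap r), fibMap_val h h' _,
    ← R_idx.1 (g.R_fibMap r)]
  refine congrArg (fun j => (perm (g.f₁.map β) j).val) (Fin.ext ?_)
  rw [perm_eqToHom]
  exact (fibMap_val h h' x).symm

theorem compOp_congr {α : T.Op} {h h' : Fin α.n → T.Op} (H : ∀ j, (h j).i = α.c j)
    (H' : ∀ j, (h' j).i = α.c j) (e : ∀ j, h j = h' j) : compOp α h H = compOp α h' H' := by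
  obtain rfl : h = h' := funext e
  rfl

theorem compOp_assoc (α : T.Op) (h : Fin α.n → T.Op) (H : ∀ j, (h j).i = α.c j)
    (k : ∀ j, Fin (h j).n → T.Op) (K : ∀ j l, (k j l).i = (h j).c l) :
    compOp (compOp α h H) (fun x => k (finSigmaFinEquiv.symm x).1 (finSigmaFinEquiv.symm x).2)
      (fun x => K _ _) = compOp α (fun j => compOp (h j) (k j) (K j)) H := by
  obtain ⟨n, c, i, a⟩ := α
  obtain ⟨m, d, t, b, rfl⟩ : ∃ (m : Fin n → ℕ) (d : ∀ j, Fin (m j) → I) (t : Fin n → I)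
      (b : ∀ j, T.Hom (m j) (d j) (t j)), h = fun j => ⟨m j, d j, t j, b j⟩ :=
    ⟨_, _, _, _, rfl⟩
  obtain rfl : t = c := funext H
  obtain ⟨p, f, t', g, rfl⟩ : ∃ (p : ∀ j, Fin (m j) → ℕ) (f : ∀ j l, Fin (p j l) → I)
      (t' : ∀ j, Fin (m j) → I) (g : ∀ j l, T.Hom (p j l) (f j l) (t' j l)),
      k = fun j l => ⟨p j l, f j l, t' j l, g j l⟩ := ⟨_, _, _, _, rfl⟩
  obtain rfl : t' = d := funext fun j => funext fun l => K j l
  exact (T.isOperad.assoc a m t' b p f g).symm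

theorem fin_lt_of {n : ℕ} {m : Fin n → ℕ} (x y : Σ j, Fin (m j)) (h : x.1.val < y.1.val ∨
    (x.1.val = y.1.val ∧ x.2.val < y.2.val)) : finSigmaFinEquiv x < finSigmaFinEquiv y := by
  obtain ⟨j, k⟩ := x
  obtain ⟨j', k'⟩ := y
  rw [Fin.lt_def, finSigmaFinEquiv_apply, finSigmaFinEquiv_apply]
  dsimp only at h ⊢
  rcases h with h | ⟨h, h'⟩
  · obtain ⟨j', hj'⟩ := j'
    obtain ⟨d, rfl⟩ : ∃ d, j' = j.val + 1 + d := ⟨j' - (j.val + 1), by simp at h; omega⟩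
    have h₁ : ∑ i : Fin j.val, m (Fin.castLE j.2.le i) + m j ≤
        ∑ i : Fin (j.val + 1 + d), m (Fin.castLE hj'.le i) := by
      rw [Fin.sum_univ_add, Fin.sum_univ_castSucc]
      exact Nat.le_add_right _ _
    exact lt_of_lt_of_le (Nat.add_lt_add_left k.2 _) (h₁.trans (Nat.le_add_right _ _))
  · obtain rfl : j = j' := Fin.ext h
    exact Nat.add_lt_add_left h' _

theorem fin_lt_iff {n : ℕ} {m : Fin n → ℕ} (x y : Σ j, Fin (m j)) :
    finSigmaFinEquiv x < finSigmaFinEquiv y ↔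
      x.1.val < y.1.val ∨ (x.1.val = y.1.val ∧ x.2.val < y.2.val) := by
  refine ⟨fun h => ?_, fin_lt_of x y⟩
  by_contra hn
  by_cases hl : y.1.val < x.1.val ∨ (y.1.val = x.1.val ∧ y.2.val < x.2.val)
  · exact lt_asymm h (fin_lt_of y x hl)
  · have h1 : x.1 = y.1 := Fin.ext (by omega)
    obtain ⟨j, k⟩ := x
    obtain ⟨j', k'⟩ := y
    obtain rfl : j = j' := h1
    dsimp only at h hn hl
    obtain rfl : k = k' := Fin.ext (by omega)
    exact lt_irrefl _ h

theorem fin_symm_lt_iff {n : ℕ} {m : Fin n → ℕ} (x y : Fin (∑ j, m j)) :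
    x < y ↔ (finSigmaFinEquiv.symm x).1.val < (finSigmaFinEquiv.symm y).1.val ∨
      ((finSigmaFinEquiv.symm x).1.val = (finSigmaFinEquiv.symm y).1.val ∧
        (finSigmaFinEquiv.symm x).2.val < (finSigmaFinEquiv.symm y).2.val) := by
  rw [← fin_lt_iff, Equiv.apply_symm_apply, Equiv.apply_symm_apply]

theorem fin_strictMono_val {a b : ℕ} (hab : a = b) {f : Fin a → Fin b} (hf : StrictMono f)
    (x : Fin a) : (f x).val = x.val := by
  subst hab
  have hb : Function.Surjective f := Finite.surjective_of_injective hf.injective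
  exact Fin.coe_orderIso_apply (hf.orderIsoOfSurjective f hb) x

theorem fin_sum_eq {n : ℕ} (m : Fin n → ℕ) (p : ∀ j, Fin (m j) → ℕ) :
    ∑ x : Fin (∑ j, m j), p (finSigmaFinEquiv.symm x).1 (finSigmaFinEquiv.symm x).2 =
      ∑ j, ∑ k, p j k := by
  refine Eq.trans ?_ (Finset.sum_sigma Finset.univ (fun j => Finset.univ (α := Fin (m j)))
    fun s : Σ j, Fin (m j) => p s.1 s.2)
  exact finSigmaFinEquiv.symm.sum_comp fun s : Σ j, Fin (m j) => p s.1 s.2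

theorem fin_assoc_aux {n : ℕ} {m : Fin n → ℕ} {p : ∀ j, Fin (m j) → ℕ} (v w : Σ j, Fin (m j))
    (k : Fin (p v.1 v.2)) (l : Fin (p w.1 w.2))
    (h : (v.1.val < w.1.val ∨ (v.1.val = w.1.val ∧ v.2.val < w.2.val)) ∨
      (v = w ∧ k.val < l.val)) :
    v.1.val < w.1.val ∨ (v.1.val = w.1.val ∧
      (finSigmaFinEquiv (⟨v.2, k⟩ : Σ x, Fin (p v.1 x))).val <
        (finSigmaFinEquiv (⟨w.2, l⟩ : Σ x, Fin (p w.1 x))).val) := by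
  rcases h with (h | ⟨h1, h2⟩) | ⟨h1, h2⟩
  · exact Or.inl h
  · obtain ⟨v, v'⟩ := v
    obtain ⟨w, w'⟩ := w
    obtain rfl : v = w := Fin.ext h1
    exact Or.inr ⟨rfl, Fin.lt_def.1 (fin_lt_of _ _ (Or.inl h2))⟩
  · subst h1
    exact Or.inr ⟨rfl, Fin.lt_def.1 (fin_lt_of _ _ (Or.inr ⟨rfl, h2⟩))⟩

theorem fin_assoc {n : ℕ} {m : Fin n → ℕ} {p : ∀ j, Fin (m j) → ℕ} {q : Fin (∑ j, m j) → ℕ}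
    (hq : ∀ x, q x = p (finSigmaFinEquiv.symm x).1 (finSigmaFinEquiv.symm x).2)
    {s : Σ x, Fin (q x)} {s' : Σ j, Fin (∑ k, p j k)}
    (h : (finSigmaFinEquiv s).val = (finSigmaFinEquiv s').val) :
    (finSigmaFinEquiv.symm s.1).1.val = s'.1.val ∧
      (finSigmaFinEquiv.symm s.1).2.val = (finSigmaFinEquiv.symm s'.2).1.val ∧
        s.2.val = (finSigmaFinEquiv.symm s'.2).2.val := by
  obtain rfl : q = _ := funext hq
  let g : (Σ x : Fin (∑ j, m j), Fin (p (finSigmaFinEquiv.symm x).1 (finSigmaFinEquiv.symm x).2)) →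
      Σ j, Fin (∑ k, p j k) := fun s =>
    ⟨(finSigmaFinEquiv.symm s.1).1, finSigmaFinEquiv ⟨(finSigmaFinEquiv.symm s.1).2, s.2⟩⟩
  have hg : StrictMono fun x => finSigmaFinEquiv (g (finSigmaFinEquiv.symm x)) := by
    intro x y hxy
    obtain ⟨s, rfl⟩ := finSigmaFinEquiv.surjective x
    obtain ⟨t, rfl⟩ := finSigmaFinEquiv.surjective y
    dsimp only
    rw [Equiv.symm_apply_apply, Equiv.symm_apply_apply]
    rw [fin_lt_iff, ← Fin.lt_def, fin_symm_lt_iff] at hxy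
    rw [fin_lt_iff]
    dsimp only [g]
    obtain ⟨x, k⟩ := s
    obtain ⟨y, l⟩ := t
    dsimp only at hxy ⊢
    replace hxy := hxy.imp_right (And.imp_left fun h =>
      congrArg (finSigmaFinEquiv (n := m)).symm (Fin.ext h))
    exact fin_assoc_aux _ _ k l hxy
  have e : (finSigmaFinEquiv (g (finSigmaFinEquiv.symm (finSigmaFinEquiv s)))).val = _ :=
    fin_strictMono_val (fin_sum_eq m fun j k => p j k) hg (finSigmaFinEquiv s)
  rw [Equiv.symm_apply_apply, h] at e
  have e' : g s = s' := finSigmaFinEquiv.injective (Fin.ext e)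
  subst e'
  have e'' := Equiv.symm_apply_apply (finSigmaFinEquiv (n := p (finSigmaFinEquiv.symm s.1).1))
    ⟨(finSigmaFinEquiv.symm s.1).2, s.2⟩
  exact ⟨rfl, congrArg (fun v => v.1.val) e''.symm, congrArg (fun v => v.2.val) e''.symm⟩

theorem fin_one_sum {n : ℕ} (x : Fin (∑ _ : Fin 1, n)) :
    (finSigmaFinEquiv.symm x).2.val = x.val := by
  have h := congrArg Fin.val (finSigmaFinEquiv.apply_symm_apply x)
  rw [finSigmaFinEquiv_apply] at h
  have h0 : (finSigmaFinEquiv.symm x).1 = 0 := Subsingleton.elim _ _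
  rw [← h, h0]
  simp

theorem fin_sum_one {n : ℕ} (x : Fin (∑ _ : Fin n, 1)) :
    (finSigmaFinEquiv.symm x).1.val = x.val := by
  have h := congrArg Fin.val (finSigmaFinEquiv.apply_symm_apply x)
  rw [finSigmaFinEquiv_apply] at h
  have h0 : (finSigmaFinEquiv.symm x).2 = 0 := Subsingleton.elim _ _
  rw [← h, h0]
  simp

theorem left_unit_fibInv {α : T.B}
    (y : T.poly.Fib ((T.poly.lu.comp ((CatPoly.hcomp unitHom (CatPoly.Hom.id T.poly)).comp
      T.multHom)).f₁.obj α)) (y' : T.poly.Fib α) (h : (idx y).val = (idx y').val) :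
    (T.poly.lu.comp ((CatPoly.hcomp unitHom (CatPoly.Hom.id T.poly)).comp
      T.multHom)).fibInv y = y' := by
  have h₁ := CatPoly.Hom.fibInv_comp T.poly.lu
    ((CatPoly.hcomp unitHom (CatPoly.Hom.id T.poly)).comp T.multHom) y
  have h₂ := CatPoly.Hom.fibInv_comp (CatPoly.hcomp unitHom (CatPoly.Hom.id T.poly))
    T.multHom (b := T.poly.lu.f₁.obj α) y
  have h₃ := multHom_fibInv (z := (CatPoly.hcomp unitHom (CatPoly.Hom.id T.poly)).f₁.obj
    (T.poly.lu.f₁.obj α)) y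
  have h₄ := CatPoly.hcomp_fibInv unitHom (CatPoly.Hom.id T.poly) (z := T.poly.lu.f₁.obj α)
    (T.multHom.fibInv y)
  refine h₁.trans ((congrArg T.poly.lu.fibInv (h₂.trans h₄)).trans ?_)
  refine (CatPoly.lu_fibInv _ _).trans ?_
  refine (CatPoly.fibInv_id T.poly _).trans ?_
  refine idx_inj (Fin.ext ?_)
  refine Eq.trans ?_ h
  refine Eq.trans ?_ (fin_one_sum (n := α.op.n) (idx (α := multObj ((CatPoly.hcomp unitHom
    (CatPoly.Hom.id T.poly)).f₁.obj (T.poly.lu.f₁.obj α))) y))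
  exact congrArg (fun v => (idx (CatPoly.pr _ v).2).val) h₃

theorem right_unit_fibInv {α : T.B}
    (y : T.poly.Fib ((T.poly.ru.comp ((CatPoly.hcomp (CatPoly.Hom.id T.poly) unitHom).comp
      T.multHom)).f₁.obj α)) (y' : T.poly.Fib α) (h : (idx y).val = (idx y').val) :
    (T.poly.ru.comp ((CatPoly.hcomp (CatPoly.Hom.id T.poly) unitHom).comp
      T.multHom)).fibInv y = y' := by
  have h₁ := CatPoly.Hom.fibInv_comp T.poly.ru
    ((CatPoly.hcomp (CatPoly.Hom.id T.poly) unitHom).comp T.multHom) y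
  have h₂ := CatPoly.Hom.fibInv_comp (CatPoly.hcomp (CatPoly.Hom.id T.poly) unitHom)
    T.multHom (b := T.poly.ru.f₁.obj α) y
  have h₃ := multHom_fibInv (z := (CatPoly.hcomp (CatPoly.Hom.id T.poly) unitHom).f₁.obj
    (T.poly.ru.f₁.obj α)) y
  have h₄ := CatPoly.hcomp_fibInv (CatPoly.Hom.id T.poly) unitHom (z := T.poly.ru.f₁.obj α)
    (T.multHom.fibInv y)
  refine h₁.trans ((congrArg T.poly.ru.fibInv (h₂.trans h₄)).trans ?_)
  refine (CatPoly.ru_fibInv _ _).trans ?_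
  refine (CatPoly.fibInv_id T.poly _).trans ?_
  refine idx_inj (Fin.ext ?_)
  refine Eq.trans ?_ h
  refine Eq.trans ?_ (fin_sum_one (n := α.op.n) (idx (α := multObj ((CatPoly.hcomp
    (CatPoly.Hom.id T.poly) unitHom).f₁.obj (T.poly.ru.f₁.obj α))) y))
  exact congrArg (fun v => (idx (CatPoly.pr _ v).1).val) h₃

theorem right_unit_obj (α : T.B) :
    (T.poly.ru.comp ((CatPoly.hcomp (CatPoly.Hom.id T.poly) unitHom).comp
      T.multHom)).f₁.obj α = α := by
  refine congrArg B.mk (Eq.trans ?_ (T.isOperad.comp_one α.op.a))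
  exact compOp_congr (h' := fun j => toOp (T.one (α.op.c j))) _ (fun j => rfl) fun j =>
    congrArg (fun i => toOp (T.one i)) ((congrArg T.poly.sc (CatPoly.fibInv_id T.poly (place j))).trans
      (sc_idx _))

theorem assoc_label (z : CatPoly.Lab T.poly (T.poly.comp T.poly).base)
    (x : Fin (T.multHom.f₁.obj (CatPoly.compObj z).b).op.n) :
    (CatPoly.compObj z).h (T.multHom.fibInv (b := (CatPoly.compObj z).b) (place x)) =
      (z.h (place (finSigmaFinEquiv.symm x).1)).h (place (finSigmaFinEquiv.symm x).2) :=
  CatPoly.compObj_h z (multHom_fibInv (z := (CatPoly.compObj z).b) (place x))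

/-- The arrows that label the places of a threefold composite. -/
def lab₃ (z : CatPoly.Lab T.poly (T.poly.comp T.poly).base) (j : Fin z.b.op.n)
    (l : Fin (z.h (place j)).b.op.n) : T.Op := ((z.h (place j)).h (place l)).op

theorem lab₃_i (z : CatPoly.Lab T.poly (T.poly.comp T.poly).base) (j : Fin z.b.op.n)
    (l : Fin (z.h (place j)).b.op.n) : (lab₃ z j l).i = (z.h (place j)).b.op.c l :=
  ((z.h (place j)).w _).trans (sc_idx _)

theorem mid_i (z : CatPoly.Lab T.poly (T.poly.comp T.poly).base) (j : Fin z.b.op.n) :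
    (z.h (place j)).b.op.i = z.b.op.c j := (z.w _).trans (sc_idx _)

theorem assoc_obj_left (z : CatPoly.Lab T.poly (T.poly.comp T.poly).base) :
    (((CatPoly.assoc T.poly T.poly T.poly).comp
      ((CatPoly.hcomp T.multHom (CatPoly.Hom.id T.poly)).comp T.multHom)).f₁.obj z).op =
    compOp (compOp z.b.op (fun j => (z.h (place j)).b.op) (mid_i z))
      (fun x => lab₃ z (finSigmaFinEquiv.symm x).1 (finSigmaFinEquiv.symm x).2)
      (fun x => lab₃_i z _ _) :=
  compOp_congr (α := compOp z.b.op (fun j => (z.h (place j)).b.op) (mid_i z)) _ _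
    fun x => congrArg B.op (assoc_label z x)

theorem assoc_obj_right (z : CatPoly.Lab T.poly (T.poly.comp T.poly).base) :
    compOp z.b.op (fun j => compOp (z.h (place j)).b.op (lab₃ z j) (lab₃_i z j)) (mid_i z) =
    (((CatPoly.hcomp (CatPoly.Hom.id T.poly) T.multHom).comp T.multHom).f₁.obj z).op :=
  compOp_congr (α := z.b.op) _ _ fun j =>
    congrArg (fun x => (multObj (z.h x)).op) (CatPoly.fibInv_id T.poly (place j)).symm

theorem assoc_obj (z : CatPoly.Lab T.poly (T.poly.comp T.poly).base) :
    ((CatPoly.assoc T.poly T.poly T.poly).comp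
      ((CatPoly.hcomp T.multHom (CatPoly.Hom.id T.poly)).comp T.multHom)).f₁.obj z =
    ((CatPoly.hcomp (CatPoly.Hom.id T.poly) T.multHom).comp T.multHom).f₁.obj z :=
  congrArg B.mk ((assoc_obj_left z).trans ((compOp_assoc z.b.op (fun j => (z.h (place j)).b.op)
    (mid_i z) (lab₃ z) (lab₃_i z)).trans (assoc_obj_right z)))

/-- The element of a fibre of a threefold composite given by places. -/
noncomputable def place₃ (z : CatPoly.Lab T.poly (T.poly.comp T.poly).base) (j : Fin z.b.op.n)
    (l : Fin (z.h (place j)).b.op.n) (k : Fin (lab₃ z j l).n) :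
    (T.poly.comp (T.poly.comp T.poly)).Fib z :=
  (CatPoly.pr z).symm ⟨place j, (CatPoly.pr (z.h (place j))).symm
    ⟨place l, place (α := (z.h (place j)).h (place l)) k⟩⟩

theorem place₃_ext {z : CatPoly.Lab T.poly (T.poly.comp T.poly).base} {j j' : Fin z.b.op.n}
    {l : Fin (z.h (place j)).b.op.n} {l' : Fin (z.h (place j')).b.op.n} {k : Fin (lab₃ z j l).n}
    {k' : Fin (lab₃ z j' l').n} (h₁ : j.val = j'.val) (h₂ : l.val = l'.val)
    (h₃ : k.val = k'.val) : place₃ z j l k = place₃ z j' l' k' := by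
  obtain rfl : j = j' := Fin.ext h₁
  obtain rfl : l = l' := Fin.ext h₂
  obtain rfl : k = k' := Fin.ext h₃
  rfl

theorem right_aux (z : CatPoly.Lab T.poly (T.poly.comp T.poly).base)
    (F : T.poly.Fib z.b → T.poly.Fib z.b) (hF : F = id)
    (y : Fin (∑ j : Fin z.b.op.n, (multObj (z.h (F (place j)))).op.n)) :
    ∃ s : Σ j : Fin z.b.op.n, Fin (∑ k, (lab₃ z j k).n), (finSigmaFinEquiv s).val = y.val ∧
      (CatPoly.pr z).symm ⟨F (place (finSigmaFinEquiv.symm y).1),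
        T.multHom.fibInv (b := z.h (F (place (finSigmaFinEquiv.symm y).1)))
          (place (α := multObj (z.h (F (place (finSigmaFinEquiv.symm y).1))))
            (finSigmaFinEquiv.symm y).2)⟩ =
      place₃ z s.1 (finSigmaFinEquiv.symm s.2).1 (finSigmaFinEquiv.symm s.2).2 := by
  subst hF
  refine ⟨finSigmaFinEquiv.symm y, congrArg Fin.val (finSigmaFinEquiv.apply_symm_apply y), ?_⟩
  refine congrArg (fun v => (CatPoly.pr z).symm ⟨place (finSigmaFinEquiv.symm y).1, v⟩) ?_
  exact multHom_fibInv (z := z.h (place (finSigmaFinEquiv.symm y).1)) _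

theorem right_fibInv (z : CatPoly.Lab T.poly (T.poly.comp T.poly).base)
    (y : T.poly.Fib (((CatPoly.hcomp (CatPoly.Hom.id T.poly) T.multHom).comp T.multHom).f₁.obj z)) :
    ∃ s : Σ j : Fin z.b.op.n, Fin (∑ k, (lab₃ z j k).n),
      (finSigmaFinEquiv s).val = (idx y).val ∧
      ((CatPoly.hcomp (CatPoly.Hom.id T.poly) T.multHom).comp T.multHom).fibInv y =
      place₃ z s.1 (finSigmaFinEquiv.symm s.2).1 (finSigmaFinEquiv.symm s.2).2 := by
  obtain ⟨s, hs, hs'⟩ := right_aux z (CatPoly.Hom.id T.poly).fibInv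
    (funext fun x => CatPoly.fibInv_id T.poly x) (idx y)
  refine ⟨s, hs, Eq.trans ?_ hs'⟩
  have h₁ := CatPoly.Hom.fibInv_comp (CatPoly.hcomp (CatPoly.Hom.id T.poly) T.multHom)
    T.multHom y
  have h₂ := multHom_fibInv (z := (CatPoly.hcomp (CatPoly.Hom.id T.poly) T.multHom).f₁.obj z) y
  refine h₁.trans ((congrArg (CatPoly.Hom.fibInv _) h₂).trans ?_)
  exact CatPoly.hcomp_fibInv (CatPoly.Hom.id T.poly) T.multHom (z := z) _

theorem left_aux (z : CatPoly.Lab T.poly (T.poly.comp T.poly).base)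
    (F : Fin (T.multHom.f₁.obj (CatPoly.compObj z).b).op.n →
      (T.poly.comp T.poly).Fib (CatPoly.compObj z).b)
    (hF : F = fun x => (CatPoly.pr (CatPoly.compObj z).b).symm
      ⟨place (finSigmaFinEquiv.symm x).1, place (finSigmaFinEquiv.symm x).2⟩)
    (y : Fin (∑ x, ((CatPoly.compObj z).h (F x)).op.n)) :
    ∃ s : Σ x : Fin (∑ j : Fin z.b.op.n, (z.h (place j)).b.op.n),
        Fin (lab₃ z (finSigmaFinEquiv.symm x).1 (finSigmaFinEquiv.symm x).2).n,
      (finSigmaFinEquiv s).val = y.val ∧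
      (CatPoly.assoc T.poly T.poly T.poly).fibInv (b := z) ((CatPoly.pr (CatPoly.compObj z)).symm
        ⟨F (finSigmaFinEquiv.symm y).1,
          (CatPoly.Hom.id T.poly).fibInv (b := (CatPoly.compObj z).h (F (finSigmaFinEquiv.symm y).1))
            (place (α := (CatPoly.compObj z).h (F (finSigmaFinEquiv.symm y).1))
              (finSigmaFinEquiv.symm y).2)⟩) =
      place₃ z (finSigmaFinEquiv.symm s.1).1 (finSigmaFinEquiv.symm s.1).2 s.2 := by
  subst hF
  refine ⟨finSigmaFinEquiv.symm y, congrArg Fin.val (finSigmaFinEquiv.apply_symm_apply y), ?_⟩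
  refine (CatPoly.assoc_fibInv T.poly T.poly T.poly (z := z) _).trans ?_
  refine congrArg (fun v => (CatPoly.pr z).symm ⟨place _, (CatPoly.pr (z.h (place _))).symm
    ⟨place _, v⟩⟩) ?_
  exact CatPoly.fibInv_id T.poly _

theorem left_fibInv (z : CatPoly.Lab T.poly (T.poly.comp T.poly).base)
    (y : T.poly.Fib (((CatPoly.assoc T.poly T.poly T.poly).comp
      ((CatPoly.hcomp T.multHom (CatPoly.Hom.id T.poly)).comp T.multHom)).f₁.obj z)) :
    ∃ s : Σ x : Fin (∑ j : Fin z.b.op.n, (z.h (place j)).b.op.n),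
        Fin (lab₃ z (finSigmaFinEquiv.symm x).1 (finSigmaFinEquiv.symm x).2).n,
      (finSigmaFinEquiv s).val = (idx y).val ∧
      ((CatPoly.assoc T.poly T.poly T.poly).comp
        ((CatPoly.hcomp T.multHom (CatPoly.Hom.id T.poly)).comp T.multHom)).fibInv y =
      place₃ z (finSigmaFinEquiv.symm s.1).1 (finSigmaFinEquiv.symm s.1).2 s.2 := by
  obtain ⟨s, hs, hs'⟩ := left_aux z
    (fun x => T.multHom.fibInv (b := (CatPoly.compObj z).b) (place x))
    (funext fun x => multHom_fibInv (z := (CatPoly.compObj z).b) (place x)) (idx y)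
  refine ⟨s, hs, Eq.trans ?_ hs'⟩
  have h₁ := CatPoly.Hom.fibInv_comp (CatPoly.assoc T.poly T.poly T.poly)
    ((CatPoly.hcomp T.multHom (CatPoly.Hom.id T.poly)).comp T.multHom) y
  have h₂ := CatPoly.Hom.fibInv_comp (CatPoly.hcomp T.multHom (CatPoly.Hom.id T.poly))
    T.multHom (b := CatPoly.compObj z) y
  have h₃ := multHom_fibInv (z := (CatPoly.hcomp T.multHom (CatPoly.Hom.id T.poly)).f₁.obj
    (CatPoly.compObj z)) y
  have h₄ := CatPoly.hcomp_fibInv T.multHom (CatPoly.Hom.id T.poly) (z := CatPoly.compObj z)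
    (T.multHom.fibInv y)
  refine h₁.trans (congrArg (CatPoly.Hom.fibInv _) (h₂.trans ?_))
  refine (congrArg (CatPoly.Hom.fibInv _) h₃).trans ?_
  exact CatPoly.hcomp_fibInv T.multHom (CatPoly.Hom.id T.poly) (z := CatPoly.compObj z) _

/-- The monad structure on the polynomial of an operad. -/
noncomputable def mon (T : Operad I) : CatPoly.Mon T.poly where
  u := unitHom
  m := multHom T
  left_unit := hom_ext
    (fun α => congrArg B.mk (T.isOperad.one_comp α.op.a)) fun α y y' h =>
      (left_unit_fibInv y y' h).trans (CatPoly.fibInv_id T.poly y').symm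
  right_unit := hom_ext right_unit_obj fun α y y' h =>
      (right_unit_fibInv y y' h).trans (CatPoly.fibInv_id T.poly y').symm
  assoc := hom_ext assoc_obj fun z y y' h => by
    obtain ⟨s, hs, e⟩ := left_fibInv z y
    obtain ⟨s', hs', e'⟩ := right_fibInv z y'
    obtain ⟨h₁, h₂, h₃⟩ := fin_assoc (p := fun j k => (lab₃ z j k).n) (fun _ => rfl)
      (hs.trans (h.trans hs'.symm))
    exact e.trans ((place₃_ext h₁ h₂ h₃).trans e'.symm)

/-- `q : T ⟶ Q` exhibits the 2-monad `Q` as `T/Σ`: it is the coidentifier of the 2-cell of 2-monads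
`α_T`, which is the image of the 2-cell from the polynomial of arrows of the polynomial of `T`, both
in the 2-category of 2-monads on `Cat/I` and in that of endo-2-functors of `Cat/I`. -/
structure IsModSigma (T : Operad I) (Q : TwoCat.TwoMonad (SlCat I))
    (q : TwoCat.TwoNat T.mon.pfun.T Q.T) : Prop where
  mnd : TwoCat.IsCoidentifierMnd (G := T.mon.pfun) T.poly.arrCell.pfun q
  endo : TwoCat.IsCoidentifierEnd T.poly.arrCell.pfun q

end Operad

/-! The theorem rests on one consequence of Σ-freeness: two arrows `α ⟶ β` of `B_T` differ by a
permutation that fixes `β`, and with it the source sequence of `β`, so they are equal. Since arrows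
of `B_T` can be reversed, `B_T` is equivalent to the discrete category of its components. This is
`SigmaFree.rigid`; everything else holds for any polynomial with this property, called `Rigid`.

Pullback. Because `p` is a discrete fibration and opfibration, an arrow of `B` transports one fibre
bijectively to another, and in the rigid case this transport depends only on the two endpoints.
Hence two objects of `E` are connected exactly when transport takes one to the other
(`Rigid.R_iff`), and the fibre of `p` over `b` maps bijectively to the fibre of `π₀p` over the
component of `b` (`Rigid.fibAux_bijective`). Bijectivity on fibres is what the pullback property
amounts to.

Coidentifier. Write `q` for the quotient morphism and `P` for the given polynomial. For each `X` the
functor `q_X : P X ⥤ (π₀P) X` is surjective on objects, full and faithful (`surjFull_lab`,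
`faithful_lab`). The arrows that it turns into identities are those all of whose labels are
identities, and these are precisely the components of the 2-cell of arrows (`isId_quot`,
`exists_eqToHom_γ`, `exists_arrCell`). So a functor on `P X` that makes this 2-cell an identity
factors through `q_X`, uniquely. Natural transformations descend as well, since `q_X` is full and
surjective on objects, and naturality in `X` descends because `q_X` can be cancelled.

Monad structure. The horizontal composite of `q` with itself is again full and surjective on
objects, so the multiplication of `P` followed by `q` descends to a unique multiplication on `π₀P`
(`Hom.exists_desc`, `Hom.epi_ext`). The monad laws are equations between morphisms into a polynomial
of connected components. Such morphisms are determined by their images under `PFun` (`Hom.ext_app`),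
and there the laws follow from those of `P` after cancelling copies of `q`. The same cancellation
shows that what descends from a morphism or a 2-cell of 2-monads is again one, which carries the
universal property from endo-2-functors to 2-monads (`IsCoidentifierEnd.isCoidentifierMnd`). -/

/-! ### Functors that are full and surjective on objects -/

/-- A functor that is full and surjective on objects. -/
structure SurjFull {C D : Type u} [SmallCategory C] [SmallCategory D] (F : C ⥤ D) : Prop where
  surj : Function.Surjective F.obj
  full : F.Full

namespace SurjFull

variable {C D E : Type u} [SmallCategory C] [SmallCategory D] [SmallCategory E] {F : C ⥤ D}

theorem exists_map (hF : SurjFull F) {x y : C} (f : F.obj x ⟶ F.obj y) : ∃ g, F.map g = f :=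
  haveI := hF.full
  F.map_surjective f

theorem comp (hF : SurjFull F) {G : D ⥤ E} (hG : SurjFull G) : SurjFull (F ⋙ G) where
  surj := hG.surj.comp hF.surj
  full := haveI := hF.full; haveI := hG.full; inferInstance

/-- Lifting first the endpoints and then the arrow between them reaches every arrow of `D`. This is
the cancellation property on which all later descent arguments rely. -/
theorem hom_ext (hF : SurjFull F) {G H : D ⥤ E} (h : F ⋙ G = F ⋙ H) : G = H := by
  refine Functor.hext (fun d => ?_) fun d d' f => ?_
  · obtain ⟨c, rfl⟩ := hF.surj d
    exact Functor.congr_obj h c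
  · obtain ⟨c, rfl⟩ := hF.surj d
    obtain ⟨c', rfl⟩ := hF.surj d'
    obtain ⟨g, rfl⟩ := hF.exists_map f
    exact Functor.hcongr_hom h g

/-- Natural transformations descend along a functor that is full and surjective on objects. -/
theorem exists_natTrans (hF : SurjFull F) {G H : D ⥤ E} (θ : F ⋙ G ⟶ F ⋙ H) :
    ∃ ξ : G ⟶ H, Functor.whiskerLeft F ξ = θ := by
  -- By fullness the identity between the equal images lifts to an arrow `c ⟶ c'`. Both `F ⋙ G` and
  -- `F ⋙ H` send this lift to an identity, so naturality of `θ` identifies its components at `c`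
  -- and `c'`.
  have key : ∀ {c c' : C} (h : F.obj c = F.obj c'),
      θ.app c' = eqToHom (by simp [h]) ≫ θ.app c ≫ eqToHom (by simp [h]) := by
    intro c c' h
    obtain ⟨g, hg⟩ := hF.exists_map (eqToHom h)
    have := θ.naturality g
    simp only [Functor.comp_map, hg, eqToHom_map] at this
    rw [← this]
    simp
  -- The components are defined through an arbitrary section `s` on objects; `key` shows that the
  -- choice does not matter.
  choose s hs using hF.surj
  have hθ : ∀ c, eqToHom (by simp [hs]) ≫ θ.app (s (F.obj c)) ≫ eqToHom (by simp [hs]) =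
      θ.app c := fun c => (key (hs _)).symm
  refine ⟨{ app := fun d => eqToHom (by simp [hs]) ≫ θ.app (s d) ≫ eqToHom (by simp [hs])
            naturality := fun d d' f => ?_ }, ?_⟩
  · obtain ⟨c, rfl⟩ := hF.surj d
    obtain ⟨c', rfl⟩ := hF.surj d'
    obtain ⟨g, rfl⟩ := hF.exists_map f
    rw [hθ, hθ]
    exact θ.naturality g
  · ext c
    exact hθ c

theorem natTrans_ext (hF : SurjFull F) {G H : D ⥤ E} {ξ ξ' : G ⟶ H}
    (h : ∀ c, ξ.app (F.obj c) = ξ'.app (F.obj c)) : ξ = ξ' := by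
  ext d
  obtain ⟨c, rfl⟩ := hF.surj d
  exact h c

/-- Functors to discrete categories descend along functors that are full and surjective on
objects. -/
theorem exists_discrete {A : Type u} (hF : SurjFull F) (G : C ⥤ Discrete A) :
    ∃ K : D ⥤ Discrete A, F ⋙ K = G := by
  choose s hs using hF.surj
  -- An arrow between images lifts to `C`, and its image in a discrete category forces the endpoints
  -- to coincide.
  have key : ∀ {c c' : C}, (F.obj c ⟶ F.obj c') → G.obj c = G.obj c' := by
    intro c c' f
    obtain ⟨g, -⟩ := hF.exists_map f
    exact Discrete.ext (Discrete.eq_of_hom (G.map g))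
  have key' : ∀ {d d' : D}, (d ⟶ d') → G.obj (s d) = G.obj (s d') := fun f =>
    key (eqToHom (hs _) ≫ f ≫ eqToHom (hs _).symm)
  refine ⟨{ obj := fun d => G.obj (s d)
            map := fun f => eqToHom (key' f)
            map_id := fun _ => Subsingleton.elim _ _
            map_comp := fun _ _ => Subsingleton.elim _ _ }, ?_⟩
  exact SlCat.functor_discrete_ext fun c => congrArg Discrete.as (key (eqToHom (hs _)))

/-- A functor descends along a functor that is fully faithful and surjective on objects as soon as
it sends the arrows that become identities to identities. -/
theorem exists_desc (hF : SurjFull F) (hf : F.Faithful) (H : C ⥤ E)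
    (hH : ∀ {c c' : C} (φ : c ⟶ c') (e : F.obj c = F.obj c'), F.map φ = eqToHom e →
      ∃ e', H.map φ = eqToHom e') : ∃ K : D ⥤ E, F ⋙ K = H := by
  choose s hs using hF.surj
  -- Lifts of arrows between the chosen preimages. Faithfulness makes them compatible with
  -- identities and composition, so applying `H` to them gives a functor.
  choose m hm using fun (d d' : D) (f : d ⟶ d') =>
    hF.exists_map (eqToHom (hs d) ≫ f ≫ eqToHom (hs d').symm)
  refine ⟨{ obj := fun d => H.obj (s d)
            map := fun f => H.map (m _ _ f)
            map_id := fun d => ?_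
            map_comp := fun f g => ?_ }, ?_⟩
  · rw [← H.map_id]
    exact congrArg H.map (F.map_injective (by simp [hm]))
  · rw [← H.map_comp]
    exact congrArg H.map (F.map_injective (by simp [hm]))
  · choose v hv using fun c => hF.exists_map (eqToHom (hs (F.obj c)))
    choose e he using fun c => hH (v c) (hs _) (hv c)
    refine CategoryTheory.Functor.ext e fun c c' φ => ?_
    obtain ⟨w, hw⟩ := hF.exists_map (eqToHom (hs (F.obj c')).symm)
    obtain ⟨e', he'⟩ := hH w (hs _).symm hw
    change H.map (m _ _ (F.map φ)) = _
    rw [show m _ _ (F.map φ) = v c ≫ φ ≫ w from F.map_injective (by simp [hm, hv, hw]),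
      H.map_comp, H.map_comp, he, he']

end SurjFull

/-! ### Rigid polynomials and their connected components -/

namespace CatPoly

variable {I : Type u}

theorem conn_eq {C : Type u} [SmallCategory C] {x y : C} (f : x ⟶ y) :
    (conn C).obj x = (conn C).obj y := Discrete.ext (Discrete.eq_of_hom ((conn C).map f))

theorem zigzag_of_conn_eq {C : Type u} [SmallCategory C] {x y : C}
    (h : (conn C).obj x = (conn C).obj y) : Zigzag x y :=
  Quotient.exact (congrArg Discrete.as h)

theorem conn_surjective {C : Type u} [SmallCategory C] (x : Conn C) :
    ∃ y, (conn C).obj y = x := by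
  obtain ⟨x⟩ := x
  obtain ⟨y, rfl⟩ := Quotient.exists_rep x
  exact ⟨y, rfl⟩

/-- The category `B` of a polynomial is a groupoid equivalent to a discrete category. -/
structure Rigid (P : CatPoly I) : Prop where
  inv : ∀ {b b' : P.B}, (b ⟶ b') → Nonempty (b' ⟶ b)
  thin : ∀ {b b' : P.B} (f g : b ⟶ b'), f = g

namespace Rigid

variable {P : CatPoly I} (hP : P.Rigid)

include hP

/-- A zigzag straightens to a single arrow because its backward steps can be reversed. -/
theorem nonempty_hom {b b' : P.B} (h : (conn P.B).obj b = (conn P.B).obj b') :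
    Nonempty (b ⟶ b') := by
  have hz := zigzag_of_conn_eq h
  clear h
  induction hz with
  | refl => exact ⟨𝟙 _⟩
  | tail _ h ih =>
    rcases h with ⟨⟨f⟩⟩ | ⟨⟨f⟩⟩
    · exact ⟨ih.some ≫ f⟩
    · exact ⟨ih.some ≫ (hP.inv f).some⟩

/-- Transport is followed along a zigzag in `E`. A forward step composes with its image in `B`. For
a backward step `κ`, an arrow `g` opposite to the image of `κ` is used: the loop they form is an
identity by thinness, so transport along `g` leads back to the source of `κ`. -/
theorem exists_R {e e' : P.E} (h : (conn P.E).obj e = (conn P.E).obj e') :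
    ∃ β, P.R β ⟨e, rfl⟩ ⟨e', rfl⟩ := by
  have hz := zigzag_of_conn_eq h
  clear h
  induction hz with
  | refl => exact ⟨𝟙 _, P.R_id _⟩
  | tail _ h ih =>
    obtain ⟨β, hβ⟩ := ih
    rcases h with ⟨⟨κ⟩⟩ | ⟨⟨κ⟩⟩
    · exact ⟨_, hβ.comp (P.R_map κ)⟩
    · obtain ⟨g⟩ := hP.inv (P.p.map κ)
      refine ⟨_, hβ.comp (β' := g) ?_⟩
      obtain ⟨y, hy⟩ := exists_right g ⟨_, rfl⟩
      have := (P.R_map κ).comp hy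
      rw [hP.thin (_ ≫ g) (𝟙 _), R_id_iff] at this
      rwa [this]

/-- By thinness the arrow supplied by `exists_R` may be replaced by `β`, so the transport relation
does not depend on the arrow along which one transports. -/
theorem R_iff {b b' : P.B} (β : b ⟶ b') (x : P.Fib b) (y : P.Fib b') :
    P.R β x y ↔ (conn P.E).obj x.1 = (conn P.E).obj y.1 := by
  refine ⟨fun h => conn_eq h.choose, fun h => ?_⟩
  obtain ⟨x, rfl⟩ := x
  obtain ⟨y, rfl⟩ := y
  obtain ⟨β', h⟩ := hP.exists_R h
  rwa [hP.thin β β']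

omit hP in
theorem conn_wp (P : CatPoly I) : conn P.E ⋙ P.pi0.p = P.p ⋙ conn P.B :=
  SlCat.functor_discrete_ext fun _ => rfl

/-- Connected elements of one fibre are related over an identity, hence equal. Conversely, an object
of `E` lying over the component of `b` can be transported into the fibre over `b` without leaving
its own component. -/
theorem fibAux_bijective (b : P.B) :
    Function.Bijective (fibAux (P := P) (Q := P.pi0) (conn P.B) (conn P.E) (conn_wp P) b) := by
  constructor
  · intro x y h
    exact R_id_iff.1 ((hP.R_iff (𝟙 b) x y).2 (congrArg Subtype.val h))
  · rintro ⟨e, he⟩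
    obtain ⟨e, rfl⟩ := conn_surjective e
    obtain ⟨β⟩ := hP.nonempty_hom (b := P.p.obj e) (b' := b) he
    obtain ⟨y, r⟩ := exists_right β ⟨e, rfl⟩
    exact ⟨y, Subtype.ext ((hP.R_iff _ _ _).1 r).symm⟩

theorem isPullback : IsPullback (conn P.E).toCatHom P.p.toCatHom P.pi0.p.toCatHom
    (conn P.B).toCatHom :=
  isPullback_of_fibAux (P := P) (Q := P.pi0) (conn P.B) (conn P.E) (conn_wp P) hP.fibAux_bijective

/-- The morphism from a polynomial to the polynomial of its connected components. -/
def quot : Hom P P.pi0 where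
  f₁ := conn P.B
  f₂ := conn P.E
  ws := SlCat.functor_discrete_ext fun _ => rfl
  wt := SlCat.functor_discrete_ext fun _ => rfl
  pb := hP.isPullback

end Rigid

end CatPoly

/-! ### Σ-free operads have rigid polynomials -/

namespace Operad

variable {I : Type u} {T : Operad I}

open OperadData

/-- An equality in the set of all arrows splits into the equality of the source sequences and a
heterogeneous equality of the arrows. For a nontrivial permutation these are exactly what
`SigmaFree` rules out. -/
theorem SigmaFree.eq_refl (hT : T.SigmaFree) (α : T.Op) (e : Fin α.n ≃ Fin α.n)
    (h : α = α.reindex e) : e = Equiv.refl _ := by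
  by_contra he
  obtain ⟨n, c, i, a⟩ := α
  obtain ⟨-, hc, -, ha⟩ := Op.mk.inj h
  have hc : c ∘ e = c := (eq_of_heq hc).symm
  refine hT e he hc a (eq_of_heq ?_)
  exact (eqRec_heq (φ := fun c => T.Hom n c i) hc _).trans ha.symm

theorem reindex_symm (α : T.Op) {β : T.Op} (e : Fin α.n ≃ Fin β.n) (h : α = β.reindex e) :
    β = α.reindex e.symm := by
  have h' : β = (β.reindex e).reindex e.symm := by
    rw [T.reindex_trans, Equiv.symm_trans_self, T.reindex_refl]
  exact T.eq_reindex h.symm _ h'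

/-- The inverse of `f` followed by `g` is a permutation that fixes `β`, so it is trivial. This is
the only place where the operad being Σ-free enters. -/
theorem SigmaFree.rigid (hT : T.SigmaFree) : T.poly.Rigid where
  inv {α β} f := ⟨BHom.mk (perm f).symm (reindex_symm _ _ (perm_w f))⟩
  thin {α β} f g := by
    have h := reindex_symm _ _ (perm_w f)
    have h' := T.comp_w _ _ h (perm_w g)
    have := SigmaFree.eq_refl hT _ _ h'
    refine perm_ext ?_
    ext j
    have := congrArg (fun e : Fin β.op.n ≃ Fin β.op.n => e (perm f j)) this
    simpa using congrArg Fin.val this.symm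
end Operad

/-! ### Lifting and descent for polynomials and their 2-functors -/

namespace SlCat

variable {I : Type u} {X Y Z : SlCat I}

theorem epi_hom_ext {f : X ⟶ Y} (hf : SurjFull (Hom.F f)) {g h : Y ⟶ Z}
    (e : f ≫ g = f ≫ h) : g = h :=
  Hom.ext (hf.hom_ext (congrArg Hom.F e))

end SlCat

namespace CatPoly

variable {I : Type u}

section

variable {P Q : CatPoly I}

/-- Fibres are discrete, so labels and components of arrows can be lifted independently for each
element of a fibre. The lifted labels have the right colours because `f` lies over `I`. -/
theorem surjFull_map (P : CatPoly I) {X Y : SlCat I} {f : X ⟶ Y} (hf : SurjFull (SlCat.Hom.F f)) :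
    SurjFull (Lab.map P f) where
  surj := by
    rintro ⟨b, h, w⟩
    choose k hk using fun x => hf.surj (h x)
    refine ⟨⟨b, k, fun x => ?_⟩, Lab.obj_ext hk⟩
    rw [← w x, ← hk x]
    exact (SlCat.Hom.col_obj f _).symm
  full := ⟨fun {z z'} φ => by
    let φ' : Lab.mapObj f z ⟶ Lab.mapObj f z' := φ
    choose k hk using fun x y (r : P.R (Lab.β φ') x y) => hf.exists_map (Lab.γ φ' r)
    exact ⟨Lab.mk' (z := z) (z' := z') (Lab.β (z := Lab.mapObj f z) φ') k, Lab.hom_ext rfl fun x y r r' => hk x y r⟩⟩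

/-- This is currying: a labelling of pairs is a labelling by labellings, and likewise for arrows.
The comparison can therefore be cancelled when laws about composite polynomials are tested on
iterated 2-functors. -/
theorem surjFull_compFun (P Q : CatPoly I) (X : SlCat I) : SurjFull (compFun P Q X) where
  surj := by
    rintro ⟨⟨b, k, w⟩, h, w'⟩
    exact ⟨⟨b, fun x => ⟨k x, fun y => h ((pr ⟨b, k, w⟩).symm ⟨x, y⟩),
      fun y => (w' _).trans (sc_pr_symm _)⟩, w⟩,
      Lab.obj_ext fun y => congrArg h ((pr ⟨b, k, w⟩).symm_apply_apply y)⟩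
  full := ⟨fun {z z'} φ => by
    let ψ : (compObj z).b ⟶ (compObj z').b := Lab.β (z := compObj z) (z' := compObj z') φ
    refine ⟨Lab.mk' (z := z) (z' := z') (Lab.β (z := (compObj z).b) (z' := (compObj z').b) ψ)
      fun x y r => Lab.mk' (z := z.h x) (z' := z'.h y)
        (Lab.γ (z := (compObj z).b) (z' := (compObj z').b) ψ r) fun v v' r' =>
        Lab.γ φ (x := (pr (compObj z).b).symm ⟨x, v⟩) (y := (pr (compObj z').b).symm ⟨y, v'⟩)
          (R_pr_symm.2 ⟨r, r'⟩), ?_⟩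
    refine Lab.hom_ext rfl fun x y r r' => eq_of_heq ?_
    exact Lab.γ_heq φ ((pr (compObj z).b).symm_apply_apply x)
      ((pr (compObj z').b).symm_apply_apply y) _ _⟩

/-- Being full and surjective on objects is inherited from `f₁` because `f₂` is its pullback:
objects lift through the fibre bijections, and an arrow lifts since transport is reflected by them.
-/
theorem Hom.surjFull_f₂ (f : Hom P Q) (hf : SurjFull f.f₁) : SurjFull f.f₂ where
  surj e := by
    obtain ⟨b, hb⟩ := hf.surj (Q.p.obj e)
    exact ⟨(f.fibInv ⟨e, hb.symm⟩).1, congrArg Subtype.val (f.fibMap_fibInv ⟨e, hb.symm⟩)⟩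
  full := ⟨fun {e e'} κ => by
    obtain ⟨β, hβ⟩ := hf.exists_map (eqToHom (Functor.congr_obj f.wp e).symm ≫ Q.p.map κ ≫
      eqToHom (Functor.congr_obj f.wp e'))
    obtain ⟨κ', hκ'⟩ : P.R β ⟨e, rfl⟩ ⟨e', rfl⟩ :=
      R_of_fibAux f.f₁ f.f₂ f.wp (fun b => (f.fibEquiv b).injective) ⟨κ, by simp [hβ]⟩
    refine ⟨κ', Q.p_faithful ?_⟩
    have h := Functor.congr_hom f.wp κ'
    simp only [Functor.comp_map] at h
    rw [h, hκ']
    simp [hβ]⟩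

/-- Morphisms to polynomials of connected components descend along morphisms that are full and
surjective on objects. -/
theorem Hom.exists_desc {R : CatPoly I} (f : Hom P Q) (hf : SurjFull f.f₁) (g : Hom P R.pi0) :
    ∃ k : Hom Q R.pi0, f.comp k = g := by
  have hf₂ := f.surjFull_f₂ hf
  -- Both categories of `R.pi0` are discrete, so the two functors descend separately. Their
  -- compatibilities are then checked after composition with `f.f₁` or `f.f₂`.
  obtain ⟨k₁, h₁⟩ := hf.exists_discrete g.f₁
  obtain ⟨k₂, h₂⟩ := hf₂.exists_discrete g.f₂
  have wp : k₂ ⋙ R.pi0.p = Q.p ⋙ k₁ := hf₂.hom_ext (by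
    rw [← Functor.assoc, h₂, g.wp, ← h₁, ← Functor.assoc, ← Functor.assoc, f.wp])
  refine ⟨⟨k₁, k₂, hf₂.hom_ext ?_, hf.hom_ext ?_, isPullback_of_fibAux (P := Q) (Q := R.pi0) k₁ k₂ wp fun c => ?_⟩,
    Hom.ext' h₁ fun e => Functor.congr_obj h₂ e⟩
  · rw [← Functor.assoc, h₂, g.ws, f.ws]
  · rw [← Functor.assoc, h₁, g.wt, f.wt]
  · obtain ⟨b, rfl⟩ := hf.surj c
    -- The fibre maps of `f`, of the descended pair and of `g` form a commuting triangle. Those of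
    -- `f` and `g` are bijective, hence so is the third.
    have key : ∀ x : P.Fib b, (fibAux (P := Q) (Q := R.pi0) k₁ k₂ wp _ (f.fibMap x)).1 = (g.fibMap x).1 :=
      fun x => Functor.congr_obj h₂ x.1
    constructor
    · intro y y' h
      obtain ⟨x, rfl⟩ := (f.fibEquiv b).surjective y
      obtain ⟨x', rfl⟩ := (f.fibEquiv b).surjective y'
      refine congrArg (f.fibEquiv b) ((g.fibEquiv b).injective (Subtype.ext ?_))
      exact (key x).symm.trans ((congrArg Subtype.val h).trans (key x'))
    · rintro ⟨e, he⟩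
      obtain ⟨x, hx⟩ := (g.fibEquiv b).surjective ⟨e, he.trans (Functor.congr_obj h₁ b)⟩
      exact ⟨f.fibMap x, Subtype.ext ((key x).trans (congrArg Subtype.val hx))⟩

/-- The test object is the universal labelling: a fibre labelled by its own elements. The labels on
its image record the inverse of the map between fibres, and therefore the action of the morphism on
`E`. -/
theorem Hom.ext_f₁_app {f g : Hom P Q} (h₁ : f.f₁ = g.f₁) (h : ∀ X, f.app X = g.app X) :
    f = g := by
  refine Hom.ext' h₁ fun e => ?_
  let X : SlCat I := ⟨Discrete (P.Fib (P.p.obj e)), Discrete.functor fun x => ⟨P.sc x⟩⟩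
  let z : Lab P X := ⟨P.p.obj e, fun x => ⟨x⟩, fun _ => rfl⟩
  have hz : f.labObj z = g.labObj z := Functor.congr_obj (congrArg SlCat.Hom.F (h X)) z
  -- An equality of labelled objects is turned into a statement on single elements of the fibres,
  -- which avoids rewriting in dependent types.
  have key : ∀ {l l' : Lab Q X} (_ : l = l') (y : Q.Fib l.b),
      ∃ y' : Q.Fib l'.b, y'.1 = y.1 ∧ l'.h y' = l.h y := by
    rintro l _ rfl y
    exact ⟨y, rfl, rfl⟩
  obtain ⟨y, hy, hy'⟩ := key hz (f.fibMap ⟨e, rfl⟩)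
  have h₂ : g.fibInv y = ⟨e, rfl⟩ :=
    (congrArg Discrete.as hy').trans (f.fibInv_fibMap ⟨e, rfl⟩)
  have h₃ := congrArg Subtype.val (congrArg g.fibMap h₂)
  rw [Hom.fibMap_fibInv] at h₃
  exact hy.symm.trans h₃

/-- A morphism to a polynomial of connected components is determined by its image under `PFun`. -/
theorem Hom.ext_app {f g : Hom P Q.pi0} (h : ∀ X, f.app X = g.app X) : f = g := by
  refine Hom.ext_f₁_app (SlCat.functor_discrete_ext fun b => ?_) h
  -- The same universal labelling also reveals the object of the base to which `b` is sent.
  -- Agreement on objects is enough, since the target base is discrete.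
  let X : SlCat I := ⟨Discrete (P.Fib b), Discrete.functor fun x => ⟨P.sc x⟩⟩
  have hz := Functor.congr_obj (congrArg SlCat.Hom.F (h X)) ⟨b, fun x => ⟨x⟩, fun _ => rfl⟩
  exact congrArg (fun l => l.b.as) hz

theorem Lab.eqToHom_γ {X : SlCat I} {z z' : Lab P X} (h : z = z') {x : P.Fib z.b} {y : P.Fib z'.b}
    (r : P.R (Lab.β (eqToHom h)) x y) : ∃ e, Lab.γ (eqToHom h) r = eqToHom e := by
  subst h
  exact ⟨_, Lab.id_γ z r⟩

end

namespace Rigid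

variable {P : CatPoly I} (hP : P.Rigid)

include hP

theorem surjFull_conn : SurjFull (conn P.B) where
  surj := conn_surjective
  full := ⟨fun f => by
    obtain ⟨β⟩ := hP.nonempty_hom (Discrete.ext (Discrete.eq_of_hom f))
    exact ⟨β, Subsingleton.elim _ _⟩⟩

/-- Labels are carried back along the bijections between fibres, and the underlying arrow of the
base is lifted along `conn`, which is full because connected objects are joined by an arrow. -/
theorem surjFull_lab (X : SlCat I) : SurjFull (hP.quot.lab X) where
  surj := by
    rintro ⟨b, h, w⟩
    obtain ⟨b, rfl⟩ := conn_surjective b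
    refine ⟨⟨b, fun x => h (hP.quot.fibMap x), fun x => (w _).trans (hP.quot.sc_fibMap x)⟩,
      Lab.obj_ext fun y => ?_⟩
    exact congrArg h (hP.quot.fibMap_fibInv y)
  full := ⟨fun {z z'} φ => by
    obtain ⟨β, hβ⟩ := hP.surjFull_conn.exists_map (Lab.β φ)
    have hR : ∀ {x y}, P.R β x y → P.pi0.R (Lab.β φ) (hP.quot.fibMap x) (hP.quot.fibMap y) :=
      fun r => hβ ▸ hP.quot.R_fibMap r
    -- The two `eqToHom` account for `fibInv` being inverse to `fibMap` only up to a proved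
    -- equality, so that labels at `x` and at `fibInv (fibMap x)` are different expressions.
    refine ⟨Lab.mk' (z := z) (z' := z') β fun x y r =>
      eqToHom (congrArg z.h (hP.quot.fibInv_fibMap x).symm) ≫ Lab.γ φ (hR r) ≫
        eqToHom (congrArg z'.h (hP.quot.fibInv_fibMap y)),
      Lab.hom_ext hβ fun x y r r' => ?_⟩
    refine eq_of_heq (HEq.trans (b := Lab.γ φ (hR (hP.quot.R_fibInv r))) ?_ ?_)
    · exact (eqToHom_comp_heq _ _).trans (comp_eqToHom_heq _ _)
    · exact Lab.γ_heq φ (hP.quot.fibMap_fibInv x) (hP.quot.fibMap_fibInv y) _ _⟩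

/-- Thinness of the base leaves only the components on labels to be compared, and the quotient keeps
all of them since it is bijective on fibres. -/
theorem faithful_lab (X : SlCat I) : (hP.quot.lab X).Faithful where
  map_injective {z z'} φ ψ h := Lab.hom_ext (hP.thin _ _) fun x y r r' => by
    have h₁ := hP.quot.R_fibMap r
    have h₂ := hP.quot.R_fibMap r'
    have h₃ := Lab.γ_congr h h₁ h₂
    have hx := hP.quot.fibInv_fibMap x
    have hy := hP.quot.fibInv_fibMap y
    have k₁ : Lab.γ φ r ≍ Lab.γ φ (hP.quot.R_fibInv h₁) := Lab.γ_heq φ hx.symm hy.symm _ _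
    have k₂ : Lab.γ ψ (hP.quot.R_fibInv h₂) ≍ Lab.γ ψ r' := Lab.γ_heq ψ hx hy _ _
    exact eq_of_heq (k₁.trans ((heq_of_eq h₃).trans k₂))

end Rigid

end CatPoly

/-! ### The monad structure on connected components -/

namespace CatPoly

variable {I : Type u}

theorem Mon.ext {P : CatPoly I} {M N : Mon P} (hu : M.u = N.u) (hm : M.m = N.m) : M = N := by
  obtain ⟨u, m, _, _, _⟩ := M
  obtain ⟨u', m', _, _, _⟩ := N
  obtain rfl : u = u' := hu
  obtain rfl : m = m' := hm
  rfl

/-- Both functors of `f` can be cancelled: `f₁` by assumption and `f₂` as its pullback. -/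
theorem Hom.epi_ext {P Q R : CatPoly I} {f : Hom P Q} (hf : SurjFull f.f₁) {g h : Hom Q R}
    (e : f.comp g = f.comp h) : g = h :=
  Hom.ext' (hf.hom_ext (congrArg Hom.f₁ e)) fun x => by
    obtain ⟨x, rfl⟩ := (f.surjFull_f₂ hf).surj x
    exact Functor.congr_obj (congrArg Hom.f₂ e) x

/-- `PFun` sends morphisms of monads to morphisms of 2-monads. -/
theorem IsMonMor.pfun {P Q : CatPoly I} {M : Mon P} {N : Mon Q} {f : Hom P Q}
    (hf : IsMonMor M N f) : TwoCat.IsMonadMor M.pfun N.pfun f.pfun where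
  unit X := by
    change (unitApp X ≫ M.u.app X) ≫ f.app X = unitApp X ≫ N.u.app X
    rw [← hf.unit, app_comp]
    rfl
  mult X := by
    change (compApp P P X ≫ M.m.app X) ≫ f.app X =
      (P.fmap (f.app X) ≫ f.app (Q.fobj X)) ≫ compApp Q Q X ≫ N.m.app X
    calc _ = compApp P P X ≫ (M.m.comp f).app X := by rw [app_comp]; rfl
      _ = (compApp P P X ≫ (hcomp f f).app X) ≫ N.m.app X := by rw [hf.mult, app_comp]; rfl
      _ = _ := by rw [hcomp_app]; rfl

theorem unitApp_naturality {X Y : SlCat I} (g : X ⟶ Y) :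
    g ≫ unitApp Y = unitApp X ≫ (one I).fmap g := pfunUnit.naturality g

section

variable {P : CatPoly I} (u : Hom (one I) P) (m : Hom (P.comp P) P) (X : SlCat I)

/-- The next four results translate the two sides of the monad laws into composites of functors over
`I`. They are stated for arbitrary `u` and `m`, so that they apply to a structure whose laws are
still to be proved. -/
theorem left_unit_app : (P.lu.comp ((hcomp u (Hom.id P)).comp m)).app X =
    (unitApp (P.fobj X) ≫ u.app (P.fobj X)) ≫ compApp P P X ≫ m.app X := by
  have h := hcomp_app u (Hom.id P) X
  rw [app_id] at h
  rw [app_comp, app_comp, lu_app]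
  exact congrArg (fun k => unitApp (P.fobj X) ≫ k ≫ m.app X) h

theorem right_unit_app : (P.ru.comp ((hcomp (Hom.id P) u).comp m)).app X =
    P.fmap (unitApp X ≫ u.app X) ≫ compApp P P X ≫ m.app X := by
  have h := hcomp_app (Hom.id P) u X
  rw [app_id] at h
  rw [app_comp, app_comp, ru_app]
  exact congrArg (fun k => P.fmap (unitApp X) ≫ k ≫ m.app X) h

/-- Associativity lives on a composite of three polynomials; precomposing with the comparison maps
moves it to the threefold iterate of the 2-functor. -/
theorem assoc_left_app : (P.fmap (compApp P P X) ≫ compApp P (P.comp P) X) ≫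
    ((CatPoly.assoc P P P).comp ((hcomp m (Hom.id P)).comp m)).app X =
      (compApp P P (P.fobj X) ≫ m.app (P.fobj X)) ≫ compApp P P X ≫ m.app X := by
  have h := hcomp_app m (Hom.id P) X
  rw [app_id] at h
  rw [app_comp, app_comp]
  exact (congrArg (· ≫ (hcomp m (Hom.id P)).app X ≫ m.app X) (assoc_app P P P X)).trans
    (congrArg (fun k => compApp P P (P.fobj X) ≫ k ≫ m.app X) h)

theorem assoc_right_app : (P.fmap (compApp P P X) ≫ compApp P (P.comp P) X) ≫
    ((hcomp (Hom.id P) m).comp m).app X =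
      P.fmap (compApp P P X ≫ m.app X) ≫ compApp P P X ≫ m.app X := by
  have h := hcomp_app (Hom.id P) m X
  rw [app_id] at h
  rw [app_comp]
  exact congrArg (fun k => P.fmap (compApp P P X) ≫ k ≫ m.app X) h

end

namespace Rigid

variable {P : CatPoly I} (hP : P.Rigid)

include hP

/-- On bases the horizontal composite relabels along the quotient and then applies the quotient to
the outer polynomial, and each of the two steps is full and surjective on objects. -/
theorem surjFull_hcomp : SurjFull (hcomp hP.quot hP.quot).f₁ :=
  (surjFull_map P (f := hP.quot.base) hP.surjFull_conn).comp (hP.surjFull_lab P.pi0.base)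

theorem exists_mult (M : Mon P) : ∃ m : Hom (P.pi0.comp P.pi0) P.pi0,
    (hcomp hP.quot hP.quot).comp m = M.m.comp hP.quot :=
  Hom.exists_desc _ hP.surjFull_hcomp _

theorem surjFull_app (X : SlCat I) : SurjFull (SlCat.Hom.F (hP.quot.app X)) := hP.surjFull_lab X

/-- The multiplication on the polynomial of connected components. -/
noncomputable def mult (M : Mon P) : Hom (P.pi0.comp P.pi0) P.pi0 := (hP.exists_mult M).choose

theorem hcomp_mult (M : Mon P) :
    (hcomp hP.quot hP.quot).comp (hP.mult M) = M.m.comp hP.quot := (hP.exists_mult M).choose_spec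

/-- The defining equation of `mult`, seen through `PFun`: the quotient respects multiplications. It
is the only fact about `mult` that the monad laws use. -/
theorem mult_app (M : Mon P) (X : SlCat I) :
    P.fmap (hP.quot.app X) ≫ hP.quot.app (P.pi0.fobj X) ≫
      compApp P.pi0 P.pi0 X ≫ (hP.mult M).app X =
    (compApp P P X ≫ M.m.app X) ≫ hP.quot.app X := by
  have h := app_comp M.m hP.quot X
  rw [← hP.hcomp_mult M, app_comp] at h
  exact (congrArg (· ≫ (hP.mult M).app X) (hcomp_app hP.quot hP.quot X)).symm.trans
    (congrArg (compApp P P X ≫ ·) h)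

/-- After `PFun` and precomposition with the quotient, naturality moves the quotient past the unit
and `mult_app` moves it past the multiplication. What remains is the unit law of `M`. The other two
laws follow the same pattern. -/
theorem mon_left_unit (M : Mon P) : P.pi0.lu.comp
    ((hcomp (M.u.comp hP.quot) (Hom.id P.pi0)).comp (hP.mult M)) = Hom.id P.pi0 :=
  Hom.ext_app fun X => SlCat.epi_hom_ext (hP.surjFull_app X) <| by
    rw [left_unit_app, app_id, app_comp]
    let q := fun X => hP.quot.app X
    let μ' := compApp P.pi0 P.pi0 X ≫ (hP.mult M).app X
    have h₁ : (unitApp (P.fobj X) ≫ M.u.app (P.fobj X)) ≫ compApp P P X ≫ M.m.app X = 𝟙 _ :=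
      M.pfun.left_unit X
    calc _ = (q X ≫ unitApp (P.pi0.fobj X)) ≫
          (M.u.app (P.pi0.fobj X) ≫ q (P.pi0.fobj X)) ≫ μ' := rfl
      _ = (unitApp (P.fobj X) ≫ M.u.app (P.fobj X)) ≫
          P.fmap (q X) ≫ q (P.pi0.fobj X) ≫ μ' := by rw [unitApp_naturality]; rfl
      _ = ((unitApp (P.fobj X) ≫ M.u.app (P.fobj X)) ≫ compApp P P X ≫ M.m.app X) ≫ q X :=
        congrArg (_ ≫ ·) (hP.mult_app M X)
      _ = _ := by rw [h₁]; rfl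

theorem mon_right_unit (M : Mon P) : P.pi0.ru.comp
    ((hcomp (Hom.id P.pi0) (M.u.comp hP.quot)).comp (hP.mult M)) = Hom.id P.pi0 :=
  Hom.ext_app fun X => SlCat.epi_hom_ext (hP.surjFull_app X) <| by
    rw [right_unit_app, app_id, app_comp]
    have h₁ : P.fmap (unitApp X ≫ M.u.app X) ≫ compApp P P X ≫ M.m.app X = 𝟙 _ :=
      M.pfun.right_unit X
    -- Naturality of the quotient holds by definition here, so the composite already contains the
    -- left side of `mult_app`, preceded by the unit of `M`.
    refine (congrArg (P.fmap (unitApp X ≫ M.u.app X) ≫ ·) (hP.mult_app M X)).trans ?_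
    exact congrArg (· ≫ hP.quot.app X) h₁

theorem mon_assoc (M : Mon P) : (CatPoly.assoc P.pi0 P.pi0 P.pi0).comp
    ((hcomp (hP.mult M) (Hom.id P.pi0)).comp (hP.mult M)) =
      (hcomp (Hom.id P.pi0) (hP.mult M)).comp (hP.mult M) :=
  Hom.ext_app fun X => SlCat.epi_hom_ext
      -- The first cancellation replaces the threefold composite of polynomials by the threefold
      -- iterate of the 2-functor.
      (f := P.pi0.fmap (compApp P.pi0 P.pi0 X) ≫ compApp P.pi0 (P.pi0.comp P.pi0) X)
      ((surjFull_map P.pi0 (surjFull_compFun P.pi0 P.pi0 X)).comp (surjFull_compFun _ _ X)) <| by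
    rw [assoc_left_app, assoc_right_app]
    let q := fun X => hP.quot.app X
    let μ := fun X => compApp P P X ≫ M.m.app X
    let μ' := fun X => compApp P.pi0 P.pi0 X ≫ (hP.mult M).app X
    let Y := P.pi0.fobj X
    -- The second cancellation applies the quotient at each of the three levels and leads back to
    -- the iterate of `P`, where associativity of `M` is known.
    refine SlCat.epi_hom_ext (f := P.fmap (P.fmap (q X)) ≫ P.fmap (q Y) ≫ q (P.pi0.fobj Y))
      ((surjFull_map P (surjFull_map P (hP.surjFull_lab X))).comp
        ((surjFull_map P (hP.surjFull_lab Y)).comp (hP.surjFull_lab _))) ?_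
    calc _ = P.fmap (P.fmap (q X)) ≫ (P.fmap (q Y) ≫ q (P.pi0.fobj Y) ≫ μ' Y) ≫ μ' X := rfl
      _ = P.fmap (P.fmap (q X)) ≫ (μ Y ≫ q Y) ≫ μ' X :=
        congrArg (fun k => P.fmap (P.fmap (q X)) ≫ k ≫ μ' X) (hP.mult_app M Y)
      _ = μ (P.fobj X) ≫ P.fmap (q X) ≫ q Y ≫ μ' X := rfl
      _ = μ (P.fobj X) ≫ μ X ≫ q X := congrArg (μ (P.fobj X) ≫ ·) (hP.mult_app M X)
      _ = P.fmap (μ X) ≫ μ X ≫ q X := congrArg (· ≫ q X) (M.pfun.assoc X).symm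
      _ = P.fmap (μ X) ≫ P.fmap (q X) ≫ q Y ≫ μ' X :=
        congrArg (P.fmap (μ X) ≫ ·) (hP.mult_app M X).symm
      _ = P.fmap (P.fmap (q X) ≫ q Y ≫ μ' X) ≫ q Y ≫ μ' X :=
        congrArg (fun k => P.fmap k ≫ q Y ≫ μ' X) (hP.mult_app M X).symm
      _ = _ := rfl

/-- The monad structure on the polynomial of connected components. -/
noncomputable def mon (M : Mon P) : Mon P.pi0 where
  u := M.u.comp hP.quot
  m := hP.mult M
  left_unit := hP.mon_left_unit M
  right_unit := hP.mon_right_unit M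
  assoc := hP.mon_assoc M

theorem isMonMor_quot (M : Mon P) : IsMonMor M (hP.mon M) hP.quot where
  unit := rfl
  mult := (hP.hcomp_mult M).symm

/-- The unit is prescribed by the morphism condition, and the multiplication is prescribed on the
image of the horizontal composite of the quotient with itself, which can be cancelled. -/
theorem mon_unique {M : Mon P} {N N' : Mon P.pi0} (hN : IsMonMor M N hP.quot)
    (hN' : IsMonMor M N' hP.quot) : N = N' :=
  Mon.ext (hN.unit.symm.trans hN'.unit)
    (Hom.epi_ext hP.surjFull_hcomp (hN.mult.symm.trans hN'.mult))

end Rigid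

end CatPoly

/-! ### Descent of 2-natural transformations and modifications -/

namespace SlCat

variable {I : Type u} {X Y : SlCat I}

/-- The equations of 2-naturality and of modifications hold up to equalities of objects;
heterogeneous equality absorbs these, and the computations below are carried out in that form. -/
theorem comp_eqToHom_eq_iff_heq {C : Type u} [SmallCategory C] {a b c d : C} (f : a ⟶ b) (g : c ⟶ d)
    (ha : a = c) (hb : b = d) : f ≫ eqToHom hb = eqToHom ha ≫ g ↔ f ≍ g := by
  subst ha hb
  simp

theorem eqToHom_heq {C : Type u} [SmallCategory C] {a b c d : C} (h : a = b) (h' : c = d)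
    (ha : a = c) : eqToHom h ≍ eqToHom h' := by
  subst h h' ha
  rfl

theorem exists_eq_eqToHom_of_heq {C : Type u} [SmallCategory C] {a b c d : C} {f : a ⟶ b}
    {g : c ⟶ d} (ha : a = c) (hb : b = d) (h : f ≍ g) (hg : ∃ e, g = eqToHom e) :
    ∃ e, f = eqToHom e := by
  subst ha hb h
  exact hg

/-- Identity components make the two functors agree on objects, and naturality then makes them agree
on arrows. -/
theorem exists_eq_eqToHom {f g : X ⟶ Y} {α : f ⟶ g} (h : ∀ x, ∃ e, cmp α x = eqToHom e) :
    ∃ e, α = eqToHom e := by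
  have e : f = g := Hom.ext (Functor.hext (fun x => (h x).1) fun x y a => by
    obtain ⟨hx, hx'⟩ := h x
    obtain ⟨hy, hy'⟩ := h y
    have := cmp_naturality α a
    rw [hx', hy'] at this
    exact (comp_eqToHom_eq_iff_heq _ _ hx hy).1 this)
  refine ⟨e, cell_ext fun x => ?_⟩
  rw [cmp_eqToHom]
  exact (h x).2

theorem cmp_congr {f g : X ⟶ Y} (α : f ⟶ g) {x y : X.C} (h : x = y) : cmp α x ≍ cmp α y := by
  subst h
  rfl

theorem map_heq {F G : X ⟶ Y} (h : F = G) {a b c d : X.C} {f : a ⟶ b} {g : c ⟶ d} (ha : a = c)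
    (hb : b = d) (hfg : f ≍ g) : (Hom.F F).map f ≍ (Hom.F G).map g := by
  subst h ha hb hfg
  rfl

theorem cmp_eq_of_eq {f g : X ⟶ Y} {α β : f ⟶ g} (h : α = β) (x : X.C) : cmp α x = cmp β x := by
  rw [h]

/-- 2-cells descend along 1-cells that are full and surjective on objects. -/
theorem exists_whiskerLeft {Z : SlCat I} {q : X ⟶ Y} (hq : SurjFull (Hom.F q)) {f g : Y ⟶ Z}
    (θ : q ≫ f ⟶ q ≫ g) : ∃ ξ : f ⟶ g, q ◁ ξ = θ := by
  obtain ⟨ξ, hξ⟩ := hq.exists_natTrans (nt θ)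
  exact ⟨mkCell ξ, Cell.ext hξ⟩

theorem whiskerLeft_injective {Z : SlCat I} {q : X ⟶ Y} (hq : SurjFull (Hom.F q)) {f g : Y ⟶ Z}
    {ξ ξ' : f ⟶ g} (h : q ◁ ξ = q ◁ ξ') : ξ = ξ' :=
  Cell.ext (hq.natTrans_ext fun x => congrArg (fun α => cmp α x) h)

end SlCat

namespace TwoCat

open SlCat

variable {I : Type u} {F G H : StrictPseudofunctor (SlCat I) (SlCat I)}

theorem TwoNat.map_cmp (φ : TwoNat F G) {X Y : SlCat I} {f g : X ⟶ Y} (θ : f ⟶ g)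
    (x : (F.obj X).C) : (Hom.F (φ.app Y)).map (cmp (F.map₂ θ) x) ≍
      cmp (G.map₂ θ) ((Hom.F (φ.app X)).obj x) := by
  have h := cmp_eq_of_eq (φ.naturality₂ θ) x
  rw [cmp_comp, cmp_comp, cmp_eqToHom, cmp_eqToHom] at h
  exact (comp_eqToHom_eq_iff_heq _ _ _ _).1 h

theorem Modif.map_cmp {φ ψ : TwoNat F G} (Γ : Modif φ ψ) {X Y : SlCat I} (f : X ⟶ Y)
    (x : (F.obj X).C) : cmp (Γ.app Y) ((Hom.F (F.map f)).obj x) ≍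
      (Hom.F (G.map f)).map (cmp (Γ.app X) x) := by
  have h := cmp_eq_of_eq (Γ.naturality f) x
  rw [cmp_comp, cmp_comp, cmp_eqToHom, cmp_eqToHom] at h
  exact (comp_eqToHom_eq_iff_heq _ _ _ _).1 h

theorem Modif.ext {φ ψ : TwoNat F G} {Γ Γ' : Modif φ ψ} (h : ∀ X, Γ.app X = Γ'.app X) :
    Γ = Γ' := by
  obtain ⟨a, _⟩ := Γ
  obtain ⟨b, _⟩ := Γ'
  obtain rfl : a = b := funext h
  rfl

/-- Identity components already force the two 2-natural transformations to coincide, so the test can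
be made at one object of one category at a time. -/
theorem Modif.isId_iff {φ ψ : TwoNat F G} (Γ : Modif φ ψ) :
    Γ.IsId ↔ ∀ X x, ∃ e, cmp (Γ.app X) x = eqToHom e := by
  constructor
  · rintro ⟨e, h⟩ X x
    rw [h X, cmp_eqToHom]
    exact ⟨_, rfl⟩
  · intro h
    have h' := fun X => exists_eq_eqToHom (h X)
    choose e he using h'
    exact ⟨TwoNat.ext e, he⟩

section

variable {q : TwoNat F G} (hq : ∀ X, SurjFull (Hom.F (q.app X)))

include hq

theorem TwoNat.comp_left_injective {k k' : TwoNat G H} (h : q.comp k = q.comp k') : k = k' :=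
  TwoNat.ext fun X => epi_hom_ext (hq X) (congrArg (fun χ => TwoNat.app χ X) h)

/-- A family of 1-cells is 2-natural if it is so after composition with `q`. -/
theorem TwoNat.exists_of_comp (h : TwoNat F H) (k : ∀ X, G.obj X ⟶ H.obj X)
    (hk : ∀ X, q.app X ≫ k X = h.app X) : ∃ k' : TwoNat G H, q.comp k' = h := by
  have nat : ∀ {X Y : SlCat I} (f : X ⟶ Y), G.map f ≫ k Y = k X ≫ H.map f := by
    intro X Y f
    refine epi_hom_ext (hq X) ?_
    rw [← Strict.assoc, ← q.naturality, Strict.assoc, hk, h.naturality, ← hk, Strict.assoc]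
  refine ⟨⟨k, nat, fun {X Y f g} θ => cell_ext fun y => ?_⟩, TwoNat.ext hk⟩
  -- Every object is in the image of `q`, and there compatibility with 2-cells follows by comparing
  -- the 2-naturality of `q` with that of `h`.
  obtain ⟨x, rfl⟩ := (hq X).surj y
  rw [cmp_comp, cmp_comp, cmp_eqToHom, cmp_eqToHom, comp_eqToHom_eq_iff_heq]
  have hq' := q.map_cmp θ x
  have hh := h.map_cmp θ x
  have hX := fun f : X ⟶ Y => Functor.congr_obj (congrArg Hom.F (q.naturality f)) x
  have h₁ : (Hom.F (k Y)).map (cmp (G.map₂ θ) ((Hom.F (q.app X)).obj x)) ≍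
      (Hom.F (k Y)).map ((Hom.F (q.app Y)).map (cmp (F.map₂ θ) x)) :=
    map_heq rfl (hX f).symm (hX g).symm hq'.symm
  have h₂ : (Hom.F (k Y)).map ((Hom.F (q.app Y)).map (cmp (F.map₂ θ) x)) ≍
      (Hom.F (h.app Y)).map (cmp (F.map₂ θ) x) :=
    map_heq (F := q.app Y ≫ k Y) (hk Y) rfl rfl HEq.rfl
  refine h₁.trans (h₂.trans (hh.trans (cmp_congr _ ?_)))
  exact (Functor.congr_obj (congrArg Hom.F (hk X)) x).symm

/-- Each component descends because `q` is full and surjective on objects. The modification axiom is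
an equation of components, so it suffices to read it at objects in the image of `q`, where it is the
axiom for `Θ`. -/
theorem Modif.exists_of_whiskerLeft {k k' : TwoNat G H} (Θ : Modif (q.comp k) (q.comp k')) :
    ∃! Ξ : Modif k k', Ξ.whiskerLeft q = Θ := by
  choose ξ hξ using fun X => exists_whiskerLeft (hq X) (Θ.app X)
  refine ⟨⟨ξ, fun {X Y} f => cell_ext fun y => ?_⟩, Modif.ext hξ, fun Ξ hΞ => Modif.ext fun X =>
    whiskerLeft_injective (hq X) ((congrArg (fun Γ => Modif.app Γ X) hΞ).trans (hξ X).symm)⟩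
  obtain ⟨x, rfl⟩ := (hq X).surj y
  rw [cmp_comp, cmp_comp, cmp_eqToHom, cmp_eqToHom, comp_eqToHom_eq_iff_heq]
  have hΘ := Θ.map_cmp f x
  rw [← hξ, ← hξ] at hΘ
  refine HEq.trans (cmp_congr (ξ Y) ?_) hΘ
  exact (Functor.congr_obj (congrArg Hom.F (q.naturality f)) x).symm

end

end TwoCat

/-! ### The coidentifier among endo-2-functors -/

namespace CatPoly

open SlCat

variable {I : Type u} {P : CatPoly I} {X : SlCat I}

/-- The base is discrete, so the underlying arrow contributes nothing and the labels alone decide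
whether an arrow is an identity. -/
theorem pi0_exists_eqToHom {z z' : Lab P.pi0 X} (φ : z ⟶ z')
    (h : ∀ x y (r : P.pi0.R (Lab.β φ) x y), ∃ e, Lab.γ φ r = eqToHom e) :
    ∃ e, φ = eqToHom e := by
  have hb : z.b = z'.b := Discrete.ext (Discrete.eq_of_hom (Lab.β φ))
  obtain ⟨b, l, w⟩ := z
  obtain ⟨b', l', w'⟩ := z'
  obtain rfl : b = b' := hb
  have hβ : Lab.β φ = 𝟙 b := Subsingleton.elim _ _
  have hl : l = l' := funext fun x => (h x x (hβ ▸ P.pi0.R_id x)).1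
  subst hl
  refine ⟨rfl, Lab.hom_ext (Subsingleton.elim _ _) fun x y r r' => ?_⟩
  obtain ⟨e, he⟩ := h x y r
  rw [he]
  exact (Lab.eqToHom_γ rfl r').2.symm

/-- The arrows of `P X` all of whose labels are identities are the components of the 2-cell of
arrows. -/
theorem exists_arrCell {z z' : Lab P X} (φ : z ⟶ z')
    (h : ∀ x y (r : P.R (Lab.β φ) x y), ∃ e, Lab.γ φ r = eqToHom e) :
    ∃ (w : Lab P.arr X) (_ : P.arrSource.labObj w = z) (_ : P.arrTarget.labObj w = z'),
      P.arrCell.labHom w ≍ φ := by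
  -- The fibre of the polynomial of arrows over an arrow of `B` consists of the arrows of `E` above
  -- it. Each of these is given the label of its source.
  let w : Lab P.arr X := ⟨Arrow.mk (Lab.β φ),
    fun x => z.h ⟨x.1.left, congrArg Comma.left x.2⟩, fun x => z.w _⟩
  have h₁ : P.arrSource.labObj w = z := Lab.obj_ext (h' := z.h) fun y =>
    congrArg z.h (P.arrSource.fibMap_fibInv (b := w.b) y)
  -- Reading the labels at targets instead gives `z'`, because by `h` each label agrees with the one
  -- to which it is transported.
  have h₂ : P.arrTarget.labObj w = z' := Lab.obj_ext (h' := z'.h) fun y => by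
    have r := P.arrCell.R_fibMap (b := w.b) (P.arrTarget.fibInv (b := w.b) y)
    rw [P.arrTarget.fibMap_fibInv (b := w.b) y] at r
    exact (h _ _ r).1
  refine ⟨w, h₁, h₂, Lab.hom_heq h₁ h₂ HEq.rfl fun x y r x' y' r' hx hy => ?_⟩
  cases hx
  cases hy
  obtain ⟨e, he⟩ := h x y r'
  rw [he]
  exact eqToHom_heq (congrArg w.h (P.arrCell.fibInv_eq r)) e
    (congrArg z.h (P.arrSource.fibMap_fibInv (b := w.b) x))

namespace Rigid

variable (hP : P.Rigid)

include hP

/-- Components of the 2-cell of arrows carry identity labels, and their underlying arrows of `B` are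
collapsed by the quotient. -/
theorem isId_quot : (P.arrCell.pfun.whiskerRight hP.quot.pfun).IsId := by
  rw [TwoCat.Modif.isId_iff]
  intro X z
  exact pi0_exists_eqToHom (hP.quot.labHom (P.arrCell.labHom z)) fun x y r =>
    ⟨congrArg z.h (P.arrCell.fibInv_eq (hP.quot.R_fibInv r)), rfl⟩

/-- The quotient permutes labels along bijections of fibres without changing them, so an arrow that
it collapses must have had identity labels. -/
theorem exists_eqToHom_γ {z z' : Lab P X} (φ : z ⟶ z') (e : hP.quot.labObj z = hP.quot.labObj z')
    (h : hP.quot.labHom φ = eqToHom e) (x y) (r : P.R (Lab.β φ) x y) :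
    ∃ e, Lab.γ φ r = eqToHom e := by
  have h₁ : P.pi0.R (Lab.β (hP.quot.labHom φ)) (hP.quot.fibMap x) (hP.quot.fibMap y) :=
    hP.quot.R_fibMap r
  have hx := hP.quot.fibInv_fibMap x
  have hy := hP.quot.fibInv_fibMap y
  have k : Lab.γ φ r ≍ Lab.γ φ (hP.quot.R_fibInv h₁) := Lab.γ_heq φ hx.symm hy.symm _ _
  refine exists_eq_eqToHom_of_heq (congrArg z.h hx.symm) (congrArg z'.h hy.symm) k ?_
  obtain ⟨e', he'⟩ := Lab.eqToHom_γ e (h ▸ h₁)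
  exact ⟨e', (Lab.γ_congr h h₁ _).trans he'⟩

/-- Combining `exists_eqToHom_γ` with `exists_arrCell`, every arrow collapsed by the quotient is a
component of the 2-cell of arrows, which `h` makes an identity. This is the hypothesis of
`SurjFull.exists_desc`, applied for each `X`; 2-naturality is recovered afterwards. -/
theorem isCoidentifierEnd : TwoCat.IsCoidentifierEnd P.arrCell.pfun hP.quot.pfun where
  isId := hP.isId_quot
  desc R h hh := by
    rw [TwoCat.Modif.isId_iff] at hh
    have key : ∀ X, ∃ k : P.pi0.fobj X ⟶ R.obj X, hP.quot.app X ≫ k = h.app X := by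
      intro X
      obtain ⟨K, hK⟩ := (hP.surjFull_lab X).exists_desc (hP.faithful_lab X) (SlCat.Hom.F (h.app X))
        fun {z z'} φ e hφ => by
          obtain ⟨w, h₁, h₂, hw⟩ := exists_arrCell φ (hP.exists_eqToHom_γ φ e hφ)
          exact exists_eq_eqToHom_of_heq (congrArg (Hom.F (h.app X)).obj h₁.symm)
            (congrArg (Hom.F (h.app X)).obj h₂.symm)
            (map_heq rfl h₁.symm h₂.symm hw.symm) (hh X w)
      -- That `K` lies over `I` may be checked after composition with the quotient, where both
      -- projections become that of `P.fobj X`.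
      refine ⟨⟨K, (hP.surjFull_lab X).hom_ext ?_⟩, SlCat.Hom.ext hK⟩
      exact (congrArg (· ⋙ (R.obj X).π) hK).trans ((h.app X).w.trans (hP.quot.app X).w.symm)
    choose k hk using key
    obtain ⟨k', hk'⟩ := TwoCat.TwoNat.exists_of_comp (q := hP.quot.pfun) hP.surjFull_app h k hk
    exact ⟨k', hk', fun k'' hk'' =>
      TwoCat.TwoNat.comp_left_injective (q := hP.quot.pfun) hP.surjFull_app (hk''.trans hk'.symm)⟩
  desc₂ R k k' Θ := TwoCat.Modif.exists_of_whiskerLeft (q := hP.quot.pfun) hP.surjFull_app Θ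

end Rigid

end CatPoly

/-! ### From endo-2-functors to 2-monads -/

namespace TwoCat

open SlCat

variable {I : Type u}

theorem comp_heq_comp {C : Type u} [SmallCategory C] {a b c a' b' c' : C} {f : a ⟶ b} {g : b ⟶ c}
    {f' : a' ⟶ b'} {g' : b' ⟶ c'} (ha : a = a') (hb : b = b') (hc : c = c') (hf : f ≍ f')
    (hg : g ≍ g') : f ≫ g ≍ f' ≫ g' := by
  subst ha hb hc hf hg
  rfl

/-- The composition constraints of a strict pseudofunctor are `eqToHom`, so they disappear under
heterogeneous equality. -/
theorem cmp_map₂_whiskerLeft (F : StrictPseudofunctor (SlCat I) (SlCat I)) {X Y Z : SlCat I}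
    (f : X ⟶ Y) {g h : Y ⟶ Z} (α : g ⟶ h) (x : (F.obj X).C) :
    cmp (F.map₂ (f ◁ α)) x ≍ cmp (F.map₂ α) ((Hom.F (F.map f)).obj x) := by
  have e := cmp_eq_of_eq (F.map₂_whisker_left f α) x
  rw [F.mapComp_eq_eqToIso, F.mapComp_eq_eqToIso] at e
  rw [eqToIso.hom, eqToIso.inv, cmp_comp, cmp_comp, cmp_eqToHom, cmp_eqToHom] at e
  rw [e]
  exact (eqToHom_comp_heq _ _).trans (comp_eqToHom_heq _ _)

variable {G Q R : TwoMonad (SlCat I)} {q : TwoNat G.T Q.T}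

/-- The unit of `Q` is that of `G` followed by `q`, so the unit condition is inherited directly. The
multiplication condition concerns 1-cells out of `Q Q X`, and is tested after the map from `G G X`
that applies `q` at both levels; this is why `G.T.map (q.app X)` must also be full and surjective on
objects. -/
theorem IsMonadMor.of_comp (hq : IsMonadMor G Q q) (hs : ∀ X, SurjFull (Hom.F (q.app X)))
    (hs' : ∀ X, SurjFull (Hom.F (G.T.map (q.app X)))) {k : TwoNat Q.T R.T}
    (hk : IsMonadMor G R (q.comp k)) : IsMonadMor Q R k where
  unit X := by
    rw [← hq.unit, Strict.assoc]
    exact hk.unit X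
  mult X := by
    refine epi_hom_ext (f := G.T.map (q.app X) ≫ q.app (Q.T.obj X)) ((hs' X).comp (hs _)) ?_
    have h : multApp G.μ X ≫ q.app X ≫ k.app X =
      (G.T.map (q.app X ≫ k.app X) ≫ q.app (R.T.obj X) ≫ k.app (R.T.obj X)) ≫ multApp R.μ X :=
      hk.mult X
    rw [← Strict.assoc, ← hq.mult, Strict.assoc, h, StrictPseudofunctor.map_comp]
    have hn := q.naturality (k.app X)
    simp only [Strict.assoc]
    rw [← Strict.assoc (q.app _) (Q.T.map _), ← hn]
    simp only [Strict.assoc]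

/-- The argument of `IsMonadMor.of_comp` one dimension higher: the equations are between components,
so it is enough to reach every relevant object from `G`, by the unit of `G` or from `G G X`. -/
theorem IsMonadCell.of_whiskerLeft (hq : IsMonadMor G Q q)
    (hs : ∀ X, SurjFull (Hom.F (q.app X))) (hs' : ∀ X, SurjFull (Hom.F (G.T.map (q.app X))))
    {k k' : TwoNat Q.T R.T} (hk : IsMonadMor Q R k) (hk' : IsMonadMor Q R k') {Ξ : Modif k k'}
    (h : IsMonadCell (hq.comp hk) (hq.comp hk') (Ξ.whiskerLeft q)) : IsMonadCell hk hk' Ξ where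
  unit X := by
    have hx : ∀ X x, (Hom.F (unitApp Q.η X)).obj x =
        (Hom.F (q.app X)).obj ((Hom.F (unitApp G.η X)).obj x) := fun X x =>
      (Functor.congr_obj (congrArg Hom.F (hq.unit X)) x).symm
    refine cell_ext fun x => ?_
    have hu := cmp_eq_of_eq (h.unit X) x
    rw [cmp_comp, cmp_eqToHom, cmp_eqToHom] at hu ⊢
    rw [comp_eqToHom_iff, eqToHom_trans] at hu
    obtain ⟨e, he⟩ := exists_eq_eqToHom_of_heq (congrArg (Hom.F (k.app X)).obj (hx X x))
      (congrArg (Hom.F (k'.app X)).obj (hx X x)) (cmp_congr (Ξ.app X) (hx X x)) ⟨_, hu⟩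
    rw [comp_eqToHom_iff, eqToHom_trans]
    exact he
  mult X := by
    refine cell_ext fun y => ?_
    -- Applying `q` at both levels reaches every object of `Q Q X` from `G G X`.
    obtain ⟨x, rfl⟩ := ((hs' X).comp (hs _)).surj y
    have hm := cmp_eq_of_eq (h.mult X) x
    rw [cmp_comp, cmp_comp, cmp_eqToHom, cmp_eqToHom, comp_eqToHom_eq_iff_heq] at hm ⊢
    rw [cmp_whiskerRight, cmp_comp] at hm ⊢
    have hμ := Functor.congr_obj (congrArg Hom.F (hq.mult X)) x
    refine (cmp_congr (Ξ.app X) hμ.symm).trans (hm.trans ?_)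
    let w := (Hom.F (G.T.map (q.app X))).obj x
    have hG : ∀ f : Q.T.obj X ⟶ R.T.obj X,
        (Hom.F (G.T.map (q.app X ≫ f))).obj x = (Hom.F (G.T.map f)).obj w := fun f =>
      Functor.congr_obj (congrArg Hom.F (G.T.map_comp (q.app X) f)) x
    have hQ : ∀ f : Q.T.obj X ⟶ R.T.obj X, (Hom.F (q.app (R.T.obj X))).obj
        ((Hom.F (G.T.map f)).obj w) = (Hom.F (Q.T.map f)).obj ((Hom.F (q.app _)).obj w) :=
      fun f => Functor.congr_obj (congrArg Hom.F (q.naturality f)) w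
    have hGQ := fun f => (congrArg (Hom.F (q.app (R.T.obj X))).obj (hG f)).trans (hQ f)
    -- The inner component is rewritten in two moves: `G` preserves whiskering by `q`, and
    -- 2-naturality of `q` exchanges the action of `G` on `Ξ` for that of `Q`.
    have h₁ : (Hom.F (q.app (R.T.obj X))).map (cmp (G.T.map₂ (q.app X ◁ Ξ.app X)) x) ≍
        cmp (Q.T.map₂ (Ξ.app X)) ((Hom.F (q.app (Q.T.obj X))).obj w) :=
      (map_heq rfl (hG _) (hG _) (cmp_map₂_whiskerLeft G.T (q.app X) (Ξ.app X) x)).trans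
        (q.map_cmp (Ξ.app X) w)
    refine map_heq rfl (congrArg (Hom.F (k.app _)).obj (hGQ _))
      (congrArg (Hom.F (k'.app _)).obj (hGQ _)) (comp_heq_comp
        (congrArg (Hom.F (k.app _)).obj (hGQ _)) (congrArg (Hom.F (k.app _)).obj (hGQ _))
        (congrArg (Hom.F (k'.app _)).obj (hGQ _)) ?_ ?_)
    · exact map_heq (F := k.app (R.T.obj X)) rfl (hGQ _) (hGQ _) h₁
    · exact cmp_congr (Ξ.app (R.T.obj X)) (hGQ _)

/-- Existence and uniqueness come from the endo-2-functor level; the only new point is that what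
descends respects the monad structures, which is the content of the two preceding results. -/
theorem IsCoidentifierEnd.isCoidentifierMnd {F : StrictPseudofunctor (SlCat I) (SlCat I)}
    {φ ψ : TwoNat F G.T} {Γ : Modif φ ψ} (hc : IsCoidentifierEnd Γ q) (hq : IsMonadMor G Q q)
    (hs : ∀ X, SurjFull (Hom.F (q.app X))) (hs' : ∀ X, SurjFull (Hom.F (G.T.map (q.app X)))) :
    IsCoidentifierMnd (G := G) Γ q where
  isMor := hq
  isId := hc.isId
  desc R h hh hΓ := by
    obtain ⟨k, rfl, hk⟩ := hc.desc R.T h hΓ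
    exact ⟨k, ⟨hq.of_comp hs hs' hh, rfl⟩, fun k' hk' => hk k' hk'.2⟩
  desc₂ R k k' hk hk' Θ hΘ := by
    obtain ⟨Ξ, rfl, hΞ⟩ := hc.desc₂ R.T k k' Θ
    exact ⟨Ξ, ⟨.of_whiskerLeft hq hs hs' hk hk' hΘ, rfl⟩, fun Ξ' h => hΞ Ξ' h.2⟩

end TwoCat

/-! ### The main theorem -/

theorem mainTheorem10 {I : Type u} (T : Operad I) (hT : T.SigmaFree) :
    IsPullback (CatPoly.conn T.poly.E).toCatHom T.poly.p.toCatHom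
      T.poly.pi0.p.toCatHom (CatPoly.conn T.poly.B).toCatHom ∧
    ∃ q : CatPoly.Hom T.poly T.poly.pi0,
      q.f₁ = CatPoly.conn T.poly.B ∧ q.f₂ = CatPoly.conn T.poly.E ∧
      ∃ M : CatPoly.Mon T.poly.pi0,
        CatPoly.IsMonMor T.mon M q ∧
        (∀ M' : CatPoly.Mon T.poly.pi0, CatPoly.IsMonMor T.mon M' q → M' = M) ∧
        TwoCat.IsMonadMor T.mon.pfun M.pfun q.pfun ∧
        T.IsModSigma M.pfun q.pfun := by
  have hP := Operad.SigmaFree.rigid hT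
  have hM := hP.isMonMor_quot T.mon
  refine ⟨hP.isPullback, hP.quot, rfl, rfl, hP.mon T.mon, hM, fun M' hM' => hP.mon_unique hM' hM,
    hM.pfun, ?_, hP.isCoidentifierEnd⟩
  -- The extra hypothesis, about the 2-functor of `T` applied to the quotient, holds because
  -- relabelling preserves fullness and surjectivity on objects.
  exact hP.isCoidentifierEnd.isCoidentifierMnd (G := T.mon.pfun) (Q := (hP.mon T.mon).pfun) hM.pfun
    hP.surjFull_app fun X => CatPoly.surjFull_map T.poly (hP.surjFull_app X)
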